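/- Let $f:\mathbb R^2\to\mathbb R$ be smooth, $2\pi$-periodic in $y$ and zero for $|x|>X$ (with $X>0$), and let $0<\beta<1/2$ be fixed. Put $f_j(x)=\int_0^{2\pi}e^{-ijy}f(x,y)\,dy$, $\tilde f_j(\xi)=\int_{\mathbb R} e^{-i\xi x}f_j(x)\,dx$, $\kappa=\sqrt{1-2\beta}$, $\gamma(\mu)=\frac{(1-\beta)^2-\mu^2}{4\pi}$, $\gamma=\gamma(0)$, $d_\pm=\tilde f_1(\pm\kappa)$ and $$\Gamma=\frac{\gamma^2}{\kappa}\bigl(|d_+|^2+|d_-|^2\bigr),\qquad W(z)=\frac{i}{z-i\Gamma/2}.$$ *Scattering problem.* For $\varepsilon>0$ and small $\mu>0$ put $\omega^2=(1-\beta)^2-\mu^2$, $k_0=\sqrt{\omega^2-\beta^2}$, $\Pi=\mathbb R\times(0,2\pi)$. Test functions are the smooth functions $\Phi$ on $\overline\Pi$ that vanish for large $|x|$ and satisfy $\Phi(x,2\pi)=e^{2\pi i\beta}\Phi(x,0)$, $\Phi_y(x,2\pi)=e^{2\pi i\beta}\Phi_y(x,0)$; $H_1^\beta(\Pi)$ is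 their completion in the norm $\|\Phi\|_{L^2(\Pi)}+\|\nabla\Phi\|_{L^2(\Pi)}$. The numbers $\mathcal R,\mathcal T\in\mathbb C$ are reflection and transmission coefficients if there is a $\Psi$ with $$\Psi-\chi(x)\,\mathcal T e^{i\beta y+ik_0x}-\chi(-x)\bigl(e^{i\beta y+ik_0x}+\mathcal R e^{i\beta y-ik_0x}\bigr)\in H_1^\beta(\Pi)$$ ($\chi$ a smooth cut-off, $\chi=0$ for $x\le0$ and $\chi=1$ for $x\ge1$) and $\int_\Pi\nabla\Psi\cdot\nabla\overline\Phi=\omega^2\int_\Pi(1+\varepsilon f)\Psi\overline\Phi$ for all test functions $\Phi$. *Resonance.* For small complex $\mu$ put $k_0=(1-2\beta-\mu^2)^{1/2}$ and $k_m=((\beta+m)^2-(1-\beta)^2+\mu^2)^{1/2}$ for $m\ne0,-1$ (principal branches); $H_0(x)=\frac{i}{2k_0}e^{ik_0|x|}$, $H_{-1}(x)=\frac{e^{-\mu|x|}-1}{2\mu}$ (equal to $-|x|/2$ for $\mu=0$), and $H_m(x)=\frac{1}{2k_m}e^{-k_m|x|}$ otherwise. On the space $\mathcal A=\ell^2(\mathbb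 Z;C[-X,X])$ let $(\hat T\mathbf A)_m=2\gamma(\mu)\sum_{n\in\mathbb Z}(H_n*A_n)f_{m-n}$, where each $A_n$ is extended by zero outside $[-X,X]$ in the convolution, and let $F(\varepsilon,\mu)=\int_{-X}^{X}\bigl((1-\varepsilon\hat T)^{-1}\mathbf g\bigr)_{-1}(x)\,dx$ with $(\mathbf g)_m=f_{m+1}$. Let $\nu_0(\varepsilon)$ be the root of $$\nu-\gamma(\varepsilon\nu)\,F(\varepsilon,\varepsilon\nu)=0$$ for which $\varepsilon\nu_0(\varepsilon)\to0$ as $\varepsilon\to0^+$. **Theorem.** Let $\Gamma\neq0$. Such a root $\nu_0(\varepsilon)$, defined for all small $\varepsilon>0$, exists. Let $\nu_0$ be any such root and let $\delta_0(\varepsilon)$ satisfy $\varepsilon\delta_0(\varepsilon)^2\to0$ as $\varepsilon\to0^+$. Then, for all sufficiently small $\varepsilon>0$ and all $\delta\in(-\delta_0(\varepsilon),\delta_0(\varepsilon))$ such that $\nu=\operatorname{Re}\nu_0(\varepsilon)+\delta>0$, the scattering problem with $\mu=\varepsilon\nu$ has a solution, its coefficients $\mathcal R,\mathcal T$ are uniquely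 determined, and $$\mathcal R=W\Bigl(\frac\delta\varepsilon\Bigr)\Bigl(\frac{\gamma^2}{\kappa}\,\overline{d_+}\,d_-+\delta\,\overline{\tilde f_0(2\kappa)}\,\frac{\gamma}{\kappa}+O(\varepsilon+\varepsilon\delta^2)\Bigr),$$ $$\mathcal T=W\Bigl(\frac\delta\varepsilon\Bigr)\Bigl(\frac{\delta}{i\varepsilon}+\frac{\gamma^2}{2\kappa}\bigl(|d_+|^2-|d_-|^2\bigr)+\delta\,\tilde f_0(0)\,\frac{\gamma}{\kappa}+O(\varepsilon+\varepsilon\delta^2)\Bigr).$$ If moreover $f(-x,y)=f(x,y)$ and $f(x,-y)=f(x,y)$, then $$|\mathcal R|^2=\frac{\varepsilon^2\Gamma^2/4}{\delta^2+\varepsilon^2\Gamma^2/4}+O(\varepsilon).$$ The $O$-constants do not depend on $\varepsilon$ and $\delta$. -/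

import Mathlib

open Filter Topology MeasureTheory Set
open scoped ContDiff ComplexConjugate ENNReal

noncomputable section

namespace PeriodicScattering

/-! ### The perturbation and its Fourier data -/

/-- `f_j(x) = ∫_0^{2π} e^{-ijy} f(x,y) dy`. -/
def fourierCoef (f : ℝ × ℝ → ℝ) (j : ℤ) (x : ℝ) : ℂ :=
  ∫ y in (0 : ℝ)..(2 * Real.pi), Complex.exp (-Complex.I * j * y) * (f (x, y) : ℂ)

/-- `f̃_j(ξ) = ∫_ℝ e^{-iξx} f_j(x) dx`. -/
def fourierHat (f : ℝ × ℝ → ℝ) (j : ℤ) (ξ : ℝ) : ℂ :=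
  ∫ x : ℝ, Complex.exp (-Complex.I * ξ * x) * fourierCoef f j x

/-- `κ = √(1 - 2β)`, the wave number of the propagating mode at the second threshold. -/
def kappa (β : ℝ) : ℝ := Real.sqrt (1 - 2 * β)

/-- `γ(0,β) = (1-β)²/(4π)`. -/
def gammaZero (β : ℝ) : ℝ := (1 - β) ^ 2 / (4 * Real.pi)

/-- `Γ = γ(0,β)² (|f̃_1(κ)|² + |f̃_1(-κ)|²) / κ`. -/
def width (f : ℝ × ℝ → ℝ) (β : ℝ) : ℝ :=
  gammaZero β ^ 2 / kappa β *
    (‖fourierHat f 1 (kappa β)‖ ^ 2 + ‖fourierHat f 1 (-kappa β)‖ ^ 2)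

/-- `W(z) = i / (z - iΓ/2)`. -/
def breitWigner (G : ℝ) (z : ℝ) : ℂ := Complex.I / ((z : ℂ) - Complex.I * G / 2)

/-! ### The scattering problem -/

/-- The strip `Π = ℝ × (0, 2π)`. -/
def strip : Set (ℝ × ℝ) := (univ : Set ℝ) ×ˢ Ioo (0 : ℝ) (2 * Real.pi)

/-- Partial derivative in the first variable. -/
def dX (φ : ℝ × ℝ → ℂ) (p : ℝ × ℝ) : ℂ := fderiv ℝ φ p (1, 0)

/-- Partial derivative in the second variable. -/
def dY (φ : ℝ × ℝ → ℂ) (p : ℝ × ℝ) : ℂ := fderiv ℝ φ p (0, 1)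

/-- Smooth functions on the closed strip that vanish for large `|x|` and satisfy the
quasiperiodic boundary conditions
`φ(x,2π) = e^{2πiβ} φ(x,0)`, `φ_y(x,2π) = e^{2πiβ} φ_y(x,0)`. -/
structure IsTestFunction (β : ℝ) (φ : ℝ × ℝ → ℂ) : Prop where
  smooth : ContDiff ℝ ∞ φ
  vanish : ∃ L : ℝ, ∀ x y : ℝ, L < |x| → y ∈ Icc (0 : ℝ) (2 * Real.pi) → φ (x, y) = 0
  bc : ∀ x : ℝ, φ (x, 2 * Real.pi) = Complex.exp (2 * Real.pi * Complex.I * β) * φ (x, 0)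
  bc_dy : ∀ x : ℝ,
    dY φ (x, 2 * Real.pi) = Complex.exp (2 * Real.pi * Complex.I * β) * dY φ (x, 0)

/-- `u`, with gradient `(ux, uy)`, belongs to the space `H_1^β(Π)`, the completion of the test
functions in the norm `‖u‖_{L²(Π)} + ‖∇u‖_{L²(Π)}`. -/
structure MemH1 (β : ℝ) (u ux uy : ℝ × ℝ → ℂ) : Prop where
  memLp : MemLp u 2 (volume.restrict strip)
  memLp_dx : MemLp ux 2 (volume.restrict strip)
  memLp_dy : MemLp uy 2 (volume.restrict strip)
  approx : ∃ φ : ℕ → ℝ × ℝ → ℂ, (∀ k, IsTestFunction β (φ k)) ∧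
    Tendsto (fun k => eLpNorm (fun p => φ k p - u p) 2 (volume.restrict strip)) atTop (𝓝 0) ∧
    Tendsto (fun k => eLpNorm (fun p => dX (φ k) p - ux p) 2 (volume.restrict strip))
      atTop (𝓝 0) ∧
    Tendsto (fun k => eLpNorm (fun p => dY (φ k) p - uy p) 2 (volume.restrict strip))
      atTop (𝓝 0)

/-- `ω² = ω_1² - μ² = (1-β)² - μ²`. -/
def omegaSq (β μ : ℝ) : ℝ := (1 - β) ^ 2 - μ ^ 2

/-- `k_0 = √(ω² - β²)`. -/
def waveNumber (β μ : ℝ) : ℝ := Real.sqrt (omegaSq β μ - β ^ 2)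

/-- The plane wave `e^{iβy + ikx}`. -/
def planeWave (β k : ℝ) (p : ℝ × ℝ) : ℂ :=
  Complex.exp (Complex.I * β * p.2 + Complex.I * k * p.1)

/-- The prescribed behaviour at infinity,
`χ(x) 𝓣 e^{iβy+ik₀x} + χ(-x) (e^{iβy+ik₀x} + 𝓡 e^{iβy-ik₀x})`, where `χ` is a smooth cut-off
function equal to `0` for `x ≤ 0` and to `1` for `x ≥ 1`. -/
def farField (β μ : ℝ) (Rc Tc : ℂ) (p : ℝ × ℝ) : ℂ :=
  (Real.smoothTransition p.1 : ℂ) * (Tc * planeWave β (waveNumber β μ) p) +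
    (Real.smoothTransition (-p.1) : ℂ) *
      (planeWave β (waveNumber β μ) p + Rc * planeWave β (-waveNumber β μ) p)

/-- `Ψ`, with weak gradient `(Ψx, Ψy)`, solves the scattering problem for
`-ΔΨ = ω² (1 + ε f) Ψ` in the strip with the quasiperiodic boundary conditions, a plane wave
incident from the left, reflection coefficient `Rc` and transmission coefficient `Tc`. -/
structure IsScatteringSolution (f : ℝ × ℝ → ℝ) (β ε μ : ℝ) (Rc Tc : ℂ)
    (Ψ Ψx Ψy : ℝ × ℝ → ℂ) : Prop where
  remainder : MemH1 β (fun p => Ψ p - farField β μ Rc Tc p)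
    (fun p => Ψx p - dX (farField β μ Rc Tc) p) (fun p => Ψy p - dY (farField β μ Rc Tc) p)
  identity : ∀ Φ : ℝ × ℝ → ℂ, IsTestFunction β Φ →
    ∫ p in strip, (Ψx p * conj (dX Φ p) + Ψy p * conj (dY Φ p)) =
      (omegaSq β μ : ℂ) * ∫ p in strip, (1 + (ε : ℂ) * (f p : ℂ)) * Ψ p * conj (Φ p)

/-- `Rc` and `Tc` are the coefficients of a solution of the scattering problem. -/
def AreScatteringCoefficients (f : ℝ × ℝ → ℝ) (β ε μ : ℝ) (Rc Tc : ℂ) : Prop :=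
  ∃ Ψ Ψx Ψy : ℝ × ℝ → ℂ, IsScatteringSolution f β ε μ Rc Tc Ψ Ψx Ψy

/-! ### The dispersion relation, for complex `μ` -/

/-- `γ(μ,β) = ((1-β)² - μ²)/(4π)`. -/
def gammaC (β : ℝ) (μ : ℂ) : ℂ := ((1 - (β : ℂ)) ^ 2 - μ ^ 2) / (4 * Real.pi)

/-- `k_0 = (1 - 2β - μ²)^{1/2}` and, for `m ≠ 0`, `k_m = ((β+m)² - (1-β)² + μ²)^{1/2}`
(used for `m ≠ -1`), with the principal branch. -/
def modeNumber (β : ℝ) (μ : ℂ) (m : ℤ) : ℂ :=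
  if m = 0 then (1 - 2 * (β : ℂ) - μ ^ 2) ^ (1 / 2 : ℂ)
  else (((β : ℂ) + m) ^ 2 - (1 - (β : ℂ)) ^ 2 + μ ^ 2) ^ (1 / 2 : ℂ)

/-- The kernels `H_n`: the outgoing Green function `i e^{ik_0|x|}/(2k_0)` for `n = 0`, the
regularized Green function `(e^{-μ|x|} - 1)/(2μ)` (equal to `-|x|/2` at `μ = 0`) for `n = -1`,
and the decaying Green function `e^{-k_n|x|}/(2k_n)` otherwise. -/
def kernelH (β : ℝ) (μ : ℂ) (n : ℤ) (x : ℝ) : ℂ :=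
  if n = 0 then
    Complex.I / (2 * modeNumber β μ 0) * Complex.exp (Complex.I * modeNumber β μ 0 * (|x| : ℝ))
  else if n = -1 then
    if μ = 0 then -((|x| : ℝ) : ℂ) / 2 else (Complex.exp (-μ * (|x| : ℝ)) - 1) / (2 * μ)
  else 1 / (2 * modeNumber β μ n) * Complex.exp (-modeNumber β μ n * (|x| : ℝ))

/-- The Banach space `𝒜` of square summable sequences `(A_n)_{n ∈ ℤ}` in `C[-X, X]`. -/
abbrev SeqSpace (X : ℝ) : Type := lp (fun _ : ℤ => C(Icc (-X) X, ℂ)) 2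

/-- The components of `T̂ A`: `(T̂ A)_m = 2γ Σ_n (H_n * A_n) f_{m-n}`. -/
def operatorT (f : ℝ × ℝ → ℝ) (X β : ℝ) (μ : ℂ) (A : SeqSpace X) (m : ℤ) (x : Icc (-X) X) : ℂ :=
  2 * gammaC β μ * ∑' n : ℤ,
    (∫ ξ : Icc (-X) X, kernelH β μ n ((x : ℝ) - (ξ : ℝ)) * A n ξ ∂(volume.comap Subtype.val)) *
      fourierCoef f (m - n) x

/-- `Y = (1 - ε T̂)⁻¹ g⁽²⁾`, where `(g⁽²⁾)_m = f_{m+1}`. -/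
def IsResolventOfG2 (f : ℝ × ℝ → ℝ) (X β ε : ℝ) (μ : ℂ) (Y : SeqSpace X) : Prop :=
  ∀ (m : ℤ) (x : Icc (-X) X),
    Y m x - (ε : ℂ) * operatorT f X β μ Y m x = fourierCoef f (m + 1) x

/-- `ν` solves `ν - γ(εν,β) F(ε,εν,β) = 0`, where `F(ε,μ,β) = ⟨((1 - ε T̂)⁻¹ g⁽²⁾)_{-1}⟩` and
`⟨h⟩ = ∫ h(x) dx`. -/
def IsDispersionRoot (f : ℝ × ℝ → ℝ) (X β ε : ℝ) (ν : ℂ) : Prop :=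
  ∃ Y : SeqSpace X, IsResolventOfG2 f X β ε ((ε : ℂ) * ν) Y ∧
    ν - gammaC β ((ε : ℂ) * ν) * (∫ x : Icc (-X) X, Y (-1) x ∂(volume.comap Subtype.val)) = 0

/-- `ε ↦ ν₀(ε)` is the root of the dispersion relation for which `μ₀(ε) = ε ν₀(ε)` tends to zero
as `ε → 0`. -/
structure IsResonance (f : ℝ × ℝ → ℝ) (X β : ℝ) (ν₀ : ℝ → ℂ) : Prop where
  root : ∀ᶠ ε in 𝓝[>] (0 : ℝ), IsDispersionRoot f X β ε (ν₀ ε)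
  tendsto : Tendsto (fun ε : ℝ => (ε : ℂ) * ν₀ ε) (𝓝[>] (0 : ℝ)) (𝓝 0)

end PeriodicScattering

end

open PeriodicScattering

/-! Expand a solution in the modes `quasiMode β n`, let `a_n` be its amplitudes and `A_m = Σ_n a_n
f_{m-n}` the source produced by `f`. Since `4πγ = ω²`, the equation becomes `a_n'' = ((β+n)² - ω²)
a_n - 2γε A_n`. Hence `a_n` is the incident wave (for `n = 0` only) plus `2γε` times the convolution
of `A_n` with the outgoing or decaying Green function, and inserting this into the definition of `A`
gives a closed linear system. Conversely a solution `A` of that system yields a scattering solution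
(`areScatteringCoefficients_of_source`), and the coefficients are read off from `a_0` beyond the
support of `f`.

As `μ → 0` every Green function stays bounded except that of mode `-1`, which is `H_{-1} + 1/(2μ)`.
The singular constant sees `A` only through `⟨A_{-1}⟩`. With `μ = εν` this leads to `A = y₁ + c y₂`,
where `y₁` and `y₂` are the images under `(1 - εT)⁻¹` of the sequences `f_m e^{ik₀x}` and `f_{m+1}`,
and where `c (ν - γF) = γ⟨(y₁)_{-1}⟩` (`areScatteringCoefficients_of_dispersion`). The function
`dispersion` is `γF`. The operator `T` is bounded and Lipschitz for small complex `μ`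
(`exists_operatorFamily`), so all inverses are Neumann series.

The resonance is a fixed point of `ν ↦ γF(ε, εν)`, a contraction for small `ε`. Its leading term is
real. At the next order all kernels at `μ = 0` are real except that of the open channel `n = 0`, so
`Im ν₀ = εΓ/2 + O(ε²)` (`im_secondOrder`, `IsResonance.bounds`). At `ν = Re ν₀ + δ` the denominator
`ν - γF` is therefore `(δ - iεΓ/2)(1 + O(ε))`. The error is relative because `Γ > 0` bounds `|δ -
iεΓ/2|` below by `εΓ/2` (`nearConst_denominator`). All other ingredients are constants up to `O(ε)`,
because `μ² = O(ε)` in the whole parameter range; this gives `exists_amplitude_expansion`. In `𝓣`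
the incident wave is absorbed through `1 = W(δ/ε)(δ/(iε) - Γ/2)`. When `f` is even in `x`, the
leading coefficient of `𝓡` has modulus `Γ/2`, which gives the Lorentzian (`lorentzian_bound`).

Uniqueness concerns the coefficients, not `Ψ`: the difference of two solutions has no incident part,
and a weak form of flux conservation makes its outgoing amplitudes vanish (`eq_zero_of_outgoing`).
Trapped modes need not be excluded. -/

noncomputable section

namespace PeriodicScattering

section

/-! ### Fourier coefficients of the perturbation -/

/-- Smooth functions that are `2π`-periodic in `y` and vanish for `|x| > X`. -/
structure IsPerturbation (f : ℝ × ℝ → ℝ) (X : ℝ) : Prop where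
  pos : 0 < X
  smooth : ContDiff ℝ ∞ f
  per : ∀ x y : ℝ, f (x, y + 2 * Real.pi) = f (x, y)
  supp : ∀ x y : ℝ, X < |x| → f (x, y) = 0

variable {f : ℝ × ℝ → ℝ} {X : ℝ}

/-- Closure of the class under `∂_y` lets the sup bound for `f` be used for `∂_y² f` too, which
yields the quadratic decay of the Fourier coefficients. -/
theorem IsPerturbation.deriv_y (h : IsPerturbation f X) :
    IsPerturbation (fun p => fderiv ℝ f p (0, 1)) X where
  pos := h.pos
  smooth := (h.smooth.fderiv_right (m := ∞) (by simp)).clm_apply contDiff_const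
  per x y := by
    have e : (fun p : ℝ × ℝ => f (p + (0, 2 * Real.pi))) = f := by
      funext p
      obtain ⟨a, b⟩ := p
      simpa using h.per a b
    have := fderiv_comp_add_right (𝕜 := ℝ) (f := f) (x := (x, y)) (0, 2 * Real.pi)
    rw [e] at this
    simp only [Prod.mk_add_mk, add_zero] at this
    simp [this]
  supp x y hx := by
    have ho : IsOpen {p : ℝ × ℝ | X < |p.1|} := isOpen_lt continuous_const (by fun_prop)
    have he : f =ᶠ[𝓝 (x, y)] fun _ => (0 : ℝ) := by
      filter_upwards [ho.mem_nhds (show (x, y) ∈ {p : ℝ × ℝ | X < |p.1|} from hx)] with p hp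
      exact h.supp p.1 p.2 hp
    simp [he.fderiv_eq]

theorem IsPerturbation.hasDerivAt_y (h : IsPerturbation f X) (x y : ℝ) :
    HasDerivAt (fun y => f (x, y)) (fderiv ℝ f (x, y) (0, 1)) y := by
  have h1 : HasFDerivAt f (fderiv ℝ f (x, y)) (x, y) :=
    ((h.smooth.differentiable (by simp)) (x, y)).hasFDerivAt
  exact h1.comp_hasDerivAt y ((hasDerivAt_const y x).prodMk (hasDerivAt_id y))

theorem IsPerturbation.bounded (h : IsPerturbation f X) : ∃ C, 0 ≤ C ∧ ∀ p, |f p| ≤ C := by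
  have hK : IsCompact (Icc (-X) X ×ˢ Icc (0 : ℝ) (2 * Real.pi)) := isCompact_Icc.prod isCompact_Icc
  obtain ⟨C, hC⟩ := hK.exists_bound_of_continuousOn h.smooth.continuous.continuousOn
  refine ⟨max C 0, le_max_right _ _, fun p => ?_⟩
  obtain ⟨x, y⟩ := p
  by_cases hx : |x| ≤ X
  · have hp : Function.Periodic (fun y => f (x, y)) (2 * Real.pi) := h.per x
    obtain ⟨z, hz, e⟩ := hp.exists_mem_Ico₀ Real.two_pi_pos y
    rw [e]
    exact (hC (x, z) ⟨abs_le.mp hx, hz.1, hz.2.le⟩).trans (le_max_left _ _)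
  · rw [h.supp x y (not_le.mp hx)]
    simp

theorem continuous_fourierCoef (hf : Continuous f) (j : ℤ) : Continuous (fourierCoef f j) := by
  unfold fourierCoef
  apply intervalIntegral.continuous_parametric_intervalIntegral_of_continuous'
  have : Continuous fun p : ℝ × ℝ => f (p.1, p.2) := by simpa using hf
  simp only [Function.uncurry_def]
  fun_prop

/-- The support condition concerns `|x| > X`; continuity adds the endpoints. They matter: a source
proportional to the `f_j` then extends by zero to a continuous function on the line. -/
theorem IsPerturbation.fourierCoef_eq_zero (h : IsPerturbation f X) (j : ℤ) {x : ℝ}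
    (hx : X ≤ |x|) : fourierCoef f j x = 0 := by
  have h0 : ∀ x : ℝ, X < |x| → fourierCoef f j x = 0 := by
    intro x hx
    simp [fourierCoef, h.supp x _ hx]
  have hcl : IsClosed {x : ℝ | fourierCoef f j x = 0} :=
    isClosed_eq (continuous_fourierCoef h.smooth.continuous j) continuous_const
  rcases hx.lt_or_eq with hlt | heq
  · exact h0 x hlt
  · have hne : x ≠ 0 := by
      rintro rfl
      have := h.pos
      simp at heq
      linarith
    have ht : Tendsto (fun t : ℝ => t * x) (𝓝[>] 1) (𝓝 x) := by
      have : Tendsto (fun t : ℝ => t * x) (𝓝 1) (𝓝 (1 * x)) :=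
        (continuous_id.mul continuous_const).tendsto 1
      rw [one_mul] at this
      exact this.mono_left nhdsWithin_le_nhds
    refine hcl.mem_of_tendsto ht ?_
    filter_upwards [self_mem_nhdsWithin] with t ht1
    apply h0
    have ht1 : (1 : ℝ) < t := ht1
    rw [abs_mul, abs_of_pos (by linarith), ← heq]
    have := h.pos
    nlinarith

theorem IsPerturbation.norm_fourierCoef_le {C : ℝ} (hC : ∀ p, |f p| ≤ C) (j : ℤ) (x : ℝ) :
    ‖fourierCoef f j x‖ ≤ 2 * Real.pi * C := by
  have := intervalIntegral.norm_integral_le_of_norm_le_const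
    (f := fun y => Complex.exp (-Complex.I * j * y) * (f (x, y) : ℂ)) (a := 0) (b := 2 * Real.pi)
    (C := C) (by
      intro y _
      have e : -Complex.I * j * y = ((-(j * y) : ℝ) : ℂ) * Complex.I := by push_cast; ring
      rw [norm_mul, e, Complex.norm_exp_ofReal_mul_I, one_mul, Complex.norm_real]
      exact hC _)
  rw [sub_zero, abs_of_pos Real.two_pi_pos] at this
  rw [mul_comm]
  exact this

theorem IsPerturbation.fourierCoef_deriv_y (h : IsPerturbation f X) (j : ℤ) (x : ℝ) :
    fourierCoef (fun p => fderiv ℝ f p (0, 1)) j x = Complex.I * j * fourierCoef f j x := by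
  unfold fourierCoef
  have hd := h.deriv_y
  have h1 : ∀ y ∈ uIcc 0 (2 * Real.pi), HasDerivAt (fun y : ℝ => Complex.exp (-Complex.I * j * y))
      (-Complex.I * j * Complex.exp (-Complex.I * j * y)) y := by
    intro y _
    have := (((hasDerivAt_id y).ofReal_comp).const_mul (-Complex.I * j)).cexp
    simpa [mul_comm] using this
  have h2 : ∀ y ∈ uIcc 0 (2 * Real.pi), HasDerivAt (fun y : ℝ => (f (x, y) : ℂ))
      (fderiv ℝ f (x, y) (0, 1) : ℂ) y := fun y _ => (h.hasDerivAt_y x y).ofReal_comp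
  have hc : Continuous fun y : ℝ => (fderiv ℝ f (x, y) (0, 1)) :=
    hd.smooth.continuous.comp (by fun_prop : Continuous fun y : ℝ => (x, y))
  rw [intervalIntegral.integral_mul_deriv_eq_deriv_mul h1 h2
    (Continuous.intervalIntegrable (by fun_prop) _ _)
    (Continuous.intervalIntegrable (by fun_prop) _ _)]
  have hp := h.per x 0
  rw [zero_add] at hp
  have e : Complex.exp (-Complex.I * j * ((2 * Real.pi : ℝ) : ℂ)) = 1 := by
    rw [Complex.exp_eq_one_iff]
    exact ⟨-j, by push_cast; ring⟩
  rw [hp, e, ← intervalIntegral.integral_const_mul]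
  simp only [Complex.ofReal_zero, mul_zero, Complex.exp_zero, sub_self, zero_sub]
  rw [← intervalIntegral.integral_neg]
  congr 1
  funext y
  ring

/-- Two integrations by parts in `y` bound `j² f_j` uniformly in `x`. The resulting summability
makes multiplication by `f` a bounded operator on mode sequences. -/
theorem IsPerturbation.exists_fourierCoef_bound (h : IsPerturbation f X) :
    ∃ C : ℝ, 0 ≤ C ∧ ∀ (j : ℤ) (x : ℝ), ‖fourierCoef f j x‖ ≤ C / (1 + (j : ℝ) ^ 2) := by
  obtain ⟨C₀, h0, hC₀⟩ := h.bounded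
  obtain ⟨C₂, h2, hC₂⟩ := h.deriv_y.deriv_y.bounded
  refine ⟨2 * Real.pi * (C₀ + C₂), by positivity, fun j x => ?_⟩
  have a0 := IsPerturbation.norm_fourierCoef_le hC₀ j x
  have a2 := IsPerturbation.norm_fourierCoef_le hC₂ j x
  rw [h.deriv_y.fourierCoef_deriv_y, h.fourierCoef_deriv_y, norm_mul, norm_mul, norm_mul, norm_mul,
    Complex.norm_I, one_mul, Complex.norm_intCast] at a2
  rw [le_div_iff₀ (by positivity)]
  have : |(j : ℝ)| * (|(j : ℝ)| * ‖fourierCoef f j x‖) = (j : ℝ) ^ 2 * ‖fourierCoef f j x‖ := by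
    rw [← mul_assoc, ← sq, sq_abs]
  rw [this] at a2
  linarith

theorem summable_one_div_one_add_sq : Summable fun j : ℤ => 1 / (1 + (j : ℝ) ^ 2) := by
  have h : Summable fun j : ℤ => 1 / (j : ℝ) ^ 2 := Real.summable_one_div_int_pow.mpr one_lt_two
  refine Summable.of_norm_bounded_eventually h ?_
  rw [Filter.eventually_cofinite]
  refine (Set.finite_singleton (0 : ℤ)).subset fun j hj => ?_
  by_contra hj0
  refine hj ?_
  have : (j : ℝ) ≠ 0 := by exact_mod_cast hj0
  rw [Real.norm_of_nonneg (by positivity)]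
  apply one_div_le_one_div_of_le (by positivity)
  linarith

theorem conj_fourierCoef (f : ℝ × ℝ → ℝ) (j : ℤ) (x : ℝ) :
    conj (fourierCoef f j x) = fourierCoef f (-j) x := by
  unfold fourierCoef
  rw [intervalIntegral.integral_of_le Real.two_pi_pos.le,
    intervalIntegral.integral_of_le Real.two_pi_pos.le, ← integral_conj]
  congr 1
  funext y
  simp [← Complex.exp_conj]

theorem IsPerturbation.hasSum_fourier (h : IsPerturbation f X) (x y : ℝ) :
    HasSum (fun j : ℤ => fourierCoef f j x * Complex.exp (Complex.I * j * y))
      (2 * Real.pi * (f (x, y) : ℂ)) := by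
  have : Fact (0 < 2 * Real.pi) := ⟨Real.two_pi_pos⟩
  have hp : Function.Periodic (fun y => (f (x, y) : ℂ)) (2 * Real.pi) := fun y => by
    simp [h.per x y]
  have hc : Continuous fun y => (f (x, y) : ℂ) := by
    have := h.smooth.continuous
    fun_prop
  let F : C(AddCircle (2 * Real.pi), ℂ) := ⟨hp.lift, continuous_coinduced_dom.mpr hc⟩
  have hF : ∀ y : ℝ, F y = f (x, y) := fun y => rfl
  have hcoef : ∀ j : ℤ, fourierCoeff F j = (1 / (2 * Real.pi) : ℝ) • fourierCoef f j x := by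
    intro j
    rw [fourierCoeff_eq_intervalIntegral _ _ 0, zero_add]
    congr 1
    unfold fourierCoef
    congr 1
    funext y
    rw [hF, smul_eq_mul, fourier_coe_apply]
    congr 2
    have : (Real.pi : ℂ) ≠ 0 := by exact_mod_cast Real.pi_ne_zero
    push_cast
    field_simp
  obtain ⟨C, hC0, hC⟩ := h.exists_fourierCoef_bound
  have hs : Summable (fourierCoeff F) := by
    refine Summable.of_norm_bounded (summable_one_div_one_add_sq.mul_left (1 / (2 * Real.pi) * C)) ?_
    intro j
    rw [hcoef, norm_smul, Real.norm_of_nonneg (by positivity), mul_assoc]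
    refine mul_le_mul_of_nonneg_left ((hC j x).trans_eq (by ring)) (by positivity)
  have := (has_pointwise_sum_fourier_series_of_summable hs (y : AddCircle (2 * Real.pi))).mul_left
    (2 * Real.pi : ℂ)
  rw [hF] at this
  refine this.congr_fun ?_ 
  intro j
  rw [hcoef, fourier_coe_apply]
  have : (Real.pi : ℂ) ≠ 0 := by exact_mod_cast Real.pi_ne_zero
  simp only [smul_eq_mul, Complex.real_smul]
  push_cast
  have e : 2 * (Real.pi : ℂ) * Complex.I * j * y / (2 * Real.pi) = Complex.I * j * y := by
    field_simp
  rw [e]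
  field_simp

end

section

/-! ### Operators on the sequence space -/

/-- Integration over `[-X, X]`. -/
abbrev intervalMeasure (X : ℝ) : Measure (Icc (-X) X) := volume.comap Subtype.val

theorem intervalMeasure_univ (X : ℝ) : intervalMeasure X univ = ENNReal.ofReal (2 * X) := by
  rw [intervalMeasure, comap_subtype_coe_apply measurableSet_Icc]
  simp only [image_univ, Subtype.range_coe_subtype]
  change volume (Icc (-X) X) = _
  rw [Real.volume_Icc]
  ring_nf

instance (X : ℝ) : IsFiniteMeasure (intervalMeasure X) :=
  ⟨by rw [intervalMeasure_univ]; exact ENNReal.ofReal_lt_top⟩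

theorem norm_integral_intervalMeasure_le {X M : ℝ} (hX : 0 ≤ X) {g : Icc (-X) X → ℂ}
    (hg : ∀ ξ, ‖g ξ‖ ≤ M) : ‖∫ ξ, g ξ ∂(intervalMeasure X)‖ ≤ 2 * X * M := by
  refine (norm_integral_le_of_norm_le_const (ae_of_all _ hg)).trans_eq ?_
  rw [measureReal_def, intervalMeasure_univ, ENNReal.toReal_ofReal (by positivity), mul_comm]

variable {X : ℝ}

theorem Icc_sub_abs_le (x ξ : Icc (-X) X) : |(x : ℝ) - ξ| ≤ 2 * X := by
  obtain ⟨x, hx⟩ := x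
  obtain ⟨ξ, hξ⟩ := ξ
  rw [abs_le]
  constructor <;> linarith [hx.1, hx.2, hξ.1, hξ.2]

/-- Convolution with a continuous kernel on `C[-X, X]`. -/
def convCLM (hX : 0 ≤ X) (h : C(ℝ, ℂ)) : C(Icc (-X) X, ℂ) →L[ℂ] C(Icc (-X) X, ℂ) :=
  have hint : ∀ (x : Icc (-X) X) (a : C(Icc (-X) X, ℂ)),
      Integrable (fun ξ : Icc (-X) X => h ((x : ℝ) - ξ) * a ξ) (intervalMeasure X) := fun x a =>
    Continuous.integrable_of_hasCompactSupport (by fun_prop) (HasCompactSupport.of_compactSpace _)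
  LinearMap.mkContinuousOfExistsBound
    { toFun := fun a => ⟨fun x => ∫ ξ, h ((x : ℝ) - ξ) * a ξ ∂(intervalMeasure X), by
        have := continuous_parametric_integral_of_continuous (μ := intervalMeasure X)
          (f := fun x ξ : Icc (-X) X => h ((x : ℝ) - ξ) * a ξ) (by fun_prop) isCompact_univ
        simpa using this⟩
      map_add' := fun a b => by
        ext x
        simp only [ContinuousMap.coe_mk, ContinuousMap.add_apply, mul_add]
        exact integral_add (hint x a) (hint x b)
      map_smul' := fun c a => by
        ext x
        simp only [ContinuousMap.coe_mk, ContinuousMap.smul_apply, smul_eq_mul, RingHom.id_apply]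
        rw [← integral_const_mul]
        congr 1
        funext ξ
        ring }
    (by
      obtain ⟨M, hM⟩ := (isCompact_Icc (a := -(2 * X)) (b := 2 * X)).exists_bound_of_continuousOn
        h.continuous.continuousOn
      have hM0 : 0 ≤ M := (norm_nonneg _).trans (hM 0 (by constructor <;> linarith))
      refine ⟨2 * X * M, fun a => (ContinuousMap.norm_le _ (by positivity)).mpr fun x => ?_⟩
      simp only [LinearMap.coe_mk, AddHom.coe_mk, ContinuousMap.coe_mk]
      rw [mul_assoc]
      refine norm_integral_intervalMeasure_le hX fun ξ => ?_
      rw [norm_mul]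
      exact mul_le_mul (hM _ (abs_le.mp (Icc_sub_abs_le x ξ))) (a.norm_coe_le_norm ξ)
        (norm_nonneg _) hM0)

theorem convCLM_apply (hX : 0 ≤ X) (h : C(ℝ, ℂ)) (a : C(Icc (-X) X, ℂ)) (x : Icc (-X) X) :
    convCLM hX h a x = ∫ ξ, h ((x : ℝ) - ξ) * a ξ ∂(intervalMeasure X) := rfl

theorem norm_convCLM_sub_le (hX : 0 ≤ X) (h h' : C(ℝ, ℂ)) {M : ℝ} (hM0 : 0 ≤ M)
    (hM : ∀ t, |t| ≤ 2 * X → ‖h t - h' t‖ ≤ M) : ‖convCLM hX h - convCLM hX h'‖ ≤ 2 * X * M := by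
  refine ContinuousLinearMap.opNorm_le_bound _ (by positivity) fun a => ?_
  refine (ContinuousMap.norm_le _ (by positivity)).mpr fun x => ?_
  have hint : ∀ h : C(ℝ, ℂ),
      Integrable (fun ξ : Icc (-X) X => h ((x : ℝ) - ξ) * a ξ) (intervalMeasure X) := fun h =>
    Continuous.integrable_of_hasCompactSupport (by fun_prop) (HasCompactSupport.of_compactSpace _)
  simp only [sub_apply, ContinuousMap.sub_apply, convCLM_apply]
  rw [← integral_sub (hint h) (hint h'), mul_assoc]
  refine norm_integral_intervalMeasure_le hX fun ξ => ?_
  rw [← sub_mul, norm_mul]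
  exact mul_le_mul (hM _ (Icc_sub_abs_le x ξ)) (a.norm_coe_le_norm ξ) (norm_nonneg _) hM0

theorem norm_convCLM_le (hX : 0 ≤ X) (h : C(ℝ, ℂ)) {M : ℝ} (hM0 : 0 ≤ M)
    (hM : ∀ t, |t| ≤ 2 * X → ‖h t‖ ≤ M) : ‖convCLM hX h‖ ≤ 2 * X * M := by
  have h0 : convCLM hX h = convCLM hX h - convCLM hX (0 : C(ℝ, ℂ)) := by
    ext a x
    simp [convCLM_apply]
  rw [h0]
  exact norm_convCLM_sub_le hX h 0 hM0 (by simpa using hM)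

/-- The shift `(S_j b)_m = b_{m - j}`. -/
def shiftCLM (X : ℝ) (j : ℤ) : SeqSpace X →L[ℂ] SeqSpace X :=
  have h2 : 0 < (2 : ℝ≥0∞).toReal := by norm_num
  LinearMap.mkContinuous
    { toFun := fun b => ⟨fun m => b (m - j), memℓp_gen
        ((Equiv.subRight j).summable_iff.mpr ((lp.memℓp b).summable h2))⟩
      map_add' := fun a b => by ext m x; rfl
      map_smul' := fun c a => by ext m x; rfl }
    1 (fun b => by
      rw [one_mul, lp.norm_eq_tsum_rpow h2, lp.norm_eq_tsum_rpow h2]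
      refine le_of_eq ?_
      congr 1
      exact (Equiv.subRight j).tsum_eq (fun m => ‖b m‖ ^ (2 : ℝ≥0∞).toReal))

theorem shiftCLM_apply (j : ℤ) (b : SeqSpace X) (m : ℤ) : shiftCLM X j b m = b (m - j) := rfl

theorem norm_shiftCLM_le (j : ℤ) : ‖shiftCLM X j‖ ≤ 1 := by
  unfold shiftCLM
  exact LinearMap.mkContinuous_norm_le _ zero_le_one _

/-- Componentwise multiplication by a continuous function. -/
def mulCLM (c : C(Icc (-X) X, ℂ)) : SeqSpace X →L[ℂ] SeqSpace X :=
  lp.mapCLM 2 (fun _ : ℤ => ContinuousLinearMap.mul ℂ C(Icc (-X) X, ℂ) c) (norm_nonneg c)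
    (fun _ => ContinuousLinearMap.opNorm_mul_apply_le ℂ _ c)

/-- The operator `(B b)_m = Σ_n b_n c_{m-n}`. -/
def seqConvCLM (c : ℤ → C(Icc (-X) X, ℂ)) : SeqSpace X →L[ℂ] SeqSpace X :=
  ∑' j, (mulCLM (c j)).comp (shiftCLM X j)

theorem norm_mulCLM_le (c : C(Icc (-X) X, ℂ)) : ‖mulCLM c‖ ≤ ‖c‖ := by
  unfold mulCLM
  exact lp.norm_mapCLM_le _ _ _ _

theorem mulCLM_apply (c : C(Icc (-X) X, ℂ)) (b : SeqSpace X) (m : ℤ) :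
    mulCLM c b m = c * b m := rfl

theorem summable_clm_of_norm_bounded {E ι : Type*} [NormedAddCommGroup E] [NormedSpace ℂ E]
    [CompleteSpace E] {c : ι → ℝ} (hc : Summable c) (F : ι → E →L[ℂ] E) (h : ∀ j, ‖F j‖ ≤ c j) :
    Summable F :=
  Summable.of_norm_bounded hc h

theorem norm_clm_comp_le {E : Type*} [NormedAddCommGroup E] [NormedSpace ℂ E] {S T : E →L[ℂ] E}
    {a b : ℝ} (hS : ‖S‖ ≤ a) (hT : ‖T‖ ≤ b) : ‖S.comp T‖ ≤ a * b :=
  (ContinuousLinearMap.opNorm_comp_le S T).trans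
    (mul_le_mul hS hT (norm_nonneg T) ((norm_nonneg S).trans hS))

/-- Young's inequality `ℓ¹ * ℓ² ⊂ ℓ²` in operator form: the shifts are contractions, so the series
converges in operator norm like `Σ ‖c_j‖`. -/
theorem seqConvCLM_summable {c : ℤ → C(Icc (-X) X, ℂ)} (hc : Summable fun j => ‖c j‖) :
    Summable fun j => (mulCLM (c j)).comp (shiftCLM X j) := by
  refine summable_clm_of_norm_bounded hc _ fun j => ?_
  exact (norm_clm_comp_le (norm_mulCLM_le _) (norm_shiftCLM_le j)).trans_eq (mul_one _)

/-- Evaluation of a component at a point. -/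
def evalAt (m : ℤ) (x : Icc (-X) X) : SeqSpace X →L[ℂ] ℂ :=
  (ContinuousMap.evalCLM ℂ x).comp (lp.evalCLM ℂ (fun _ : ℤ => C(Icc (-X) X, ℂ)) 2 m)

theorem evalAt_apply (m : ℤ) (x : Icc (-X) X) (b : SeqSpace X) : evalAt m x b = b m x := rfl

/-- Evaluation of the image of a vector. -/
def evalVec (b : SeqSpace X) : (SeqSpace X →L[ℂ] SeqSpace X) →L[ℂ] SeqSpace X :=
  ContinuousLinearMap.apply ℂ (SeqSpace X) b

theorem evalVec_apply (b : SeqSpace X) (T : SeqSpace X →L[ℂ] SeqSpace X) : evalVec b T = T b := rfl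

/-- Evaluation at a component and a point is a continuous functional of the operator, so it passes
through the norm convergent series; the substitution `n = m - j` gives the convolution. -/
theorem seqConvCLM_hasSum {c : ℤ → C(Icc (-X) X, ℂ)} (hc : Summable fun j => ‖c j‖)
    (b : SeqSpace X) (m : ℤ) (x : Icc (-X) X) :
    HasSum (fun n => b n x * c (m - n) x) (seqConvCLM c b m x) := by
  have h1 : HasSum _ (seqConvCLM c) := (seqConvCLM_summable hc).hasSum
  have h2 := ((evalAt m x).comp (evalVec b)).hasSum h1
  simp only [ContinuousLinearMap.comp_apply, evalAt_apply, evalVec_apply] at h2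
  refine HasSum.congr_fun ((Equiv.subLeft m).hasSum_iff.mpr h2) fun n => ?_
  simp only [Function.comp_apply, mulCLM_apply, shiftCLM_apply, ContinuousMap.mul_apply, Equiv.subLeft_apply,
    sub_sub_cancel]
  exact mul_comm _ _

/-- The block diagonal operator `(D A)_n = h_n * A_n`. -/
def diagCLM (hX : 0 ≤ X) (h : ℤ → C(ℝ, ℂ)) {M : ℝ} (hM0 : 0 ≤ M)
    (hM : ∀ n t, |t| ≤ 2 * X → ‖h n t‖ ≤ M) : SeqSpace X →L[ℂ] SeqSpace X :=
  lp.mapCLM 2 (fun n => convCLM hX (h n)) (by positivity : 0 ≤ 2 * X * M)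
    (fun n => norm_convCLM_le hX (h n) hM0 (hM n))

theorem norm_diagCLM_le (hX : 0 ≤ X) (h : ℤ → C(ℝ, ℂ)) {M : ℝ} (hM0 : 0 ≤ M)
    (hM : ∀ n t, |t| ≤ 2 * X → ‖h n t‖ ≤ M) : ‖diagCLM hX h hM0 hM‖ ≤ 2 * X * M :=
  lp.norm_mapCLM_le _ _ _ _

theorem norm_diagCLM_sub_le (hX : 0 ≤ X) (h h' : ℤ → C(ℝ, ℂ)) {M M' N : ℝ} (hM0 : 0 ≤ M)
    (hM0' : 0 ≤ M') (hM : ∀ n t, |t| ≤ 2 * X → ‖h n t‖ ≤ M)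
    (hM' : ∀ n t, |t| ≤ 2 * X → ‖h' n t‖ ≤ M') (hN0 : 0 ≤ N)
    (hN : ∀ n t, |t| ≤ 2 * X → ‖h n t - h' n t‖ ≤ N) :
    ‖diagCLM hX h hM0 hM - diagCLM hX h' hM0' hM'‖ ≤ 2 * X * N := by
  have e : diagCLM hX h hM0 hM - diagCLM hX h' hM0' hM' =
      lp.mapCLM 2 (fun n => convCLM hX (h n) - convCLM hX (h' n)) (by positivity : 0 ≤ 2 * X * N)
        (fun n => norm_convCLM_sub_le hX (h n) (h' n) hN0 (hN n)) := by
    ext A n x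
    rfl
  rw [e]
  exact lp.norm_mapCLM_le _ _ _ _

/-- Restriction of the Fourier coefficients to `[-X, X]`. -/
def coefC {f : ℝ × ℝ → ℝ} (hf : IsPerturbation f X) (j : ℤ) : C(Icc (-X) X, ℂ) :=
  ⟨fun x => fourierCoef f j x,
    (continuous_fourierCoef hf.smooth.continuous j).comp continuous_subtype_val⟩

theorem coefC_apply {f : ℝ × ℝ → ℝ} (hf : IsPerturbation f X) (j : ℤ) (x : Icc (-X) X) :
    coefC hf j x = fourierCoef f j x := rfl

theorem norm_coefC_le {f : ℝ × ℝ → ℝ} (hf : IsPerturbation f X) {C : ℝ} (hC0 : 0 ≤ C)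
    (hC : ∀ (j : ℤ) (x : ℝ), ‖fourierCoef f j x‖ ≤ C / (1 + (j : ℝ) ^ 2)) (j : ℤ) :
    ‖coefC hf j‖ ≤ C / (1 + (j : ℝ) ^ 2) :=
  (ContinuousMap.norm_le _ (by positivity)).mpr fun x => hC j x

theorem summable_norm_coefC {f : ℝ × ℝ → ℝ} (hf : IsPerturbation f X) :
    Summable fun j => ‖coefC hf j‖ := by
  obtain ⟨C, hC0, hC⟩ := hf.exists_fourierCoef_bound
  refine Summable.of_nonneg_of_le (fun _ => norm_nonneg _) (norm_coefC_le hf hC0 hC) ?_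
  exact (summable_one_div_one_add_sq.mul_left C).congr fun j => by ring

/-- Sequences dominated by the Fourier coefficients belong to the sequence space. -/
theorem memℓp_shift_coefC {f : ℝ × ℝ → ℝ} (hf : IsPerturbation f X) (k : ℤ)
    (u : C(Icc (-X) X, ℂ)) : Memℓp (fun m => coefC hf (m + k) * u) 2 := by
  refine Memℓp.of_exponent_ge (q := 1) ?_ one_le_two
  refine memℓp_gen ?_
  simp only [ENNReal.toReal_one, Real.rpow_one]
  refine Summable.of_nonneg_of_le (fun _ => norm_nonneg _) (fun m => norm_mul_le _ _) ?_
  exact ((Equiv.addRight k).summable_iff.mpr (summable_norm_coefC hf)).mul_right _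

end

/-! ### The mode numbers and the kernels -/

theorem cpow_half_sq (z : ℂ) : (z ^ (1 / 2 : ℂ)) ^ 2 = z := by
  rw [← Complex.cpow_nat_mul]
  simp

theorem cpow_half_re_nonneg (z : ℂ) : 0 ≤ (z ^ (1 / 2 : ℂ)).re := by
  by_cases hz : z = 0
  · simp [hz]
  rw [Complex.cpow_def_of_ne_zero hz, Complex.exp_re]
  refine mul_nonneg (Real.exp_pos _).le ?_
  have e : (Complex.log z * (1 / 2)).im = z.arg / 2 := by
    rw [show Complex.log z * (1 / 2) = Complex.log z / (2 : ℝ) by push_cast; ring,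
      Complex.div_ofReal_im, Complex.log_im]
  rw [e]
  apply Real.cos_nonneg_of_neg_pi_div_two_le_of_le
  · linarith [Complex.neg_pi_lt_arg z]
  · linarith [Complex.arg_le_pi z]

theorem re_sq_ge_of_sq_eq {w z : ℂ} (h : w ^ 2 = z) : z.re ≤ w.re ^ 2 := by
  rw [← h, sq, Complex.mul_re]
  nlinarith [sq_nonneg w.im]

/-- For `w² = z` one has `Re z = (Re w)² - (Im w)²`, and the principal root has `Re w ≥ 0`. This
keeps the mode numbers uniformly inside the right half-plane for small complex `μ`. -/
theorem sqrt_le_cpow_half_re (z : ℂ) : Real.sqrt z.re ≤ (z ^ (1 / 2 : ℂ)).re :=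
  Real.sqrt_le_iff.mpr ⟨cpow_half_re_nonneg z, re_sq_ge_of_sq_eq (cpow_half_sq z)⟩

theorem modeNumber_zero_sq (β : ℝ) (μ : ℂ) : modeNumber β μ 0 ^ 2 = 1 - 2 * (β : ℂ) - μ ^ 2 := by
  rw [modeNumber, if_pos rfl, cpow_half_sq]

theorem modeNumber_sq (β : ℝ) (μ : ℂ) {n : ℤ} (hn : n ≠ 0) :
    modeNumber β μ n ^ 2 = ((β : ℂ) + n) ^ 2 - (1 - (β : ℂ)) ^ 2 + μ ^ 2 := by
  rw [modeNumber, if_neg hn, cpow_half_sq]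

/-- The gap is negative at `n = 0` (open channel) and zero at `n = -1` (threshold). For the closed
channels it grows like `n²`; since it is only `4β` at `n = 1`, the constant has to shrink with `β`.
-/
theorem modeGap_ge {β : ℝ} (h0 : 0 < β) (h1 : β < 1 / 2) {n : ℤ} (hn0 : n ≠ 0) (hn1 : n ≠ -1) :
    2 * β / 5 * (1 + (n : ℝ) ^ 2) ≤ (β + n) ^ 2 - (1 - β) ^ 2 := by
  rcases lt_or_gt_of_ne hn0 with h | h
  · have : n ≤ -2 := by omega
    have : (n : ℝ) ≤ -2 := by exact_mod_cast this
    nlinarith [mul_nonneg (by linarith : (0:ℝ) ≤ -2 - n) (by linarith : 0 ≤ 1 - 2 * β),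
      mul_nonneg (by linarith : (0:ℝ) ≤ -2 - n) (by linarith : (0:ℝ) ≤ -2 - n),
      mul_nonneg (mul_nonneg (by linarith : (0:ℝ) ≤ -2 - n) (by linarith : (0:ℝ) ≤ -2 - n))
        (by linarith : 0 ≤ 1 - 2 * β)]
  · have : 1 ≤ n := by omega
    have : (1 : ℝ) ≤ n := by exact_mod_cast this
    nlinarith [mul_nonneg (by linarith : (0:ℝ) ≤ n - 1) (by linarith : 0 ≤ 1 - 2 * β),
      mul_nonneg (by linarith : (0:ℝ) ≤ n - 1) (by linarith : (0:ℝ) ≤ n - 1),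
      mul_nonneg (mul_nonneg (by linarith : (0:ℝ) ≤ n - 1) (by linarith : (0:ℝ) ≤ n - 1))
        (by linarith : 0 ≤ 1 - 2 * β)]

/-- The size of `|μ|` up to which the mode numbers stay away from the thresholds. -/
def muMax (β : ℝ) : ℝ := min (min (Real.sqrt (β / 5)) (Real.sqrt ((1 - 2 * β) / 2))) 1

theorem muMax_pos {β : ℝ} (h0 : 0 < β) (h1 : β < 1 / 2) : 0 < muMax β := by
  unfold muMax
  refine lt_min (lt_min (Real.sqrt_pos.mpr (by linarith)) (Real.sqrt_pos.mpr (by linarith)))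
    one_pos

theorem sq_le_of_le_muMax {β : ℝ} (h0 : 0 < β) (h1 : β < 1 / 2) {t : ℝ} (ht0 : 0 ≤ t)
    (ht : t ≤ muMax β) : t ^ 2 ≤ β / 5 ∧ t ^ 2 ≤ (1 - 2 * β) / 2 ∧ t ≤ 1 := by
  unfold muMax at ht
  have a := (ht.trans (min_le_left _ _)).trans (min_le_left _ _)
  have b := (ht.trans (min_le_left _ _)).trans (min_le_right _ _)
  refine ⟨?_, ?_, ht.trans (min_le_right _ _)⟩
  · exact (pow_le_pow_left₀ ht0 a 2).trans_eq (Real.sq_sqrt (by linarith))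
  · exact (pow_le_pow_left₀ ht0 b 2).trans_eq (Real.sq_sqrt (by linarith))

theorem abs_re_sq_le (μ : ℂ) : |(μ ^ 2).re| ≤ ‖μ‖ ^ 2 := by
  rw [← norm_pow]
  exact Complex.abs_re_le_norm _

theorem modeNumber_re_ge {β : ℝ} (h0 : 0 < β) (h1 : β < 1 / 2) {μ : ℂ} (hμ : ‖μ‖ ≤ muMax β)
    {n : ℤ} (hn0 : n ≠ 0) (hn1 : n ≠ -1) :
    Real.sqrt (β / 5 * (1 + (n : ℝ) ^ 2)) ≤ (modeNumber β μ n).re := by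
  rw [modeNumber, if_neg hn0]
  refine le_trans (Real.sqrt_le_sqrt ?_) (sqrt_le_cpow_half_re _)
  have e : (((β : ℂ) + n) ^ 2 - (1 - (β : ℂ)) ^ 2 + μ ^ 2).re =
      (β + n) ^ 2 - (1 - β) ^ 2 + (μ ^ 2).re := by
    have : ((β : ℂ) + n) ^ 2 - (1 - (β : ℂ)) ^ 2 = (((β + n) ^ 2 - (1 - β) ^ 2 : ℝ) : ℂ) := by
      push_cast; ring
    rw [this, Complex.add_re, Complex.ofReal_re]
  rw [e]
  have := (abs_le.mp (abs_re_sq_le μ)).1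
  have hm := (sq_le_of_le_muMax h0 h1 (norm_nonneg μ) hμ).1
  have hg := modeGap_ge h0 h1 hn0 hn1
  nlinarith [mul_nonneg h0.le (sq_nonneg (n : ℝ))]

theorem modeNumber_re_ge' {β : ℝ} (h0 : 0 < β) (h1 : β < 1 / 2) {μ : ℂ} (hμ : ‖μ‖ ≤ muMax β)
    {n : ℤ} (hn0 : n ≠ 0) (hn1 : n ≠ -1) : Real.sqrt (β / 5) ≤ (modeNumber β μ n).re := by
  refine (Real.sqrt_le_sqrt ?_).trans (modeNumber_re_ge h0 h1 hμ hn0 hn1)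
  nlinarith [mul_nonneg h0.le (sq_nonneg (n : ℝ))]

theorem modeNumber_zero_re_ge {β : ℝ} (h0 : 0 < β) (h1 : β < 1 / 2) {μ : ℂ}
    (hμ : ‖μ‖ ≤ muMax β) : Real.sqrt ((1 - 2 * β) / 2) ≤ (modeNumber β μ 0).re := by
  rw [modeNumber, if_pos rfl]
  refine le_trans (Real.sqrt_le_sqrt ?_) (sqrt_le_cpow_half_re _)
  have e : (1 - 2 * (β : ℂ) - μ ^ 2).re = 1 - 2 * β - (μ ^ 2).re := by
    have : (1 - 2 * (β : ℂ)) = ((1 - 2 * β : ℝ) : ℂ) := by push_cast; ring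
    rw [this, Complex.sub_re, Complex.ofReal_re]
  rw [e]
  have := (abs_le.mp (abs_re_sq_le μ)).2
  have hm := (sq_le_of_le_muMax h0 h1 (norm_nonneg μ) hμ).2.1
  linarith

theorem norm_modeNumber_zero_le {β : ℝ} (h0 : 0 < β) (h1 : β < 1 / 2) {μ : ℂ}
    (hμ : ‖μ‖ ≤ muMax β) : ‖modeNumber β μ 0‖ ≤ 2 := by
  have e := congrArg norm (modeNumber_zero_sq β μ)
  rw [norm_pow] at e
  have a : ‖1 - 2 * (β : ℂ) - μ ^ 2‖ ≤ 1 + 1 := by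
    refine (norm_sub_le _ _).trans (add_le_add ?_ ?_)
    · have : (1 - 2 * (β : ℂ)) = ((1 - 2 * β : ℝ) : ℂ) := by push_cast; ring
      rw [this, Complex.norm_real, Real.norm_of_nonneg (by linarith)]
      linarith
    · rw [norm_pow]
      have := (sq_le_of_le_muMax h0 h1 (norm_nonneg μ) hμ).2.2
      exact pow_le_one₀ (norm_nonneg _) this
  nlinarith [norm_nonneg (modeNumber β μ 0)]

/-- Factor `w² - w'² = (w - w')(w + w')`, where `|w + w'| ≥ m`. The square root is thus Lipschitz
away from zero, which makes the mode numbers Lipschitz in `μ²`, uniformly in the channel. -/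
theorem norm_sub_le_of_sq {w w' : ℂ} {m : ℝ} (hm : 0 < m) (hw : m ≤ w.re) (hw' : m ≤ w'.re) :
    ‖w - w'‖ ≤ ‖w ^ 2 - w' ^ 2‖ / m := by
  rw [le_div_iff₀ hm, show w ^ 2 - w' ^ 2 = (w - w') * (w + w') by ring, norm_mul]
  refine mul_le_mul_of_nonneg_left ?_ (norm_nonneg _)
  have := Complex.re_le_norm (w + w')
  rw [Complex.add_re] at this
  linarith

theorem norm_sq_sub_sq_le {μ μ' : ℂ} (hμ : ‖μ‖ ≤ 1) (hμ' : ‖μ'‖ ≤ 1) :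
    ‖μ ^ 2 - μ' ^ 2‖ ≤ 2 * ‖μ - μ'‖ := by
  rw [show μ ^ 2 - μ' ^ 2 = (μ + μ') * (μ - μ') by ring, norm_mul]
  exact mul_le_mul_of_nonneg_right ((norm_add_le _ _).trans (by linarith)) (norm_nonneg _)

theorem norm_exp_sub_exp_le {a b : ℂ} {r : ℝ} (ha : a.re ≤ r) (hb : b.re ≤ r) :
    ‖Complex.exp a - Complex.exp b‖ ≤ Real.exp r * ‖a - b‖ := by
  have hconv : Convex ℝ {z : ℂ | z.re ≤ r} := convex_halfSpace_re_le r
  refine hconv.norm_image_sub_le_of_norm_hasDerivWithin_le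
    (fun z _ => (Complex.hasDerivAt_exp z).hasDerivWithinAt) (fun z hz => ?_) hb ha
  rw [Complex.norm_exp]
  exact Real.exp_le_exp.mpr hz

/-- The outgoing or decaying Green function `e^{-kt}/(2k)`, `t ≥ 0`. -/
def greenE (k : ℂ) (t : ℝ) : ℂ := 1 / (2 * k) * Complex.exp (-k * t)

theorem norm_greenE_le {k : ℂ} {t m r : ℝ} (hm : 0 < m) (hk : m ≤ ‖k‖) (hr : (-k * t).re ≤ r) :
    ‖greenE k t‖ ≤ 1 / (2 * m) * Real.exp r := by
  rw [greenE, norm_mul, Complex.norm_exp, norm_div, norm_one, norm_mul, RCLike.norm_ofNat]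
  refine mul_le_mul ?_ (Real.exp_le_exp.mpr hr) (Real.exp_pos _).le (by positivity)
  exact one_div_le_one_div_of_le (by positivity) (by linarith)

theorem norm_greenE_sub_le {k k' : ℂ} {t m r L : ℝ} (hm : 0 < m) (hk : m ≤ ‖k‖) (hk' : m ≤ ‖k'‖)
    (ht0 : 0 ≤ t) (ht : t ≤ L) (hr : (-k * t).re ≤ r) (hr' : (-k' * t).re ≤ r) :
    ‖greenE k t - greenE k' t‖ ≤
      (1 / (2 * m) * (Real.exp r * L) + 1 / (2 * m ^ 2) * Real.exp r) * ‖k - k'‖ := by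
  have hk0 : k ≠ 0 := norm_pos_iff.mp (hm.trans_le hk)
  have hk0' : k' ≠ 0 := norm_pos_iff.mp (hm.trans_le hk')
  have e : greenE k t - greenE k' t = 1 / (2 * k) * (Complex.exp (-k * t) - Complex.exp (-k' * t)) +
      (k' - k) / (2 * k * k') * Complex.exp (-k' * t) := by
    unfold greenE
    field_simp
    ring
  have b1 : ‖1 / (2 * k)‖ ≤ 1 / (2 * m) := by
    rw [norm_div, norm_one, norm_mul, RCLike.norm_ofNat]
    exact one_div_le_one_div_of_le (by positivity) (by linarith)
  have b2 : ‖Complex.exp (-k * t) - Complex.exp (-k' * t)‖ ≤ Real.exp r * L * ‖k - k'‖ := by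
    refine (norm_exp_sub_exp_le hr hr').trans ?_
    rw [show -k * t - -k' * t = -((t : ℂ) * (k - k')) by ring, norm_neg, norm_mul,
      Complex.norm_real, Real.norm_of_nonneg ht0, mul_assoc]
    gcongr
  have b3 : ‖(k' - k) / (2 * k * k')‖ ≤ 1 / (2 * m ^ 2) * ‖k - k'‖ := by
    rw [norm_div, norm_mul, norm_mul, RCLike.norm_ofNat, norm_sub_rev, div_eq_mul_one_div, mul_comm]
    refine mul_le_mul_of_nonneg_right ?_ (norm_nonneg _)
    refine one_div_le_one_div_of_le (by positivity) ?_
    nlinarith [mul_le_mul hk hk' hm.le (norm_nonneg k)]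
  have b4 : ‖Complex.exp (-k' * t)‖ ≤ Real.exp r := by
    rw [Complex.norm_exp]
    exact Real.exp_le_exp.mpr hr'
  rw [e]
  refine (norm_add_le _ _).trans ?_
  rw [norm_mul, norm_mul, add_mul]
  refine add_le_add ?_ ?_
  · rw [mul_assoc]
    exact mul_le_mul b1 b2 (norm_nonneg _) (by positivity)
  · calc _ ≤ 1 / (2 * m ^ 2) * ‖k - k'‖ * Real.exp r :=
        mul_le_mul b3 b4 (norm_nonneg _) (by positivity)
      _ = _ := by ring

theorem kernelH_zero (β : ℝ) (μ : ℂ) (x : ℝ) :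
    kernelH β μ 0 x = greenE (-Complex.I * modeNumber β μ 0) |x| := by
  rw [kernelH, if_pos rfl, greenE]
  congr 1
  · by_cases h : modeNumber β μ 0 = 0
    · simp [h]
    · have := Complex.I_ne_zero
      field_simp
      simp
  · congr 1
    ring

theorem kernelH_of_ne (β : ℝ) (μ : ℂ) {n : ℤ} (hn0 : n ≠ 0) (hn1 : n ≠ -1) (x : ℝ) :
    kernelH β μ n x = greenE (modeNumber β μ n) |x| := by
  rw [kernelH, if_neg hn0, if_neg hn1, greenE]

/-- The integral form has no division by `μ` and includes the case `μ = 0`, so the estimates of the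
threshold kernel hold uniformly through the threshold. -/
theorem kernelH_neg_one (β : ℝ) (μ : ℂ) (x : ℝ) :
    kernelH β μ (-1) x = -(|x| : ℝ) / 2 * ∫ s in (0 : ℝ)..1, Complex.exp (-(μ * (|x| : ℝ)) * s) := by
  rw [kernelH, if_neg (by norm_num), if_pos rfl]
  by_cases hμ : μ = 0
  · simp [hμ]
  · rw [if_neg hμ]
    by_cases hx : |x| = 0
    · simp [hx]
    · have hx' : ((|x| : ℝ) : ℂ) ≠ 0 := by exact_mod_cast hx
      rw [integral_exp_mul_complex (by simp only [ne_eq, neg_eq_zero, mul_eq_zero]; tauto)]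
      simp only [Complex.ofReal_one, mul_one, Complex.ofReal_zero, mul_zero, Complex.exp_zero]
      rw [neg_mul]
      field_simp

theorem norm_kernelH_neg_one_le {β : ℝ} {μ : ℂ} (hμ : ‖μ‖ ≤ 1) {L x : ℝ} (hx : |x| ≤ L) :
    ‖kernelH β μ (-1) x‖ ≤ L * Real.exp L := by
  have hL : 0 ≤ L := (abs_nonneg x).trans hx
  have b : ‖∫ s in (0 : ℝ)..1, Complex.exp (-(μ * (|x| : ℝ)) * s)‖ ≤ Real.exp L * |1 - 0| := by
    refine intervalIntegral.norm_integral_le_of_norm_le_const fun s hs => ?_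
    rw [uIoc_of_le zero_le_one] at hs
    rw [Complex.norm_exp]
    apply Real.exp_le_exp.mpr
    refine (Complex.re_le_norm _).trans ?_
    rw [norm_mul, norm_neg, norm_mul, Complex.norm_real, Complex.norm_real, Real.norm_of_nonneg
      (abs_nonneg x), Real.norm_of_nonneg hs.1.le]
    calc ‖μ‖ * |x| * s ≤ 1 * L * 1 := by
          gcongr
          · exact hs.1.le
          · exact hs.2
      _ = L := by ring
  rw [kernelH_neg_one, norm_mul, norm_div, norm_neg, Complex.norm_real, RCLike.norm_ofNat,
    Real.norm_of_nonneg (abs_nonneg x)]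
  rw [sub_zero, abs_one, mul_one] at b
  exact mul_le_mul (by linarith) b (norm_nonneg _) hL

theorem norm_kernelH_neg_one_sub_le {β : ℝ} {μ μ' : ℂ} (hμ : ‖μ‖ ≤ 1) (hμ' : ‖μ'‖ ≤ 1) {L x : ℝ}
    (hx : |x| ≤ L) :
    ‖kernelH β μ (-1) x - kernelH β μ' (-1) x‖ ≤ L * (Real.exp L * L) * ‖μ - μ'‖ := by
  have hL : 0 ≤ L := (abs_nonneg x).trans hx
  have hre : ∀ {μ : ℂ}, ‖μ‖ ≤ 1 → ∀ s : ℝ, s ∈ uIoc 0 (1:ℝ) → (-(μ * (|x| : ℝ)) * s).re ≤ L := by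
    intro μ hμ s hs
    rw [uIoc_of_le zero_le_one] at hs
    refine (Complex.re_le_norm _).trans ?_
    rw [norm_mul, norm_neg, norm_mul, Complex.norm_real, Complex.norm_real, Real.norm_of_nonneg
      (abs_nonneg x), Real.norm_of_nonneg hs.1.le]
    calc ‖μ‖ * |x| * s ≤ 1 * L * 1 := by
          gcongr
          · exact hs.1.le
          · exact hs.2
      _ = L := by ring
  rw [kernelH_neg_one, kernelH_neg_one, ← mul_sub, ← intervalIntegral.integral_sub
    (Continuous.intervalIntegrable (by fun_prop) _ _)
    (Continuous.intervalIntegrable (by fun_prop) _ _)]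
  have b : ‖∫ s in (0 : ℝ)..1, (Complex.exp (-(μ * (|x| : ℝ)) * s) -
      Complex.exp (-(μ' * (|x| : ℝ)) * s))‖ ≤ (Real.exp L * L * ‖μ - μ'‖) * |1 - 0| := by
    refine intervalIntegral.norm_integral_le_of_norm_le_const fun s hs => ?_
    refine (norm_exp_sub_exp_le (hre hμ s hs) (hre hμ' s hs)).trans ?_
    rw [uIoc_of_le zero_le_one] at hs
    rw [show -(μ * (|x| : ℝ)) * s - -(μ' * (|x| : ℝ)) * s = -((|x| : ℝ) * s * (μ - μ')) by ring,
      norm_neg, norm_mul, norm_mul, Complex.norm_real, Complex.norm_real, Real.norm_of_nonneg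
      (abs_nonneg x), Real.norm_of_nonneg hs.1.le, mul_assoc (Real.exp L)]
    have : |x| * s ≤ L * 1 := mul_le_mul hx hs.2 hs.1.le hL
    rw [mul_one] at this
    gcongr
  rw [norm_mul, norm_div, norm_neg, Complex.norm_real, RCLike.norm_ofNat,
    Real.norm_of_nonneg (abs_nonneg x)]
  rw [sub_zero, abs_one, mul_one] at b
  rw [mul_assoc L]
  exact mul_le_mul (by linarith) b (norm_nonneg _) hL

theorem continuous_kernelH (β : ℝ) (μ : ℂ) (n : ℤ) : Continuous (kernelH β μ n) := by
  unfold kernelH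
  split_ifs
  · fun_prop
  · fun_prop
  · exact (by fun_prop : Continuous fun x : ℝ =>
      (Complex.exp (-μ * (|x| : ℝ)) - 1)).div_const _
  · fun_prop

/-- One constant serves all channels: `m` bounds the real parts of all mode numbers other than that
of `n = -1` from below, and the regularized threshold kernel is bounded on compact sets. -/
theorem exists_kernelH_bounds {β L : ℝ} (h0 : 0 < β) (h1 : β < 1 / 2) (hL : 0 ≤ L) :
    ∃ M : ℝ, 0 ≤ M ∧
      (∀ μ : ℂ, ‖μ‖ ≤ muMax β → ∀ (n : ℤ) (t : ℝ), |t| ≤ L → ‖kernelH β μ n t‖ ≤ M) ∧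
      (∀ μ μ' : ℂ, ‖μ‖ ≤ muMax β → ‖μ'‖ ≤ muMax β → ∀ (n : ℤ) (t : ℝ), |t| ≤ L →
        ‖kernelH β μ n t - kernelH β μ' n t‖ ≤ M * ‖μ - μ'‖) := by
  obtain ⟨m, hm0, hma, hmb⟩ : ∃ m : ℝ, 0 < m ∧ m ≤ Real.sqrt (β / 5) ∧
      m ≤ Real.sqrt ((1 - 2 * β) / 2) :=
    ⟨min _ _, lt_min (Real.sqrt_pos.mpr (by linarith)) (Real.sqrt_pos.mpr (by linarith)),
      min_le_left _ _, min_le_right _ _⟩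
  have hre0 : ∀ {μ : ℂ}, ‖μ‖ ≤ muMax β → m ≤ (modeNumber β μ 0).re :=
    fun hμ => hmb.trans (modeNumber_zero_re_ge h0 h1 hμ)
  have hre : ∀ {μ : ℂ}, ‖μ‖ ≤ muMax β → ∀ {n : ℤ}, n ≠ 0 → n ≠ -1 → m ≤ (modeNumber β μ n).re :=
    fun hμ _ hn0 hn1 => hma.trans (modeNumber_re_ge' h0 h1 hμ hn0 hn1)
  have hle1 : ∀ {μ : ℂ}, ‖μ‖ ≤ muMax β → ‖μ‖ ≤ 1 := fun hμ =>
    (sq_le_of_le_muMax h0 h1 (norm_nonneg _) hμ).2.2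
  have hn0 : ∀ {μ : ℂ}, ‖μ‖ ≤ muMax β → m ≤ ‖-Complex.I * modeNumber β μ 0‖ := fun hμ => by
    rw [norm_mul, norm_neg, Complex.norm_I, one_mul]
    exact (hre0 hμ).trans (Complex.re_le_norm _)
  have hr0 : ∀ {μ : ℂ}, ‖μ‖ ≤ muMax β → ∀ {t : ℝ}, |t| ≤ L →
      (-(-Complex.I * modeNumber β μ 0) * (|t| : ℝ)).re ≤ 2 * L := fun hμ t ht => by
    refine (Complex.re_le_norm _).trans ?_
    rw [norm_mul, norm_neg, norm_mul, norm_neg, Complex.norm_I, one_mul, Complex.norm_real,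
      Real.norm_of_nonneg (abs_nonneg t)]
    exact mul_le_mul (norm_modeNumber_zero_le h0 h1 hμ) ht (abs_nonneg t) zero_le_two
  have hrn : ∀ {μ : ℂ}, ‖μ‖ ≤ muMax β → ∀ {n : ℤ}, n ≠ 0 → n ≠ -1 → ∀ {t : ℝ},
      (-(modeNumber β μ n) * (|t| : ℝ)).re ≤ 2 * L := fun hμ n a b t => by
    rw [Complex.re_mul_ofReal, Complex.neg_re]
    have := mul_nonneg (hm0.le.trans (hre hμ a b)) (abs_nonneg t)
    linarith
  -- The first pair bounds the kernels, the second their Lipschitz constants; in each pair the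
  -- second entry belongs to `n = -1`. The factor `2/m` comes from `|k - k'| ≤ |μ² - μ'²|/m ≤ 2|μ -
  -- μ'|/m`.
  refine ⟨max (max (1 / (2 * m) * Real.exp (2 * L)) (L * Real.exp L))
    (max ((1 / (2 * m) * (Real.exp (2 * L) * L) + 1 / (2 * m ^ 2) * Real.exp (2 * L)) * (2 / m))
      (L * (Real.exp L * L))), ?_, ?_, ?_⟩
  · exact le_max_of_le_left (le_max_of_le_left (by positivity))
  · intro μ hμ n t ht
    by_cases a : n = 0
    · subst a
      refine le_max_of_le_left (le_max_of_le_left ?_)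
      rw [kernelH_zero]
      exact norm_greenE_le hm0 (hn0 hμ) (hr0 hμ ht)
    by_cases b : n = -1
    · subst b
      exact le_max_of_le_left (le_max_of_le_right (norm_kernelH_neg_one_le (hle1 hμ) ht))
    · refine le_max_of_le_left (le_max_of_le_left ?_)
      rw [kernelH_of_ne _ _ a b]
      exact norm_greenE_le hm0 ((hre hμ a b).trans (Complex.re_le_norm _)) (hrn hμ a b)
  · intro μ μ' hμ hμ' n t ht
    have hsq := norm_sq_sub_sq_le (hle1 hμ) (hle1 hμ')
    have hfin : ∀ {k k' : ℂ}, ‖k - k'‖ ≤ ‖μ ^ 2 - μ' ^ 2‖ / m →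
        (1 / (2 * m) * (Real.exp (2 * L) * L) + 1 / (2 * m ^ 2) * Real.exp (2 * L)) * ‖k - k'‖ ≤
        ((1 / (2 * m) * (Real.exp (2 * L) * L) + 1 / (2 * m ^ 2) * Real.exp (2 * L)) * (2 / m)) *
          ‖μ - μ'‖ := fun {k k'} hk => by
      rw [mul_assoc _ (2 / m)]
      refine mul_le_mul_of_nonneg_left (hk.trans ?_) (by positivity)
      rw [div_mul_eq_mul_div]
      gcongr
    by_cases a : n = 0
    · subst a
      rw [kernelH_zero, kernelH_zero]
      refine ((norm_greenE_sub_le hm0 (hn0 hμ) (hn0 hμ') (abs_nonneg t) ht (hr0 hμ ht)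
        (hr0 hμ' ht)).trans (hfin ?_)).trans (mul_le_mul_of_nonneg_right
          (le_max_of_le_right (le_max_left _ _)) (norm_nonneg _))
      rw [← mul_sub, norm_mul, norm_neg, Complex.norm_I, one_mul]
      refine (norm_sub_le_of_sq hm0 (hre0 hμ) (hre0 hμ')).trans_eq ?_
      rw [modeNumber_zero_sq, modeNumber_zero_sq, sub_sub_sub_cancel_left, norm_sub_rev]
    by_cases b : n = -1
    · subst b
      exact (norm_kernelH_neg_one_sub_le (hle1 hμ) (hle1 hμ') ht).trans
        (mul_le_mul_of_nonneg_right (le_max_of_le_right (le_max_right _ _)) (norm_nonneg _))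
    · rw [kernelH_of_ne _ _ a b, kernelH_of_ne _ _ a b]
      refine ((norm_greenE_sub_le hm0 ((hre hμ a b).trans (Complex.re_le_norm _))
        ((hre hμ' a b).trans (Complex.re_le_norm _)) (abs_nonneg t) ht (hrn hμ a b)
        (hrn hμ' a b)).trans (hfin ?_)).trans (mul_le_mul_of_nonneg_right
          (le_max_of_le_right (le_max_left _ _)) (norm_nonneg _))
      refine (norm_sub_le_of_sq hm0 (hre hμ a b) (hre hμ' a b)).trans_eq ?_
      rw [modeNumber_sq _ _ a, modeNumber_sq _ _ a, add_sub_add_left_eq_sub]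

section

/-! ### Neumann series for a family of small operators -/

section Neumann

variable {E : Type*} [NormedAddCommGroup E] [NormedSpace ℂ E]

theorem norm_le_of_sub_eq {S : E →L[ℂ] E} (hS : ‖S‖ ≤ 1 / 2) {x y : E} (h : x - S x = y) :
    ‖x‖ ≤ 2 * ‖y‖ := by
  have h1 : ‖S x‖ ≤ 1 / 2 * ‖x‖ := S.le_of_opNorm_le hS x
  have h2 : ‖x‖ ≤ ‖y‖ + ‖S x‖ := by
    have : x = y + S x := by rw [← h]; abel
    calc ‖x‖ = ‖y + S x‖ := by rw [← this]
      _ ≤ _ := norm_add_le _ _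
  linarith

theorem eq_of_sub_eq {S : E →L[ℂ] E} (hS : ‖S‖ ≤ 1 / 2) {x x' y : E} (h : x - S x = y)
    (h' : x' - S x' = y) : x = x' := by
  have : (x - x') - S (x - x') = 0 := by
    rw [map_sub, sub_sub_sub_comm, h, h', sub_self]
  have := norm_le_of_sub_eq hS this
  rw [norm_zero, mul_zero] at this
  exact sub_eq_zero.mp (norm_le_zero_iff.mp this)

theorem exists_sub_eq [CompleteSpace E] {S : E →L[ℂ] E} (hS : ‖S‖ ≤ 1 / 2) (y : E) :
    ∃ x, x - S x = y := by
  have h1 : ‖S‖ < 1 := by linarith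
  refine ⟨(↑(Units.oneSub S h1)⁻¹ : E →L[ℂ] E) y, ?_⟩
  have := congrArg (fun T : E →L[ℂ] E => T y) (Units.oneSub S h1).mul_inv
  simpa using this

/-- The solution `x` of `x - S x = y`. -/
def solve [CompleteSpace E] (S : E →L[ℂ] E) (y : E) : E :=
  -- The value `0` plays no role: all estimates are made under `K ε ≤ 1/2`, where the solution is
  -- unique.
  open Classical in if h : ‖S‖ ≤ 1 / 2 then (exists_sub_eq h y).choose else 0

theorem solve_spec [CompleteSpace E] {S : E →L[ℂ] E} (hS : ‖S‖ ≤ 1 / 2) (y : E) :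
    solve S y - S (solve S y) = y := by
  rw [solve, dif_pos hS]
  exact (exists_sub_eq hS y).choose_spec

theorem eq_solve [CompleteSpace E] {S : E →L[ℂ] E} (hS : ‖S‖ ≤ 1 / 2) {x y : E}
    (h : x - S x = y) : x = solve S y :=
  eq_of_sub_eq hS h (solve_spec hS y)

/-- A bounded Lipschitz family of operators on a disc. -/
structure IsOperatorFamily (T : ℂ → E →L[ℂ] E) (r K : ℝ) : Prop where
  r_pos : 0 < r
  bound_pos : 0 < K
  bound : ∀ μ, ‖μ‖ ≤ r → ‖T μ‖ ≤ K
  lip : ∀ μ μ', ‖μ‖ ≤ r → ‖μ'‖ ≤ r → ‖T μ - T μ'‖ ≤ K * ‖μ - μ'‖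

variable {T : ℂ → E →L[ℂ] E} {r K ε : ℝ}

theorem IsOperatorFamily.norm_smul_le (H : IsOperatorFamily T r K) (hε : 0 ≤ ε) {μ : ℂ}
    (hμ : ‖μ‖ ≤ r) : ‖(ε : ℂ) • T μ‖ ≤ K * ε := by
  rw [norm_smul, Complex.norm_real, Real.norm_of_nonneg hε, mul_comm]
  exact mul_le_mul_of_nonneg_right (H.bound μ hμ) hε

theorem IsOperatorFamily.norm_smul_apply_le (H : IsOperatorFamily T r K) (hε : 0 ≤ ε) {μ : ℂ}
    (hμ : ‖μ‖ ≤ r) (y : E) : ‖(ε : ℂ) • T μ y‖ ≤ K * ε * ‖y‖ :=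
  ((ε : ℂ) • T μ).le_of_opNorm_le (H.norm_smul_le hε hμ) y

variable [CompleteSpace E]

theorem IsOperatorFamily.solve_spec (H : IsOperatorFamily T r K) (hε : 0 ≤ ε)
    (hε' : K * ε ≤ 1 / 2) {μ : ℂ} (hμ : ‖μ‖ ≤ r) (y : E) :
    solve ((ε : ℂ) • T μ) y - (ε : ℂ) • T μ (solve ((ε : ℂ) • T μ) y) = y :=
  PeriodicScattering.solve_spec ((H.norm_smul_le hε hμ).trans hε') y

theorem IsOperatorFamily.eq_solve (H : IsOperatorFamily T r K) (hε : 0 ≤ ε)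
    (hε' : K * ε ≤ 1 / 2) {μ : ℂ} (hμ : ‖μ‖ ≤ r) {x y : E} (h : x - (ε : ℂ) • T μ x = y) :
    x = solve ((ε : ℂ) • T μ) y :=
  PeriodicScattering.eq_solve ((H.norm_smul_le hε hμ).trans hε') h

theorem IsOperatorFamily.norm_solve_le (H : IsOperatorFamily T r K) (hε : 0 ≤ ε)
    (hε' : K * ε ≤ 1 / 2) {μ : ℂ} (hμ : ‖μ‖ ≤ r) (y : E) :
    ‖solve ((ε : ℂ) • T μ) y‖ ≤ 2 * ‖y‖ :=
  norm_le_of_sub_eq ((H.norm_smul_le hε hμ).trans hε') (H.solve_spec hε hε' hμ y)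

/-- The solution `x` satisfies `x - y = εTx`, so it agrees with its right-hand side up to one power
of `ε`. -/
theorem IsOperatorFamily.norm_solve_sub_le (H : IsOperatorFamily T r K) (hε : 0 ≤ ε)
    (hε' : K * ε ≤ 1 / 2) {μ : ℂ} (hμ : ‖μ‖ ≤ r) (y : E) :
    ‖solve ((ε : ℂ) • T μ) y - y‖ ≤ 2 * K * ε * ‖y‖ := by
  have h := H.solve_spec hε hε' hμ y
  have e : solve ((ε : ℂ) • T μ) y - y = (ε : ℂ) • T μ (solve ((ε : ℂ) • T μ) y) := by
    rw [sub_eq_iff_eq_add, ← sub_eq_iff_eq_add', h]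
  rw [e]
  refine (H.norm_smul_apply_le hε hμ _).trans ?_
  have := mul_le_mul_of_nonneg_left (H.norm_solve_le hε hε' hμ y) (mul_nonneg H.bound_pos.le hε)
  linarith

/-- Here `x - y - εTy = εT(x - y)`, and the first order estimate supplies the second power of `ε`.
-/
theorem IsOperatorFamily.norm_solve_sub_sub_le (H : IsOperatorFamily T r K) (hε : 0 ≤ ε)
    (hε' : K * ε ≤ 1 / 2) {μ : ℂ} (hμ : ‖μ‖ ≤ r) (y : E) :
    ‖solve ((ε : ℂ) • T μ) y - y - (ε : ℂ) • T μ y‖ ≤ 2 * K ^ 2 * ε ^ 2 * ‖y‖ := by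
  have h := H.solve_spec hε hε' hμ y
  have e : solve ((ε : ℂ) • T μ) y - y - (ε : ℂ) • T μ y =
      (ε : ℂ) • T μ (solve ((ε : ℂ) • T μ) y - y) := by
    rw [map_sub, smul_sub]
    congr 1
    rw [sub_eq_iff_eq_add, ← sub_eq_iff_eq_add', h]
  rw [e]
  refine (H.norm_smul_apply_le hε hμ _).trans ?_
  have := mul_le_mul_of_nonneg_left (H.norm_solve_sub_le hε hε' hμ y) (mul_nonneg H.bound_pos.le hε)
  linarith

/-- Resolvent identity: `x - x'` solves the equation for `μ` with right-hand side `ε(T μ - T μ')x'`.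
The dependence on `μ` therefore carries a factor `ε`, which is essential for the relative accuracy
of the denominator. -/
theorem IsOperatorFamily.norm_solve_lip (H : IsOperatorFamily T r K) (hε : 0 ≤ ε)
    (hε' : K * ε ≤ 1 / 2) {μ μ' : ℂ} (hμ : ‖μ‖ ≤ r) (hμ' : ‖μ'‖ ≤ r) (y : E) :
    ‖solve ((ε : ℂ) • T μ) y - solve ((ε : ℂ) • T μ') y‖ ≤ 4 * K * ε * ‖y‖ * ‖μ - μ'‖ := by
  set x := solve ((ε : ℂ) • T μ) y with hx
  set x' := solve ((ε : ℂ) • T μ') y with hx'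
  have h : x - (ε : ℂ) • T μ x = y := H.solve_spec hε hε' hμ y
  have h' : x' - (ε : ℂ) • T μ' x' = y := H.solve_spec hε hε' hμ' y
  have e : (x - x') - ((ε : ℂ) • T μ) (x - x') = (ε : ℂ) • (T μ - T μ') x' := by
    have e1 : (x - x') - ((ε : ℂ) • T μ) (x - x') =
      (x - (ε : ℂ) • T μ x) - (x' - (ε : ℂ) • T μ' x') + (ε : ℂ) • (T μ - T μ') x' := by
      simp only [smul_apply, map_sub, sub_apply, smul_sub]
      abel
    rw [e1, h, h', sub_self, zero_add]
  refine (norm_le_of_sub_eq ((H.norm_smul_le hε hμ).trans hε') e).trans ?_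
  rw [norm_smul, Complex.norm_real, Real.norm_of_nonneg hε]
  have b1 : ‖(T μ - T μ') x'‖ ≤ K * ‖μ - μ'‖ * ‖x'‖ :=
    (T μ - T μ').le_of_opNorm_le (H.lip μ μ' hμ hμ') x'
  have b2 : ‖x'‖ ≤ 2 * ‖y‖ := H.norm_solve_le hε hε' hμ' y
  calc 2 * (ε * ‖(T μ - T μ') x'‖) ≤ 2 * (ε * (K * ‖μ - μ'‖ * (2 * ‖y‖))) := by
        have := H.bound_pos
        gcongr
        exact b1.trans (by gcongr)
    _ = _ := by ring

/-! ### The dispersion function -/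

theorem exists_fixedPoint_of_lipschitz {G : ℂ → ℂ} {C : ℝ} (hC : 0 ≤ C)
    (hmap : ∀ ν, ‖ν‖ ≤ C → ‖G ν‖ ≤ C)
    (hlip : ∀ ν ν', ‖ν‖ ≤ C → ‖ν'‖ ≤ C → ‖G ν - G ν'‖ ≤ 1 / 2 * ‖ν - ν'‖) :
    ∃ ν, ‖ν‖ ≤ C ∧ G ν = ν := by
  have hs : IsComplete (Metric.closedBall (0 : ℂ) C) := Metric.isClosed_closedBall.isComplete
  have hm : MapsTo G (Metric.closedBall 0 C) (Metric.closedBall 0 C) := fun ν hν => by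
    rw [mem_closedBall_zero_iff] at *
    exact hmap ν hν
  have hc : ContractingWith (1 / 2) (hm.restrict G _ _) := by
    refine ⟨by rw [← NNReal.coe_lt_coe]; norm_num, LipschitzWith.of_dist_le_mul fun a b => ?_⟩
    have := hlip a b (mem_closedBall_zero_iff.mp a.2) (mem_closedBall_zero_iff.mp b.2)
    rw [Subtype.dist_eq, Subtype.dist_eq, dist_eq_norm, dist_eq_norm]
    simpa using this
  obtain ⟨y, hy, hfix, -⟩ := hc.exists_fixedPoint' hs hm (x := 0)
    (Metric.mem_closedBall_self hC) (edist_ne_top _ _)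
  exact ⟨y, mem_closedBall_zero_iff.mp hy, hfix⟩

/-- The parameter `μ` enters through `γ`, that is through `μ²`, and through `T`, that is with a
factor `ε`. For `μ = εν` with bounded `ν` both effects are `O(ε²)`, so the expansion at `μ = 0`
determines the resonance to first order in `ε`. -/
theorem exists_dispersion_bounds (H : IsOperatorFamily T r K) (ℓ : E →L[ℂ] ℂ) (g : E) {γ : ℂ → ℂ}
    (hγ : ∀ μ, ‖μ‖ ≤ r → ‖γ μ‖ ≤ 1) (hγ' : ∀ μ μ', ‖γ μ - γ μ'‖ ≤ ‖μ ^ 2 - μ' ^ 2‖) :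
    ∃ C, 0 < C ∧ ∀ ε : ℝ, 0 ≤ ε → K * ε ≤ 1 / 2 →
      (∀ μ, ‖μ‖ ≤ r → ‖γ μ * ℓ (solve ((ε : ℂ) • T μ) g)‖ ≤ C) ∧
      (∀ μ μ', ‖μ‖ ≤ r → ‖μ'‖ ≤ r →
        ‖γ μ * ℓ (solve ((ε : ℂ) • T μ) g) - γ μ' * ℓ (solve ((ε : ℂ) • T μ') g)‖ ≤
          C * (‖μ ^ 2 - μ' ^ 2‖ + ε * ‖μ - μ'‖)) ∧
      ‖γ 0 * ℓ (solve ((ε : ℂ) • T 0) g) - γ 0 * (ℓ g + ε * ℓ (T 0 g))‖ ≤ C * ε ^ 2 := by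
  have hK := H.bound_pos
  refine ⟨‖ℓ‖ * ‖g‖ * (2 + 4 * K + 2 * K ^ 2) + 1, by positivity, fun ε hε hε' => ⟨?_, ?_, ?_⟩⟩
  · intro μ hμ
    rw [norm_mul]
    have : ‖ℓ (solve ((ε : ℂ) • T μ) g)‖ ≤ ‖ℓ‖ * (2 * ‖g‖) :=
      ℓ.le_opNorm_of_le (H.norm_solve_le hε hε' hμ g)
    have h2 := mul_le_mul (hγ μ hμ) this (norm_nonneg _) zero_le_one
    have : 0 ≤ ‖ℓ‖ * ‖g‖ * (4 * K + 2 * K ^ 2) := by positivity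
    linarith
  · intro μ μ' hμ hμ'
    have b1 : ‖ℓ (solve ((ε : ℂ) • T μ) g)‖ ≤ ‖ℓ‖ * (2 * ‖g‖) :=
      ℓ.le_opNorm_of_le (H.norm_solve_le hε hε' hμ g)
    have b2 : ‖ℓ (solve ((ε : ℂ) • T μ) g - solve ((ε : ℂ) • T μ') g)‖ ≤
        ‖ℓ‖ * (4 * K * ε * ‖g‖ * ‖μ - μ'‖) := ℓ.le_opNorm_of_le (H.norm_solve_lip hε hε' hμ hμ' g)
    have e : γ μ * ℓ (solve ((ε : ℂ) • T μ) g) - γ μ' * ℓ (solve ((ε : ℂ) • T μ') g) =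
        (γ μ - γ μ') * ℓ (solve ((ε : ℂ) • T μ) g) +
          γ μ' * ℓ (solve ((ε : ℂ) • T μ) g - solve ((ε : ℂ) • T μ') g) := by
      rw [map_sub]
      ring
    rw [e]
    refine (norm_add_le _ _).trans ?_
    rw [norm_mul, norm_mul]
    have c1 := mul_le_mul (hγ' μ μ') b1 (norm_nonneg _) (norm_nonneg _)
    have c2 := mul_le_mul (hγ μ' hμ') b2 (norm_nonneg _) zero_le_one
    have d1 : 0 ≤ (‖ℓ‖ * ‖g‖ * (4 * K + 2 * K ^ 2) + 1) * ‖μ ^ 2 - μ' ^ 2‖ := by positivity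
    have d2 : 0 ≤ (‖ℓ‖ * ‖g‖ * (2 + 2 * K ^ 2) + 1) * (ε * ‖μ - μ'‖) := by positivity
    linarith
  · have h0 : ‖(0 : ℂ)‖ ≤ r := by rw [norm_zero]; exact H.r_pos.le
    have e : γ 0 * ℓ (solve ((ε : ℂ) • T 0) g) - γ 0 * (ℓ g + ε * ℓ (T 0 g)) =
        γ 0 * ℓ (solve ((ε : ℂ) • T 0) g - g - (ε : ℂ) • T 0 g) := by
      simp only [map_sub, map_smul, smul_eq_mul]
      ring
    rw [e, norm_mul]
    have b2 : ‖ℓ (solve ((ε : ℂ) • T 0) g - g - (ε : ℂ) • T 0 g)‖ ≤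
        ‖ℓ‖ * (2 * K ^ 2 * ε ^ 2 * ‖g‖) := ℓ.le_opNorm_of_le (H.norm_solve_sub_sub_le hε hε' h0 g)
    have c2 := mul_le_mul (hγ 0 h0) b2 (norm_nonneg _) zero_le_one
    have d2 : 0 ≤ (‖ℓ‖ * ‖g‖ * (2 + 4 * K) + 1) * ε ^ 2 := by positivity
    linarith

end Neumann

/-- On the disc `|ν| ≤ C` the map `ν ↦ Φ(ε, εν)` has Lipschitz constant at most `Cε²(2C + 1)`, so
the contraction principle applies once `ε` is small. -/
theorem exists_root_of_lipschitz {Φ : ℝ → ℂ → ℂ} {C r ε₁ : ℝ} (hC : 0 < C) (hr : 0 < r)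
    (hε₁ : 0 < ε₁)
    (hb : ∀ ε, 0 ≤ ε → ε ≤ ε₁ → ∀ μ, ‖μ‖ ≤ r → ‖Φ ε μ‖ ≤ C)
    (hl : ∀ ε, 0 ≤ ε → ε ≤ ε₁ → ∀ μ μ', ‖μ‖ ≤ r → ‖μ'‖ ≤ r →
      ‖Φ ε μ - Φ ε μ'‖ ≤ C * (‖μ ^ 2 - μ' ^ 2‖ + ε * ‖μ - μ'‖)) :
    ∀ᶠ ε in 𝓝[>] (0 : ℝ), ∃ ν : ℂ, ‖ν‖ ≤ C ∧ Φ ε (ε * ν) = ν := by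
  have h1 : ∀ᶠ ε in 𝓝[>] (0 : ℝ), ε ≤ ε₁ :=
    nhdsWithin_le_nhds (eventually_le_nhds hε₁)
  have h2 : ∀ᶠ ε in 𝓝[>] (0 : ℝ), ε * C ≤ r := by
    have : Tendsto (fun ε : ℝ => ε * C) (𝓝 0) (𝓝 (0 * C)) := (continuous_mul_const C).tendsto 0
    rw [zero_mul] at this
    exact nhdsWithin_le_nhds (this.eventually_le_const hr)
  have h3 : ∀ᶠ ε in 𝓝[>] (0 : ℝ), C * (ε * ε * (2 * C + 1)) ≤ 1 / 2 := by
    have : Tendsto (fun ε : ℝ => C * (ε * ε * (2 * C + 1))) (𝓝 0) (𝓝 (C * (0 * 0 * (2 * C + 1)))) :=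
      (by fun_prop : Continuous fun ε : ℝ => C * (ε * ε * (2 * C + 1))).tendsto 0
    simp only [mul_zero, zero_mul] at this
    exact nhdsWithin_le_nhds (this.eventually_le_const (by norm_num))
  filter_upwards [h1, h2, h3, self_mem_nhdsWithin] with ε a1 a2 a3 a0
  have a0 : 0 < ε := a0
  have hball : ∀ ν : ℂ, ‖ν‖ ≤ C → ‖(ε : ℂ) * ν‖ ≤ r := fun ν hν => by
    rw [norm_mul, Complex.norm_real, Real.norm_of_nonneg a0.le]
    exact (mul_le_mul_of_nonneg_left hν a0.le).trans a2
  obtain ⟨ν, hν, h⟩ := exists_fixedPoint_of_lipschitz (G := fun ν => Φ ε (ε * ν)) hC.le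
    (fun ν hν => hb ε a0.le a1 _ (hball ν hν)) (fun ν ν' hν hν' => by
      refine (hl ε a0.le a1 _ _ (hball ν hν) (hball ν' hν')).trans ?_
      rw [← mul_sub, show ((ε : ℂ) * ν) ^ 2 - (ε * ν') ^ 2 = ε * ε * (ν + ν') * (ν - ν') by ring]
      simp only [norm_mul, Complex.norm_real, Real.norm_of_nonneg a0.le]
      have : ‖ν + ν'‖ ≤ 2 * C := (norm_add_le _ _).trans (by linarith)
      calc C * (ε * ε * ‖ν + ν'‖ * ‖ν - ν'‖ + ε * (ε * ‖ν - ν'‖))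
          ≤ C * (ε * ε * (2 * C) * ‖ν - ν'‖ + ε * (ε * ‖ν - ν'‖)) := by gcongr
        _ = C * (ε * ε * (2 * C + 1)) * ‖ν - ν'‖ := by ring
        _ ≤ _ := by gcongr)
  exact ⟨ν, hν, h⟩

/-! ### The operator of the problem -/

theorem norm_gammaC_sub_le (β : ℝ) (μ μ' : ℂ) :
    ‖gammaC β μ - gammaC β μ'‖ ≤ ‖μ ^ 2 - μ' ^ 2‖ := by
  unfold gammaC
  rw [← sub_div, sub_sub_sub_cancel_left, norm_div, norm_sub_rev]
  refine div_le_self (norm_nonneg _) ?_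
  rw [norm_mul, RCLike.norm_ofNat, Complex.norm_real, Real.norm_of_nonneg Real.pi_pos.le]
  linarith [Real.pi_gt_three]

theorem norm_gammaC_le {β : ℝ} (h0 : 0 < β) (h1 : β < 1 / 2) {μ : ℂ} (hμ : ‖μ‖ ≤ muMax β) :
    ‖gammaC β μ‖ ≤ 1 := by
  have hle := (sq_le_of_le_muMax h0 h1 (norm_nonneg _) hμ).2.2
  unfold gammaC
  rw [norm_div, norm_mul, RCLike.norm_ofNat, Complex.norm_real, Real.norm_of_nonneg Real.pi_pos.le]
  rw [div_le_one (by positivity)]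
  have : ‖(1 - (β : ℂ)) ^ 2 - μ ^ 2‖ ≤ 1 + 1 := by
    refine (norm_sub_le _ _).trans (add_le_add ?_ ?_)
    · rw [norm_pow]
      refine pow_le_one₀ (norm_nonneg _) ?_
      have : (1 - (β : ℂ)) = ((1 - β : ℝ) : ℂ) := by push_cast; ring
      rw [this, Complex.norm_real, Real.norm_of_nonneg (by linarith)]
      linarith
    · rw [norm_pow]
      exact pow_le_one₀ (norm_nonneg _) hle
  linarith [Real.pi_gt_three]

theorem norm_smul_comp_le {E : Type*} [NormedAddCommGroup E] [NormedSpace ℂ E] (B : E →L[ℂ] E)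
    {a : ℂ} {D : E →L[ℂ] E} {c d : ℝ} (ha : ‖a‖ ≤ c) (hD : ‖D‖ ≤ d) :
    ‖a • B.comp D‖ ≤ c * (‖B‖ * d) := by
  rw [norm_smul]
  exact mul_le_mul ha (norm_clm_comp_le le_rfl hD) (norm_nonneg _) ((norm_nonneg _).trans ha)

theorem norm_smul_comp_sub_le {E : Type*} [NormedAddCommGroup E] [NormedSpace ℂ E] (B : E →L[ℂ] E)
    {a a' : ℂ} {D D' : E →L[ℂ] E} {c c' d d' : ℝ} (ha : ‖a - a'‖ ≤ c) (ha' : ‖a'‖ ≤ c')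
    (hD : ‖D‖ ≤ d) (hD' : ‖D - D'‖ ≤ d') :
    ‖a • B.comp D - a' • B.comp D'‖ ≤ c * (‖B‖ * d) + c' * (‖B‖ * d') := by
  have e : a • B.comp D - a' • B.comp D' = (a - a') • B.comp D + a' • B.comp (D - D') := by
    ext x
    simp only [sub_apply, smul_apply, ContinuousLinearMap.comp_apply, add_apply, sub_smul, map_sub,
      smul_sub]
    abel
  rw [e]
  exact (norm_add_le _ _).trans (add_le_add (norm_smul_comp_le B ha hD)
    (norm_smul_comp_le B ha' hD'))

/-- The operator factors as `2γ` times (multiplication by `f`, a convolution in the mode index)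
times (block diagonal convolution with the kernels). Only `γ` and the diagonal factor depend on `μ`.
-/
theorem exists_operatorFamily {f : ℝ × ℝ → ℝ} {X β : ℝ} (hf : IsPerturbation f X) (h0 : 0 < β)
    (h1 : β < 1 / 2) : ∃ (K : ℝ) (T : ℂ → SeqSpace X →L[ℂ] SeqSpace X),
      IsOperatorFamily T (muMax β) K ∧
      ∀ μ, ‖μ‖ ≤ muMax β → ∀ A m x, T μ A m x = operatorT f X β μ A m x := by
  have hX := hf.pos.le
  obtain ⟨M, hM0, hM, hM'⟩ := exists_kernelH_bounds h0 h1 (by positivity : 0 ≤ 2 * X)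
  let h : ℂ → ℤ → C(ℝ, ℂ) := fun μ n => ⟨kernelH β μ n, continuous_kernelH β μ n⟩
  let B := seqConvCLM (coefC hf)
  classical
  -- The kernel bounds, which the diagonal operator needs, hold only for `‖μ‖ ≤ muMax β`; outside
  -- this disc the value is immaterial.
  let T : ℂ → SeqSpace X →L[ℂ] SeqSpace X := fun μ =>
    if hμ : ‖μ‖ ≤ muMax β then (2 * gammaC β μ) • B.comp (diagCLM hX (h μ) hM0 (hM μ hμ)) else 0
  have hT : ∀ μ (hμ : ‖μ‖ ≤ muMax β),
      T μ = (2 * gammaC β μ) • B.comp (diagCLM hX (h μ) hM0 (hM μ hμ)) := fun μ hμ => dif_pos hμ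
  have ha : ∀ μ, ‖μ‖ ≤ muMax β → ‖2 * gammaC β μ‖ ≤ 2 := fun μ hμ => by
    rw [norm_mul, RCLike.norm_ofNat]
    linarith [norm_gammaC_le h0 h1 hμ]
  have hle1 : ∀ {μ : ℂ}, ‖μ‖ ≤ muMax β → ‖μ‖ ≤ 1 := fun hμ =>
    (sq_le_of_le_muMax h0 h1 (norm_nonneg _) hμ).2.2
  have hBn : 0 ≤ ‖B‖ * (2 * X * M) :=
    mul_nonneg (ContinuousLinearMap.opNorm_nonneg B) (by positivity)
  -- The `6` is `4 + 2`: the factor `2γ` has Lipschitz constant `4` and size at most `2`. The added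
  -- `1` keeps the constant positive.
  refine ⟨6 * (‖B‖ * (2 * X * M)) + 1, T, ⟨muMax_pos h0 h1, by linarith, ?_, ?_⟩, ?_⟩
  · intro μ hμ
    rw [hT μ hμ]
    exact (norm_smul_comp_le B (ha μ hμ) (norm_diagCLM_le hX (h μ) hM0 (hM μ hμ))).trans
      (by linarith)
  · intro μ μ' hμ hμ'
    rw [hT μ hμ, hT μ' hμ']
    have hd := norm_diagCLM_sub_le hX (h μ) (h μ') hM0 hM0 (hM μ hμ) (hM μ' hμ')
      (N := M * ‖μ - μ'‖) (by positivity) (hM' μ μ' hμ hμ')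
    have hc : ‖2 * gammaC β μ - 2 * gammaC β μ'‖ ≤ 4 * ‖μ - μ'‖ := by
      rw [← mul_sub, norm_mul, RCLike.norm_ofNat]
      linarith [norm_gammaC_sub_le β μ μ', norm_sq_sub_sq_le (hle1 hμ) (hle1 hμ')]
    refine (norm_smul_comp_sub_le B hc (ha μ' hμ') (norm_diagCLM_le hX (h μ) hM0 (hM μ hμ))
      hd).trans ?_
    have := norm_nonneg (μ - μ')
    linarith
  · intro μ hμ A m x
    rw [hT μ hμ]
    have := (seqConvCLM_hasSum (summable_norm_coefC hf)
      (diagCLM hX (h μ) hM0 (hM μ hμ) A) m x).tsum_eq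
    rw [operatorT]
    exact congrArg (2 * gammaC β μ * ·) this.symm

end

section

/-! ### One-dimensional Green functions -/

/-- `∫_{-X}^x e^{kξ} a(ξ) dξ`. -/
def expPrim (k : ℂ) (X : ℝ) (a : ℝ → ℂ) (x : ℝ) : ℂ := ∫ ξ in (-X)..x, Complex.exp (k * ξ) * a ξ

/-- `∫_x^X e^{-kξ} a(ξ) dξ`. -/
def expPrimRight (k : ℂ) (X : ℝ) (a : ℝ → ℂ) (x : ℝ) : ℂ :=
  ∫ ξ in x..X, Complex.exp (-k * ξ) * a ξ

/-- The convolution of `e^{-k|x|}/(2k)` with a function supported in `[-X, X]`. -/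
def greenConv (k : ℂ) (X : ℝ) (a : ℝ → ℂ) (x : ℝ) : ℂ :=
  1 / (2 * k) * (Complex.exp (-k * x) * expPrim k X a x + Complex.exp (k * x) * expPrimRight k X a x)

/-- The derivative of `greenConv`. -/
def greenConvDeriv (k : ℂ) (X : ℝ) (a : ℝ → ℂ) (x : ℝ) : ℂ :=
  1 / 2 * (-(Complex.exp (-k * x) * expPrim k X a x) + Complex.exp (k * x) * expPrimRight k X a x)

variable {k : ℂ} {X : ℝ} {a : ℝ → ℂ}

theorem hasDerivAt_exp_mul (k : ℂ) (x : ℝ) :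
    HasDerivAt (fun x : ℝ => Complex.exp (k * x)) (k * Complex.exp (k * x)) x := by
  have := (((hasDerivAt_id x).ofReal_comp).const_mul k).cexp
  simpa [mul_comm] using this

theorem hasDerivAt_expPrim (ha : Continuous a) (x : ℝ) :
    HasDerivAt (expPrim k X a) (Complex.exp (k * x) * a x) x :=
  ((by fun_prop : Continuous fun ξ : ℝ => Complex.exp (k * ξ) * a ξ).integral_hasStrictDerivAt
    (-X) x).hasDerivAt

theorem hasDerivAt_expPrimRight (ha : Continuous a) (x : ℝ) :
    HasDerivAt (expPrimRight k X a) (-(Complex.exp (-k * x) * a x)) x := by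
  have hc : Continuous fun ξ : ℝ => Complex.exp (-k * ξ) * a ξ := by fun_prop
  exact intervalIntegral.integral_hasDerivAt_left (hc.intervalIntegrable _ _)
    (hc.stronglyMeasurableAtFilter _ _) hc.continuousAt

/-- The two terms with `a(x)` cancel because `e^{-kx} e^{kx} = 1`. After one more differentiation
they add up to `-a(x)`, so the convolution solves `u'' = k²u - a`. -/
theorem hasDerivAt_greenConv (hk : k ≠ 0) (ha : Continuous a) (x : ℝ) :
    HasDerivAt (greenConv k X a) (greenConvDeriv k X a x) x := by
  have h := ((((hasDerivAt_exp_mul (-k) x).mul (hasDerivAt_expPrim (k := k) (X := X) ha x)).add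
    ((hasDerivAt_exp_mul k x).mul (hasDerivAt_expPrimRight (k := k) (X := X) ha x))).const_mul
      (1 / (2 * k)))
  refine h.congr_deriv ?_
  have e : Complex.exp (-k * x) * Complex.exp (k * x) = 1 := by
    rw [← Complex.exp_add]
    simp
  unfold greenConvDeriv
  field_simp
  ring

theorem hasDerivAt_greenConvDeriv (ha : Continuous a) (x : ℝ) :
    HasDerivAt (greenConvDeriv k X a) (k ^ 2 * greenConv k X a x - a x) x := by
  have h := (((((hasDerivAt_exp_mul (-k) x).mul (hasDerivAt_expPrim (k := k) (X := X) ha x)).neg).add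
    ((hasDerivAt_exp_mul k x).mul (hasDerivAt_expPrimRight (k := k) (X := X) ha x))).const_mul
      (1 / 2 : ℂ))
  refine h.congr_deriv ?_
  have e : Complex.exp (-k * x) * Complex.exp (k * x) = 1 := by
    rw [← Complex.exp_add]
    simp
  unfold greenConv
  generalize Complex.exp (-k * x) = u at *
  generalize Complex.exp (k * x) = v at *
  field_simp
  linear_combination -2 * a x * e

theorem expPrim_eq_of_le (hX : 0 < X) (hs : ∀ x, X ≤ |x| → a x = 0) {x : ℝ} (hx : X ≤ x) :
    expPrim k X a x = expPrim k X a X := by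
  -- No regularity of `a` is assumed. If the integrand is not integrable on `[-X, X]`, it is not
  -- integrable on the larger interval either, and both integrals are `0` by convention.
  by_cases ha : IntervalIntegrable (fun ξ : ℝ => Complex.exp (k * ξ) * a ξ) volume (-X) X
  · have h0 : EqOn (fun ξ : ℝ => Complex.exp (k * ξ) * a ξ) (fun _ => 0) (uIcc X x) := by
      intro ξ hξ
      rw [uIcc_of_le hx] at hξ
      simp [hs ξ (hξ.1.trans (le_abs_self ξ))]
    have hi : IntervalIntegrable (fun ξ : ℝ => Complex.exp (k * ξ) * a ξ) volume X x :=
      (intervalIntegrable_const (c := (0 : ℂ))).congr (fun ξ hξ => (h0 (uIoc_subset_uIcc hξ)).symm)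
    unfold expPrim
    rw [← intervalIntegral.integral_add_adjacent_intervals ha hi,
      intervalIntegral.integral_congr h0]
    simp
  · unfold expPrim
    rw [intervalIntegral.integral_undef ha, intervalIntegral.integral_undef]
    intro h
    exact ha (h.mono_set (by
      rw [uIcc_of_le (by linarith), uIcc_of_le (by linarith)]
      exact Icc_subset_Icc_right hx))

theorem expPrim_eq_zero (hs : ∀ x, X ≤ |x| → a x = 0) {x : ℝ} (hx : x ≤ -X) :
    expPrim k X a x = 0 := by
  have h0 : EqOn (fun ξ : ℝ => Complex.exp (k * ξ) * a ξ) (fun _ => 0) (uIcc (-X) x) := by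
    intro ξ hξ
    rw [uIcc_of_ge hx] at hξ
    have : X ≤ |ξ| := by
      have := neg_le_abs ξ
      linarith [hξ.2]
    simp [hs ξ this]
  unfold expPrim
  rw [intervalIntegral.integral_congr h0]
  simp

theorem expPrimRight_eq (k : ℂ) (X : ℝ) (a : ℝ → ℂ) (x : ℝ) :
    expPrimRight k X a x = expPrim k X (fun ξ => a (-ξ)) (-x) := by
  unfold expPrimRight expPrim
  rw [← intervalIntegral.integral_comp_neg]
  simp

theorem neg_supp (hs : ∀ x, X ≤ |x| → a x = 0) : ∀ x, X ≤ |x| → a (-x) = 0 := fun x hx =>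
  hs (-x) (by rwa [abs_neg])

/-- Beyond the support the convolution is a pure exponential with an exponential mean of `a` as
coefficient. In the open channel these coefficients are the scattered amplitudes. -/
theorem greenConv_of_ge (hX : 0 < X) (hs : ∀ x, X ≤ |x| → a x = 0) {x : ℝ} (hx : X ≤ x) :
    greenConv k X a x = 1 / (2 * k) * (Complex.exp (-k * x) * expPrim k X a X) := by
  unfold greenConv
  rw [expPrim_eq_of_le hX hs hx, expPrimRight_eq, expPrim_eq_zero (neg_supp hs) (by linarith),
    mul_zero, add_zero]

theorem greenConv_of_le (hX : 0 < X) (hs : ∀ x, X ≤ |x| → a x = 0) {x : ℝ} (hx : x ≤ -X) :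
    greenConv k X a x = 1 / (2 * k) * (Complex.exp (k * x) * expPrim (-k) X a X) := by
  unfold greenConv
  rw [expPrim_eq_zero hs hx, mul_zero, zero_add, expPrimRight_eq,
    expPrim_eq_of_le hX (neg_supp hs) (by linarith : X ≤ -x)]
  congr 2
  unfold expPrim
  conv_rhs => rw [← neg_neg X, ← intervalIntegral.integral_comp_neg]
  simp

/-- Integrating `e^{kξ}` gains the factor `1/k`. The decay is stated at the fixed rate `b ≤ k`, at
the price of `e^{bX}`, so that one weight serves all closed modes. -/
theorem norm_exp_mul_expPrim_le {k b s : ℝ} (hb : 0 < b) (hbk : b ≤ k) (hX : 0 < X)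
    (hs : ∀ x, X ≤ |x| → a x = 0) (ha : ∀ x, ‖a x‖ ≤ s) (x : ℝ) :
    ‖Complex.exp (-(k : ℂ) * x) * expPrim k X a x‖ ≤ s / k * Real.exp (b * X) * Real.exp (-b * |x|) := by
  have hk : 0 < k := hb.trans_le hbk
  have hs0 : 0 ≤ s := (norm_nonneg _).trans (ha 0)
  have key : ∀ x, -X ≤ x → ‖expPrim k X a x‖ ≤ s / k * Real.exp (k * x) := by
    intro x hx
    have h1 : ‖expPrim k X a x‖ ≤ ∫ ξ in (-X)..x, s * Real.exp (k * ξ) := by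
      refine intervalIntegral.norm_integral_le_of_norm_le hx (ae_of_all _ fun ξ _ => ?_)
        (Continuous.intervalIntegrable (by fun_prop) _ _)
      rw [norm_mul, ← Complex.ofReal_mul, Complex.norm_exp_ofReal, mul_comm]
      exact mul_le_mul_of_nonneg_right (ha ξ) (Real.exp_pos _).le
    have h2 : ∫ ξ in (-X)..x, s * Real.exp (k * ξ) =
        s / k * Real.exp (k * x) - s / k * Real.exp (k * (-X)) := by
      refine intervalIntegral.integral_eq_sub_of_hasDerivAt
        (f := fun ξ => s / k * Real.exp (k * ξ)) (fun ξ _ => ?_)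
        (Continuous.intervalIntegrable (by fun_prop) _ _)
      have := ((((hasDerivAt_id ξ).const_mul k).exp).const_mul (s / k))
      refine this.congr_deriv ?_
      simp only [id]
      field_simp
    rw [h2] at h1
    have : 0 ≤ s / k * Real.exp (k * (-X)) := by positivity
    linarith
  have hexp : ∀ x : ℝ, ‖Complex.exp (-(k : ℂ) * x)‖ = Real.exp (-k * x) := fun x => by
    rw [show -(k : ℂ) * x = ((-k * x : ℝ) : ℂ) by push_cast; ring, Complex.norm_exp_ofReal]
  rw [norm_mul, hexp, mul_assoc (s / k), ← Real.exp_add]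
  rcases le_or_gt x (-X) with h | h
  · rw [expPrim_eq_zero hs h, norm_zero, mul_zero]
    positivity
  rcases le_or_gt x X with h' | h'
  · calc Real.exp (-k * x) * ‖expPrim k X a x‖ ≤ Real.exp (-k * x) * (s / k * Real.exp (k * x)) :=
        mul_le_mul_of_nonneg_left (key x h.le) (Real.exp_pos _).le
      _ = s / k * Real.exp 0 := by
        rw [mul_left_comm, ← Real.exp_add]
        congr 2
        ring
      _ ≤ _ := by
        have : |x| ≤ X := abs_le.mpr ⟨h.le, h'⟩
        gcongr
        nlinarith
  · rw [expPrim_eq_of_le hX hs h'.le]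
    calc Real.exp (-k * x) * ‖expPrim k X a X‖ ≤ Real.exp (-k * x) * (s / k * Real.exp (k * X)) :=
        mul_le_mul_of_nonneg_left (key X (by linarith)) (Real.exp_pos _).le
      _ = s / k * Real.exp (-k * x + k * X) := by
        rw [mul_left_comm, ← Real.exp_add]
      _ ≤ _ := by
        rw [abs_of_pos (by linarith)]
        refine mul_le_mul_of_nonneg_left (Real.exp_le_exp.mpr ?_) (by positivity)
        nlinarith

/-- The weight `1/(1+x²)`. -/
def rho (x : ℝ) : ℝ := 1 / (1 + x ^ 2)

theorem rho_pos (x : ℝ) : 0 < rho x := by unfold rho; positivity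

theorem rho_le_one (x : ℝ) : rho x ≤ 1 := by
  unfold rho
  rw [div_le_one (by positivity)]
  linarith [sq_nonneg x]

theorem continuous_rho : Continuous rho := by
  unfold rho
  exact continuous_const.div (by fun_prop) fun x => by positivity

/-- The fourth order Taylor term of the exponential dominates `(1 + x²)² ≤ 2 + 2x⁴`, whence `48 = 2
· 4!`. The square of `rho` is kept on purpose: in cut-off arguments one factor becomes small and the
other remains square integrable. -/
theorem exp_neg_le_rho_sq {b : ℝ} (hb : 0 < b) :
    ∃ C, 0 < C ∧ ∀ x : ℝ, Real.exp (-b * |x|) ≤ C * rho x ^ 2 := by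
  refine ⟨2 + 48 / b ^ 4, by positivity, fun x => ?_⟩
  have h1 := Real.pow_div_factorial_le_exp (b * |x|) (by positivity) 4
  have h2 : 1 ≤ Real.exp (b * |x|) := Real.one_le_exp (by positivity)
  have e : (b * |x|) ^ 4 = b ^ 4 * x ^ 4 := by
    rw [mul_pow]
    congr 1
    rw [show |x| ^ 4 = (|x| ^ 2) ^ 2 by ring, sq_abs]
    ring
  rw [e] at h1
  have h3 : x ^ 4 ≤ 24 / b ^ 4 * Real.exp (b * |x|) := by
    rw [div_mul_eq_mul_div, le_div_iff₀ (by positivity)]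
    have : ((Nat.factorial 4 : ℕ) : ℝ) = 24 := by norm_num [Nat.factorial]
    rw [this, div_le_iff₀ (by norm_num)] at h1
    linarith
  have h4 : (1 + x ^ 2) ^ 2 ≤ (2 + 48 / b ^ 4) * Real.exp (b * |x|) := by
    have : (1 + x ^ 2) ^ 2 ≤ 2 + 2 * x ^ 4 := by nlinarith [sq_nonneg (x ^ 2 - 1)]
    have e2 : (2 + 48 / b ^ 4) * Real.exp (b * |x|) =
      2 * Real.exp (b * |x|) + 2 * (24 / b ^ 4 * Real.exp (b * |x|)) := by ring
    linarith
  unfold rho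
  rw [one_div, inv_pow, ← div_eq_mul_inv, le_div_iff₀ (by positivity), neg_mul, Real.exp_neg,
    inv_mul_le_iff₀ (Real.exp_pos _), mul_comm]
  exact h4

/-- The constant depends on `b` and `X` alone. The second power of `1/k` leaves room for the factor
`β + n` that `∂_y` produces. -/
theorem exists_greenConv_bound {b : ℝ} (hb : 0 < b) (hX : 0 < X) : ∃ C, 0 < C ∧
    ∀ (k : ℝ) (a : ℝ → ℂ) (s : ℝ), b ≤ k → (∀ x, X ≤ |x| → a x = 0) → (∀ x, ‖a x‖ ≤ s) → ∀ x,
      ‖greenConv k X a x‖ ≤ C * s / k ^ 2 * rho x ^ 2 ∧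
      ‖greenConvDeriv k X a x‖ ≤ C * s / k * rho x ^ 2 := by
  obtain ⟨C, hC, h⟩ := exp_neg_le_rho_sq hb
  refine ⟨Real.exp (b * X) * C, by positivity, fun k a s hbk hs ha x => ?_⟩
  have hk : 0 < k := hb.trans_le hbk
  have hs0 : 0 ≤ s := (norm_nonneg _).trans (ha 0)
  have h1 : ‖Complex.exp (-(k : ℂ) * x) * expPrim k X a x‖ ≤
      s / k * Real.exp (b * X) * (C * rho x ^ 2) :=
    (norm_exp_mul_expPrim_le hb hbk hX hs ha x).trans
      (mul_le_mul_of_nonneg_left (h x) (by positivity))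
  have h2 : ‖Complex.exp ((k : ℂ) * x) * expPrimRight k X a x‖ ≤
      s / k * Real.exp (b * X) * (C * rho x ^ 2) := by
    have := norm_exp_mul_expPrim_le hb hbk hX (neg_supp hs) (fun x => ha (-x)) (-x)
    rw [← expPrimRight_eq, abs_neg] at this
    simp only [Complex.ofReal_neg, neg_mul_neg] at this
    exact this.trans (mul_le_mul_of_nonneg_left (h x) (by positivity))
  constructor
  · unfold greenConv
    rw [norm_mul, norm_div, norm_one, norm_mul, RCLike.norm_ofNat, Complex.norm_real,
      Real.norm_of_nonneg hk.le]
    calc _ ≤ 1 / (2 * k) * (s / k * Real.exp (b * X) * (C * rho x ^ 2) +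
          s / k * Real.exp (b * X) * (C * rho x ^ 2)) :=
        mul_le_mul_of_nonneg_left ((norm_add_le _ _).trans (add_le_add h1 h2)) (by positivity)
      _ = _ := by field_simp; ring
  · unfold greenConvDeriv
    rw [norm_mul, norm_div, norm_one, RCLike.norm_ofNat]
    calc _ ≤ 1 / 2 * (s / k * Real.exp (b * X) * (C * rho x ^ 2) +
            s / k * Real.exp (b * X) * (C * rho x ^ 2)) := by
          refine mul_le_mul_of_nonneg_left ((norm_add_le _ _).trans (add_le_add ?_ h2)) (by positivity)
          rw [norm_neg]
          exact h1
      _ = _ := by field_simp; ring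

/-- Extension by zero. -/
def zeroExt (A : C(Icc (-X) X, ℂ)) (x : ℝ) : ℂ :=
  open Classical in if h : x ∈ Icc (-X) X then A ⟨x, h⟩ else 0

theorem zeroExt_coe (A : C(Icc (-X) X, ℂ)) (x : Icc (-X) X) : zeroExt A x = A x := by
  rw [zeroExt, dif_pos x.2]

theorem norm_zeroExt_le (A : C(Icc (-X) X, ℂ)) (x : ℝ) : ‖zeroExt A x‖ ≤ ‖A‖ := by
  unfold zeroExt
  split_ifs
  · exact A.norm_coe_le_norm _
  · simp

theorem continuous_zeroExt (hX : 0 < X) {A : C(Icc (-X) X, ℂ)} (hs : ∀ x, X ≤ |x| → zeroExt A x = 0) :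
    Continuous (zeroExt A) := by
  have e : zeroExt A = (Icc (-X) X).indicator (zeroExt A) := by
    funext x
    by_cases h : x ∈ Icc (-X) X
    · rw [indicator_of_mem h]
    · rw [indicator_of_notMem h, zeroExt, dif_neg h]
  rw [e]
  refine continuous_indicator (fun x hx => ?_) ?_
  · rw [frontier_Icc (by linarith)] at hx
    refine hs x ?_
    rcases hx with rfl | rfl
    · rw [abs_neg]
      exact le_abs_self X
    · exact le_abs_self _
  · rw [isClosed_Icc.closure_eq, continuousOn_iff_continuous_domRestrict]
    have : (Icc (-X) X).domRestrict (zeroExt A) = A := by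
      funext x
      exact zeroExt_coe A x
    rw [this]
    exact A.continuous

theorem integral_intervalMeasure (hX : 0 < X) (g : ℝ → ℂ) :
    ∫ ξ, g ξ ∂(intervalMeasure X) = ∫ ξ in (-X)..X, g ξ := by
  rw [integral_subtype_comap measurableSet_Icc, intervalIntegral.integral_of_le (by linarith),
    integral_Icc_eq_integral_Ioc]

theorem greenConv_eq_integral (hX : 0 < X) {A : C(Icc (-X) X, ℂ)}
    (hs : ∀ x, X ≤ |x| → zeroExt A x = 0) (x : Icc (-X) X) :
    greenConv k X (zeroExt A) x =
      ∫ ξ, greenE k |(x : ℝ) - ξ| * A ξ ∂(intervalMeasure X) := by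
  have hc := continuous_zeroExt hX hs
  have hg : Continuous fun ξ : ℝ => greenE k |(x : ℝ) - ξ| * zeroExt A ξ := by
    unfold greenE
    fun_prop
  have e1 : ∀ ξ : Icc (-X) X, greenE k |(x : ℝ) - ξ| * A ξ =
      (fun ξ : ℝ => greenE k |(x : ℝ) - ξ| * zeroExt A ξ) ξ := fun ξ => by
    simp only [zeroExt_coe]
  simp_rw [e1]
  rw [integral_intervalMeasure hX (fun ξ : ℝ => greenE k |(x : ℝ) - ξ| * zeroExt A ξ), ← intervalIntegral.integral_add_adjacent_intervals
    (hg.intervalIntegrable (-X) x) (hg.intervalIntegrable x X)]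
  unfold greenConv expPrim expPrimRight
  rw [mul_add, ← intervalIntegral.integral_const_mul, ← intervalIntegral.integral_const_mul,
    ← intervalIntegral.integral_const_mul, ← intervalIntegral.integral_const_mul]
  congr 1
  · refine intervalIntegral.integral_congr fun ξ hξ => ?_
    rw [uIcc_of_le x.2.1] at hξ
    simp only [greenE]
    rw [abs_of_nonneg (by linarith [hξ.2]), ← mul_assoc (Complex.exp _), ← Complex.exp_add,
      ← mul_assoc]
    congr 3
    push_cast
    ring
  · refine intervalIntegral.integral_congr fun ξ hξ => ?_
    rw [uIcc_of_le x.2.2] at hξ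
    simp only [greenE]
    rw [abs_of_nonpos (by linarith [hξ.1]), ← mul_assoc (Complex.exp _), ← Complex.exp_add,
      ← mul_assoc]
    congr 3
    push_cast
    ring

end

section

/-! ### Integration by parts in the strip -/

/-- The transversal modes `e^{i(β+m)y}`. -/
def quasiMode (β : ℝ) (m : ℤ) (y : ℝ) : ℂ := Complex.exp (Complex.I * (β + m) * y)

theorem norm_quasiMode (β : ℝ) (m : ℤ) (y : ℝ) : ‖quasiMode β m y‖ = 1 := by
  rw [quasiMode, show Complex.I * (β + m) * y = (((β + m) * y : ℝ) : ℂ) * Complex.I by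
    push_cast; ring, Complex.norm_exp_ofReal_mul_I]

theorem contDiff_quasiMode (β : ℝ) (m : ℤ) : ContDiff ℝ ∞ (quasiMode β m) := by
  unfold quasiMode
  have : ContDiff ℝ ∞ fun y : ℝ => (y : ℂ) := Complex.ofRealCLM.contDiff
  exact (contDiff_const.mul this).cexp

theorem continuous_quasiMode (β : ℝ) (m : ℤ) : Continuous (quasiMode β m) :=
  (contDiff_quasiMode β m).continuous

theorem hasDerivAt_quasiMode (β : ℝ) (m : ℤ) (y : ℝ) :
    HasDerivAt (quasiMode β m) (Complex.I * (β + m) * quasiMode β m y) y :=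
  hasDerivAt_exp_mul _ y

theorem quasiMode_two_pi (β : ℝ) (m : ℤ) :
    quasiMode β m (2 * Real.pi) = Complex.exp (2 * Real.pi * Complex.I * β) := by
  rw [quasiMode, Complex.exp_eq_exp_iff_exists_int]
  exact ⟨m, by push_cast; ring⟩

theorem quasiMode_zero (β : ℝ) (m : ℤ) : quasiMode β m 0 = 1 := by simp [quasiMode]

theorem isOpen_strip : IsOpen strip := isOpen_univ.prod isOpen_Ioo

theorem measurableSet_strip : MeasurableSet strip := isOpen_strip.measurableSet

theorem snd_mem_of_mem_strip {p : ℝ × ℝ} (hp : p ∈ strip) : p.2 ∈ Icc (0 : ℝ) (2 * Real.pi) :=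
  Ioo_subset_Icc_self hp.2

variable {β : ℝ} {Φ : ℝ × ℝ → ℂ}

theorem IsTestFunction.continuous_dX (h : IsTestFunction β Φ) : Continuous (dX Φ) :=
  (h.smooth.continuous_fderiv (by simp)).clm_apply continuous_const

theorem IsTestFunction.continuous_dY (h : IsTestFunction β Φ) : Continuous (dY Φ) :=
  (h.smooth.continuous_fderiv (by simp)).clm_apply continuous_const

theorem IsTestFunction.exists_vanish (h : IsTestFunction β Φ) :
    ∃ L, 0 < L ∧ (∀ x y : ℝ, L < |x| → y ∈ Icc (0 : ℝ) (2 * Real.pi) → Φ (x, y) = 0) ∧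
      ∀ p ∈ strip, L < |p.1| → Φ p = 0 ∧ dX Φ p = 0 ∧ dY Φ p = 0 := by
  obtain ⟨L, hL⟩ := h.vanish
  refine ⟨max L 1, lt_max_of_lt_right one_pos,
    fun x y hx hy => hL x y ((le_max_left _ _).trans_lt hx) hy, fun p hp hpL => ?_⟩
  have hpL : L < |p.1| := (le_max_left _ _).trans_lt hpL
  have ho : IsOpen (strip ∩ {p : ℝ × ℝ | L < |p.1|}) :=
    isOpen_strip.inter (isOpen_lt continuous_const (by fun_prop))
  have he : Φ =ᶠ[𝓝 p] fun _ => (0 : ℂ) := by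
    filter_upwards [ho.mem_nhds ⟨hp, hpL⟩] with q hq
    exact hL q.1 q.2 hq.2 (snd_mem_of_mem_strip hq.1)
  refine ⟨hL p.1 p.2 hpL (snd_mem_of_mem_strip hp), ?_, ?_⟩
  · simp [dX, he.fderiv_eq]
  · simp [dY, he.fderiv_eq]

theorem strip_inter_ae_eq (L : ℝ) :
    (Icc (-L) L ×ˢ Ioo (0 : ℝ) (2 * Real.pi) : Set (ℝ × ℝ)) =ᵐ[volume]
      Icc ((-L, 0) : ℝ × ℝ) (L, 2 * Real.pi) := by
  rw [← Icc_prod_Icc, Measure.volume_eq_prod]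
  exact Measure.set_prod_ae_eq (ae_eq_refl _) Ioo_ae_eq_Icc

theorem Icc_prod_Ioo_subset_strip (L : ℝ) :
    (Icc (-L) L ×ˢ Ioo (0 : ℝ) (2 * Real.pi) : Set (ℝ × ℝ)) ⊆ strip :=
  prod_mono (subset_univ _) Subset.rfl

theorem eq_zero_of_mem_strip_diff {L : ℝ} {g : ℝ × ℝ → ℂ} (h0 : ∀ p ∈ strip, L < |p.1| → g p = 0) :
    ∀ p ∈ strip \ (Icc (-L) L ×ˢ Ioo (0 : ℝ) (2 * Real.pi)), g p = 0 := by
  intro p hp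
  refine h0 p hp.1 ?_
  by_contra hc
  exact hp.2 ⟨abs_le.mp (not_lt.mp hc), hp.1.2⟩

theorem integrableOn_strip {L : ℝ} {g : ℝ × ℝ → ℂ} (hg : Continuous g)
    (h0 : ∀ p ∈ strip, L < |p.1| → g p = 0) : IntegrableOn g strip := by
  have h1 : IntegrableOn g (Icc (-L) L ×ˢ Ioo (0 : ℝ) (2 * Real.pi)) := by
    rw [integrableOn_congr_set_ae (strip_inter_ae_eq L)]
    exact hg.continuousOn.integrableOn_compact isCompact_Icc
  exact h1.of_forall_sdiff_eq_zero measurableSet_strip (eq_zero_of_mem_strip_diff h0)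

theorem setIntegral_strip_eq {L : ℝ} {g : ℝ × ℝ → ℂ} (h0 : ∀ p ∈ strip, L < |p.1| → g p = 0) :
    ∫ p in strip, g p = ∫ p in Icc ((-L, 0) : ℝ × ℝ) (L, 2 * Real.pi), g p := by
  rw [← setIntegral_congr_set (strip_inter_ae_eq L)]
  exact setIntegral_eq_of_subset_of_forall_sdiff_eq_zero measurableSet_strip
    (Icc_prod_Ioo_subset_strip L) (eq_zero_of_mem_strip_diff h0)

/-- Green's formula for `q(x) e^{i(β+m)y}`: the vertical sides contribute nothing because `Φ`
vanishes there, and the two horizontal sides cancel by quasiperiodicity. -/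
theorem integral_strip_mode (hΦ : IsTestFunction β Φ) {q q₁ q₂ : ℝ → ℂ}
    (hq : ∀ x, HasDerivAt q (q₁ x) x) (hq₁ : ∀ x, HasDerivAt q₁ (q₂ x) x) (hq₂ : Continuous q₂)
    (m : ℤ) :
    ∫ p in strip, (q₁ p.1 * quasiMode β m p.2 * conj (dX Φ p) +
        Complex.I * (β + m) * q p.1 * quasiMode β m p.2 * conj (dY Φ p)) =
      ∫ p in strip, ((β + m) ^ 2 * q p.1 - q₂ p.1) * quasiMode β m p.2 * conj (Φ p) := by
  obtain ⟨L, hL0, hL, hv⟩ := hΦ.exists_vanish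
  have hqc : Continuous q := continuous_iff_continuousAt.mpr fun x => (hq x).continuousAt
  have hqc₁ : Continuous q₁ := continuous_iff_continuousAt.mpr fun x => (hq₁ x).continuousAt
  have hec := continuous_quasiMode β m
  have hΦc := hΦ.smooth.continuous
  have hXc := hΦ.continuous_dX
  have hYc := hΦ.continuous_dY
  have hc1 : Continuous fun p : ℝ × ℝ => q₁ p.1 * quasiMode β m p.2 * conj (dX Φ p) +
      Complex.I * (β + m) * q p.1 * quasiMode β m p.2 * conj (dY Φ p) := by fun_prop
  have hc2 : Continuous fun p : ℝ × ℝ =>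
      ((β + m) ^ 2 * q p.1 - q₂ p.1) * quasiMode β m p.2 * conj (Φ p) := by fun_prop
  have hz1 : ∀ p ∈ strip, L < |p.1| → q₁ p.1 * quasiMode β m p.2 * conj (dX Φ p) +
      Complex.I * (β + m) * q p.1 * quasiMode β m p.2 * conj (dY Φ p) = 0 := fun p hp hpL => by
    rw [(hv p hp hpL).2.1, (hv p hp hpL).2.2]
    simp
  have hz2 : ∀ p ∈ strip, L < |p.1| →
      ((β + m) ^ 2 * q p.1 - q₂ p.1) * quasiMode β m p.2 * conj (Φ p) = 0 := fun p hp hpL => by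
    rw [(hv p hp hpL).1]
    simp
  rw [← sub_eq_zero, ← integral_sub (integrableOn_strip hc1 hz1) (integrableOn_strip hc2 hz2)]
  -- The rectangle is cut at `L + 1`, because `Φ` is known to vanish only for `|x| > L` and its
  -- vertical sides must lie in that region.
  rw [setIntegral_strip_eq (L := L + 1) (fun p hp hpL => by
    rw [hz1 p hp (by linarith), hz2 p hp (by linarith), sub_zero])]
  have hd : ∀ p : ℝ × ℝ, HasFDerivAt Φ (fderiv ℝ Φ p) p := fun p =>
    ((hΦ.smooth.differentiable (by simp)) p).hasFDerivAt
  have hdc : ∀ p : ℝ × ℝ, HasFDerivAt (fun p => conj (Φ p))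
      ((Complex.conjCLE : ℂ →L[ℝ] ℂ).comp (fderiv ℝ Φ p)) p := fun p =>
    (Complex.conjCLE : ℂ →L[ℝ] ℂ).hasFDerivAt.comp p (hd p)
  have hfst : ∀ {r r' : ℝ → ℂ} (_ : ∀ x, HasDerivAt r (r' x) x) (p : ℝ × ℝ),
      HasFDerivAt (fun p : ℝ × ℝ => r p.1)
        (((1 : ℝ →L[ℝ] ℝ).smulRight (r' p.1)).comp (ContinuousLinearMap.fst ℝ ℝ ℝ)) p :=
    fun hr p => (hr p.1).hasFDerivAt.comp p hasFDerivAt_fst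
  have hsnd : ∀ p : ℝ × ℝ, HasFDerivAt (fun p : ℝ × ℝ => quasiMode β m p.2)
        (((1 : ℝ →L[ℝ] ℝ).smulRight (Complex.I * (β + m) * quasiMode β m p.2)).comp
          (ContinuousLinearMap.snd ℝ ℝ ℝ)) p :=
    fun p => (hasDerivAt_quasiMode β m p.2).hasFDerivAt.comp p hasFDerivAt_snd
  have hF := fun p : ℝ × ℝ => ((hfst hq₁ p).mul (hsnd p)).mul (hdc p)
  have hG := fun p : ℝ × ℝ => (((hfst hq p).const_mul (Complex.I * (β + m))).mul (hsnd p)).mul (hdc p)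
  have hI : Complex.I * Complex.I = -1 := Complex.I_mul_I
  have key := integral_divergence_prod_Icc_of_hasFDerivAt_of_le _ _ _ _
    ((-(L + 1), 0) : ℝ × ℝ) (L + 1, 2 * Real.pi) ⟨by simp; linarith, by simp; positivity⟩
    (fun p _ => (hF p).continuousAt.continuousWithinAt)
    (fun p _ => (hG p).continuousAt.continuousWithinAt)
    (fun p _ => hF p) (fun p _ => hG p) ?_
  · refine Eq.trans ?_ (key.trans ?_)
    · refine setIntegral_congr_fun measurableSet_Icc fun p _ => ?_
      simp [dX, dY]
      linear_combination (-(β + m) ^ 2 * q p.1 * quasiMode β m p.2 * conj (Φ p)) * hI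
    · have e1 : ∀ y ∈ uIcc (0 : ℝ) (2 * Real.pi), Φ (L + 1, y) = 0 := fun y hy => by
        rw [uIcc_of_le Real.two_pi_pos.le] at hy
        exact hL _ _ (by rw [abs_of_pos (by linarith)]; linarith) hy
      have e2 : ∀ y ∈ uIcc (0 : ℝ) (2 * Real.pi), Φ (-(L + 1), y) = 0 := fun y hy => by
        rw [uIcc_of_le Real.two_pi_pos.le] at hy
        exact hL _ _ (by rw [abs_neg, abs_of_pos (by linarith)]; linarith) hy
      have i1 : ∫ y in (0 : ℝ)..(2 * Real.pi),
          q₁ (L + 1) * quasiMode β m y * conj (Φ (L + 1, y)) = 0 := by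
        rw [intervalIntegral.integral_congr (g := fun _ => 0) fun y hy => by simp [e1 y hy]]
        simp
      have i2 : ∫ y in (0 : ℝ)..(2 * Real.pi),
          q₁ (-(L + 1)) * quasiMode β m y * conj (Φ (-(L + 1), y)) = 0 := by
        rw [intervalIntegral.integral_congr (g := fun _ => 0) fun y hy => by simp only [e2 y hy, map_zero, mul_zero]]
        simp
      -- The mode and the conjugated test function carry opposite phases `e^{±2πiβ}`, whose product
      -- is `1`.
      have e3 : ∀ x : ℝ, quasiMode β m (2 * Real.pi) * conj (Φ (x, 2 * Real.pi)) =
          quasiMode β m 0 * conj (Φ (x, 0)) := fun x => by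
        rw [hΦ.bc, map_mul, quasiMode_zero, quasiMode_two_pi, ← mul_assoc, Complex.mul_conj]
        have : (2 : ℂ) * Real.pi * Complex.I * β = ((2 * Real.pi * β : ℝ) : ℂ) * Complex.I := by
          push_cast; ring
        rw [this, Complex.normSq_eq_norm_sq, Complex.norm_exp_ofReal_mul_I]
        simp
      simp only [Pi.mul_apply]
      rw [i1, i2]
      simp only [mul_assoc, e3]
      simp
  · refine Continuous.integrableOn_Icc ?_
    have hc3 := hc1.sub hc2
    refine hc3.congr fun p => ?_
    simp [dX, dY]
    linear_combination (-(β + m) ^ 2 * q p.1 * quasiMode β m p.2 * conj (Φ p)) * hI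

end

/-! ### Approximation by smooth compactly supported functions -/

/-- A smooth bump equal to `1` on `[-1, 1]` and to `0` outside `(-2, 2)`. -/
def cutoffBump : ContDiffBump (0 : ℝ) := ⟨1, 2, one_pos, one_lt_two⟩

/-- The rescaled cut-off `θ(x/L)`. -/
def cutoff (L x : ℝ) : ℝ := cutoffBump (x / L)

theorem contDiff_cutoff (L : ℝ) : ContDiff ℝ ∞ (cutoff L) := by
  unfold cutoff
  exact cutoffBump.contDiff.comp (contDiff_id.div_const L)

theorem cutoff_eq_one {L x : ℝ} (hL : 0 < L) (hx : |x| ≤ L) : cutoff L x = 1 := by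
  refine cutoffBump.one_of_mem_closedBall ?_
  rw [mem_closedBall_zero_iff, Real.norm_eq_abs, abs_div, abs_of_pos hL]
  exact (div_le_one hL).mpr hx

theorem cutoff_eq_zero {L x : ℝ} (hL : 0 < L) (hx : 2 * L ≤ |x|) : cutoff L x = 0 := by
  refine cutoffBump.zero_of_le_dist ?_
  rw [dist_zero_right, Real.norm_eq_abs, abs_div, abs_of_pos hL]
  exact (le_div_iff₀ hL).mpr hx

theorem cutoff_mem_Icc (L x : ℝ) : cutoff L x ∈ Icc (0 : ℝ) 1 :=
  ⟨cutoffBump.nonneg, cutoffBump.le_one⟩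

theorem hasDerivAt_cutoff (L x : ℝ) :
    HasDerivAt (cutoff L) (deriv cutoffBump (x / L) / L) x := by
  have h : HasDerivAt cutoffBump (deriv cutoffBump (x / L)) (x / L) :=
    ((cutoffBump.contDiff (n := 1)).differentiable one_ne_zero _).hasDerivAt
  exact (h.comp x ((hasDerivAt_id x).div_const L)).congr_deriv (by ring)

theorem exists_cutoff_deriv_bound : ∃ M, 0 ≤ M ∧ ∀ x, |deriv cutoffBump x| ≤ M := by
  have hc : Continuous (deriv cutoffBump) :=
    (cutoffBump.contDiff (n := 1)).continuous_deriv le_rfl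
  obtain ⟨M, hM⟩ := hc.bounded_above_of_compact_support cutoffBump.hasCompactSupport.deriv
  exact ⟨M, (norm_nonneg _).trans (hM 0), hM⟩

theorem deriv_cutoffBump_eq_zero {x : ℝ} (hx : |x| < 1) : deriv cutoffBump x = 0 := by
  have he : (cutoffBump : ℝ → ℝ) =ᶠ[𝓝 x] fun _ => (1 : ℝ) := by
    have : Metric.ball (0 : ℝ) 1 ∈ 𝓝 x := Metric.isOpen_ball.mem_nhds (by simpa using hx)
    filter_upwards [this] with y hy
    exact cutoffBump.one_of_mem_closedBall (Metric.ball_subset_closedBall hy)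
  rw [he.deriv_eq]
  simp

theorem rho_anti {x y : ℝ} (h : |x| ≤ |y|) : rho y ≤ rho x := by
  unfold rho
  exact one_div_le_one_div_of_le (by positivity) (by linarith [sq_le_sq.mpr h])

theorem exists_rho_le {η : ℝ} (hη : 0 < η) : ∃ L, 0 < L ∧ rho L ≤ η := by
  refine ⟨1 / η + 1, by positivity, ?_⟩
  unfold rho
  rw [div_le_iff₀ (by positivity)]
  have h1 : 0 < 1 / η := by positivity
  have h2 : η * (1 / η) = 1 := by field_simp
  nlinarith [mul_pos hη h1, mul_pos hη (mul_pos h1 h1)]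

/-- Mollification: `v` and `v'` have compact support, hence are uniformly continuous, and
differentiation commutes with convolution. A radius at most `1` enlarges the support by at most `1`.
-/
theorem exists_contDiff_approx {v v₁ : ℝ → ℂ} (hv : ∀ x, HasDerivAt v (v₁ x) x)
    (hv₁ : Continuous v₁) {N : ℝ} (hs : ∀ x, N ≤ |x| → v x = 0) {η : ℝ} (hη : 0 < η) :
    ∃ u : ℝ → ℂ, ContDiff ℝ ∞ u ∧ (∀ x, N + 1 ≤ |x| → u x = 0) ∧
      (∀ x, ‖u x - v x‖ ≤ η) ∧ (∀ x, ‖deriv u x - v₁ x‖ ≤ η) ∧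
      (∀ x, N + 1 < |x| → deriv u x = 0 ∧ v₁ x = 0) := by
  have hd : deriv v = v₁ := funext fun x => (hv x).deriv
  have hvc : Continuous v := continuous_iff_continuousAt.mpr fun x => (hv x).continuousAt
  have hcd : ContDiff ℝ 1 v := by
    rw [contDiff_one_iff_deriv, hd]
    exact ⟨fun x => (hv x).differentiableAt, hv₁⟩
  have hcs : HasCompactSupport v := by
    refine HasCompactSupport.intro (isCompact_Icc (a := -N) (b := N)) fun x hx => hs x ?_
    by_contra h
    exact hx (abs_le.mp (not_le.mp h).le)
  have hcs₁ : HasCompactSupport v₁ := hd ▸ hcs.deriv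
  have hu := hcs.uniformContinuous_of_continuous hvc
  have hu₁ := hcs₁.uniformContinuous_of_continuous hv₁
  obtain ⟨d, hd0, hdd⟩ := Metric.uniformContinuous_iff.mp hu η hη
  obtain ⟨d₁, hd0₁, hdd₁⟩ := Metric.uniformContinuous_iff.mp hu₁ η hη
  obtain ⟨t, ht0, htd, htd₁, ht1⟩ : ∃ t : ℝ, 0 < t ∧ t ≤ d ∧ t ≤ d₁ ∧ t ≤ 1 :=
    ⟨min (min d d₁) 1, lt_min (lt_min hd0 hd0₁) one_pos, (min_le_left _ _).trans (min_le_left _ _),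
      (min_le_left _ _).trans (min_le_right _ _), min_le_right _ _⟩
  let φ : ContDiffBump (0 : ℝ) := ⟨t / 2, t, by linarith, by linarith⟩
  have hr : φ.rOut = t := rfl
  let u := convolution (φ.normed volume) v (ContinuousLinearMap.lsmul ℝ ℝ) volume
  have hu' : deriv u = convolution (φ.normed volume) v₁ (ContinuousLinearMap.lsmul ℝ ℝ) volume := by
    funext x
    have := (hcs.hasDerivAt_convolution_right (ContinuousLinearMap.lsmul ℝ ℝ)
      (φ.integrable_normed (μ := volume)).locallyIntegrable hcd x).deriv
    rw [hd] at this
    exact this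
  have hz : ∀ x, N + 1 ≤ |x| → u x = 0 := by
    intro x hx
    have h0 : v x = 0 := hs x (by linarith)
    have := φ.dist_normed_convolution_le (μ := volume) (x₀ := x) (ε := 0)
      hvc.aestronglyMeasurable (fun y hy => by
        rw [hr, Metric.mem_ball, Real.dist_eq] at hy
        have : N ≤ |y| := by
          have := abs_sub_abs_le_abs_sub x y
          rw [abs_sub_comm] at this
          linarith
        rw [h0, hs y this, dist_self])
    rw [h0, dist_zero_right] at this
    exact norm_le_zero_iff.mp this
  refine ⟨u, ?_, hz, ?_, ?_, ?_⟩
  · exact φ.hasCompactSupport_normed.contDiff_convolution_left _ φ.contDiff_normed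
      hvc.locallyIntegrable
  · intro x
    rw [← dist_eq_norm]
    exact φ.dist_normed_convolution_le (μ := volume) hvc.aestronglyMeasurable fun y hy =>
      (hdd (lt_of_lt_of_le hy htd)).le
  · intro x
    rw [← dist_eq_norm, hu']
    exact φ.dist_normed_convolution_le (μ := volume) hv₁.aestronglyMeasurable fun y hy =>
      (hdd₁ (lt_of_lt_of_le hy htd₁)).le
  · intro x hx
    have ho : IsOpen {x : ℝ | N + 1 < |x|} := isOpen_lt continuous_const continuous_abs
    have he : u =ᶠ[𝓝 x] fun _ => (0 : ℂ) := by
      filter_upwards [ho.mem_nhds hx] with y hy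
      exact hz y (le_of_lt hy)
    have he' : v =ᶠ[𝓝 x] fun _ => (0 : ℂ) := by
      filter_upwards [ho.mem_nhds hx] with y hy
      have hy : N + 1 < |y| := hy
      exact hs y (by linarith)
    rw [he.deriv_eq, ← hd, he'.deriv_eq]
    simp

/-- Cut off at scale `L`, then mollify. The cut-off changes `r` only for `|x| ≥ L`, where one of the
two factors `rho` is small. -/
theorem exists_contDiff_approx_rho {r r₁ : ℝ → ℂ} (hr : ∀ x, HasDerivAt r (r₁ x) x)
    (hr₁ : Continuous r₁) {c : ℝ} (hb : ∀ x, ‖r x‖ ≤ c * rho x ^ 2)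
    (hb₁ : ∀ x, ‖r₁ x‖ ≤ c * rho x ^ 2) {η : ℝ} (hη : 0 < η) :
    ∃ u : ℝ → ℂ, ContDiff ℝ ∞ u ∧ (∃ N, ∀ x, N ≤ |x| → u x = 0) ∧
      (∀ x, ‖u x - r x‖ ≤ η * rho x) ∧ (∀ x, ‖deriv u x - r₁ x‖ ≤ η * rho x) := by
  obtain ⟨M, hM0, hM⟩ := exists_cutoff_deriv_bound
  have hc : 0 ≤ c := by
    have := (norm_nonneg _).trans (hb 0)
    simpa [rho] using this
  obtain ⟨L₀, hL₀, hL₀'⟩ := exists_rho_le (show 0 < η / (2 * (c * (1 + M) + 1)) by positivity)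
  obtain ⟨L, hL, hL1, hLr⟩ : ∃ L, 0 < L ∧ 1 ≤ L ∧ c * (1 + M) * rho L ≤ η / 2 := by
    refine ⟨max L₀ 1, by positivity, le_max_right _ _, ?_⟩
    have h1 : rho (max L₀ 1) ≤ η / (2 * (c * (1 + M) + 1)) := by
      refine (rho_anti ?_).trans hL₀'
      rw [abs_of_pos hL₀, abs_of_pos (lt_max_of_lt_left hL₀)]
      exact le_max_left _ _
    rw [le_div_iff₀ (by positivity)] at h1
    have := rho_pos (max L₀ 1)
    nlinarith
  let v : ℝ → ℂ := fun x => (cutoff L x : ℂ) * r x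
  let v₁ : ℝ → ℂ := fun x => (deriv cutoffBump (x / L) / L : ℝ) * r x + (cutoff L x : ℂ) * r₁ x
  have hv : ∀ x, HasDerivAt v (v₁ x) x := fun x => (hasDerivAt_cutoff L x).ofReal_comp.mul (hr x)
  have hrc : Continuous r := continuous_iff_continuousAt.mpr fun x => (hr x).continuousAt
  have hdc : Continuous (deriv cutoffBump) :=
    (cutoffBump.contDiff (n := 1)).continuous_deriv le_rfl
  have hcc := (contDiff_cutoff L).continuous
  have hv₁ : Continuous v₁ := by fun_prop
  have hs : ∀ x, 2 * L ≤ |x| → v x = 0 := fun x hx => by simp [v, cutoff_eq_zero hL hx]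
  -- Everything lives in `|x| ≤ 2L + 1`, where `rho` is at least `rho (2L + 1)`; a uniform error of
  -- this size is therefore a weighted one.
  obtain ⟨u, hu, hu0, hua, hub, hu1⟩ := exists_contDiff_approx hv hv₁ hs
    (mul_pos (half_pos hη) (rho_pos (2 * L + 1)))
  have hsmall : ∀ x, L ≤ |x| → c * (1 + M) * rho x ^ 2 ≤ η / 2 * rho x := fun x hx => by
    have : rho x ≤ rho L := rho_anti (by rwa [abs_of_pos hL])
    have h3 := rho_pos x
    have : c * (1 + M) * rho x ≤ η / 2 :=
      (mul_le_mul_of_nonneg_left this (by positivity)).trans hLr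
    calc c * (1 + M) * rho x ^ 2 = c * (1 + M) * rho x * rho x := by ring
      _ ≤ _ := mul_le_mul_of_nonneg_right this h3.le
  have hvr : ∀ x, ‖v x - r x‖ ≤ η / 2 * rho x := fun x => by
    by_cases hx : |x| < L
    · have : v x - r x = 0 := by simp [v, cutoff_eq_one hL hx.le]
      rw [this, norm_zero]
      exact mul_nonneg (by positivity) (rho_pos x).le
    · refine le_trans ?_ (hsmall x (not_lt.mp hx))
      have e : v x - r x = ((cutoff L x - 1 : ℝ) : ℂ) * r x := by simp only [v]; push_cast; ring
      have hm := cutoff_mem_Icc L x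
      rw [e, norm_mul, Complex.norm_real, Real.norm_eq_abs, abs_sub_comm,
        abs_of_nonneg (by linarith [hm.2])]
      have h2 : 0 ≤ c * rho x ^ 2 := by positivity
      calc (1 - cutoff L x) * ‖r x‖ ≤ 1 * (c * rho x ^ 2) :=
          mul_le_mul (by linarith [hm.1]) (hb x) (norm_nonneg _) zero_le_one
        _ ≤ _ := by nlinarith
  have hvr₁ : ∀ x, ‖v₁ x - r₁ x‖ ≤ η / 2 * rho x := fun x => by
    by_cases hx : |x| < L
    · have h0 : deriv cutoffBump (x / L) = 0 := deriv_cutoffBump_eq_zero (by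
        rw [abs_div, abs_of_pos hL]
        exact (div_lt_one hL).mpr hx)
      have : v₁ x - r₁ x = 0 := by simp [v₁, cutoff_eq_one hL hx.le, h0]
      rw [this, norm_zero]
      exact mul_nonneg (by positivity) (rho_pos x).le
    · refine le_trans ?_ (hsmall x (not_lt.mp hx))
      have e : v₁ x - r₁ x = (deriv cutoffBump (x / L) / L : ℝ) * r x +
          ((cutoff L x - 1 : ℝ) : ℂ) * r₁ x := by simp only [v₁]; push_cast; ring
      have hm := cutoff_mem_Icc L x
      have h4 : |deriv cutoffBump (x / L) / L| ≤ M := by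
        rw [abs_div, abs_of_pos hL]
        exact (div_le_self (abs_nonneg _) hL1).trans (hM _)
      rw [e]
      refine (norm_add_le _ _).trans ?_
      rw [norm_mul, norm_mul, Complex.norm_real, Complex.norm_real, Real.norm_eq_abs,
        Real.norm_eq_abs, abs_sub_comm (cutoff L x), abs_of_nonneg (a := 1 - cutoff L x)
          (by linarith [hm.2])]
      calc _ ≤ M * (c * rho x ^ 2) + 1 * (c * rho x ^ 2) := by
            refine add_le_add (mul_le_mul h4 (hb x) (norm_nonneg _) hM0) ?_
            exact mul_le_mul (by linarith [hm.1]) (hb₁ x) (norm_nonneg _) zero_le_one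
        _ = _ := by ring
  have hfin : ∀ x, |x| ≤ 2 * L + 1 → η / 2 * rho (2 * L + 1) ≤ η / 2 * rho x := fun x hx =>
    mul_le_mul_of_nonneg_left (rho_anti (by rwa [abs_of_pos (by linarith : 0 < 2 * L + 1)]))
      (by positivity)
  refine ⟨u, hu, ⟨2 * L + 1, hu0⟩, fun x => ?_, fun x => ?_⟩
  · have h1 : ‖u x - v x‖ ≤ η / 2 * rho x := by
      by_cases hx : |x| ≤ 2 * L + 1
      · exact (hua x).trans (hfin x hx)
      · rw [hu0 x (by linarith), hs x (by linarith), sub_self, norm_zero]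
        exact mul_nonneg (by positivity) (rho_pos x).le
    calc ‖u x - r x‖ = ‖(u x - v x) + (v x - r x)‖ := by congr 1; ring
      _ ≤ _ := norm_add_le _ _
      _ ≤ η / 2 * rho x + η / 2 * rho x := add_le_add h1 (hvr x)
      _ = _ := by ring
  · have h1 : ‖deriv u x - v₁ x‖ ≤ η / 2 * rho x := by
      by_cases hx : |x| ≤ 2 * L + 1
      · exact (hub x).trans (hfin x hx)
      · obtain ⟨a, b⟩ := hu1 x (not_le.mp hx)
        rw [a, b, sub_self, norm_zero]
        exact mul_nonneg (by positivity) (rho_pos x).le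
    calc ‖deriv u x - r₁ x‖ = ‖(deriv u x - v₁ x) + (v₁ x - r₁ x)‖ := by congr 1; ring
      _ ≤ _ := norm_add_le _ _
      _ ≤ η / 2 * rho x + η / 2 * rho x := add_le_add h1 (hvr₁ x)
      _ = _ := by ring

section

/-! ### Series of modes in `H_1^β` -/

variable {β : ℝ}

theorem hasFDerivAt_mode {u : ℝ → ℂ} {u' : ℂ} {p : ℝ × ℝ} (m : ℤ) (hu : HasDerivAt u u' p.1) :
    dX (fun p => u p.1 * quasiMode β m p.2) p = u' * quasiMode β m p.2 ∧
    dY (fun p => u p.1 * quasiMode β m p.2) p = Complex.I * (β + m) * u p.1 * quasiMode β m p.2 ∧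
    DifferentiableAt ℝ (fun p : ℝ × ℝ => u p.1 * quasiMode β m p.2) p := by
  have h1 : HasFDerivAt (fun p : ℝ × ℝ => u p.1)
      (((1 : ℝ →L[ℝ] ℝ).smulRight u').comp (ContinuousLinearMap.fst ℝ ℝ ℝ)) p :=
    hu.hasFDerivAt.comp p hasFDerivAt_fst
  have h2 : HasFDerivAt (fun p : ℝ × ℝ => quasiMode β m p.2)
        (((1 : ℝ →L[ℝ] ℝ).smulRight (Complex.I * (β + m) * quasiMode β m p.2)).comp
          (ContinuousLinearMap.snd ℝ ℝ ℝ)) p :=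
    (hasDerivAt_quasiMode β m p.2).hasFDerivAt.comp p hasFDerivAt_snd
  have h := h1.mul h2
  have h' : fderiv ℝ (fun p : ℝ × ℝ => u p.1 * quasiMode β m p.2) p = _ := h.fderiv
  refine ⟨?_, ?_, h.differentiableAt⟩
  · rw [dX, h']
    simp [mul_comm]
  · rw [dY, h']
    simp
    ring

theorem isTestFunction_mode {u : ℝ → ℂ} (hu : ContDiff ℝ ∞ u) {N : ℝ}
    (hN : ∀ x, N ≤ |x| → u x = 0) (m : ℤ) :
    IsTestFunction β (fun p => u p.1 * quasiMode β m p.2) where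
  smooth := (hu.comp contDiff_fst).mul ((contDiff_quasiMode β m).comp contDiff_snd)
  vanish := ⟨N, fun x y hx _ => by simp [hN x hx.le]⟩
  bc x := by
    simp only [quasiMode_two_pi, quasiMode_zero]
    ring
  bc_dy x := by
    have hd : ∀ x, HasDerivAt u (deriv u x) x := fun x =>
      ((hu.differentiable (by simp)) x).hasDerivAt
    rw [(hasFDerivAt_mode (β := β) (p := (x, 2 * Real.pi)) m (hd x)).2.1,
      (hasFDerivAt_mode (β := β) (p := (x, 0)) m (hd x)).2.1]
    simp only [quasiMode_two_pi, quasiMode_zero]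
    ring

theorem dX_sum {ι : Type*} (s : Finset ι) {φ : ι → ℝ × ℝ → ℂ} {p : ℝ × ℝ}
    (h : ∀ i ∈ s, DifferentiableAt ℝ (φ i) p) :
    dX (fun p => ∑ i ∈ s, φ i p) p = ∑ i ∈ s, dX (φ i) p ∧
      dY (fun p => ∑ i ∈ s, φ i p) p = ∑ i ∈ s, dY (φ i) p := by
  unfold dX dY
  rw [fderiv_fun_sum h]
  simp

theorem IsTestFunction.differentiableAt {φ : ℝ × ℝ → ℂ} (h : IsTestFunction β φ) (p : ℝ × ℝ) :
    DifferentiableAt ℝ φ p := (h.smooth.differentiable (by simp)) p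

theorem isTestFunction_sum {ι : Type*} (s : Finset ι) {φ : ι → ℝ × ℝ → ℂ}
    (h : ∀ i ∈ s, IsTestFunction β (φ i)) : IsTestFunction β (fun p => ∑ i ∈ s, φ i p) where
  smooth := ContDiff.sum fun i hi => (h i hi).smooth
  vanish := by
    classical
    choose! L hL using fun i (hi : i ∈ s) => (h i hi).vanish
    refine ⟨∑ i ∈ s, |L i|, fun x y hx hy => Finset.sum_eq_zero fun i hi => hL i hi x y ?_ hy⟩
    have := Finset.single_le_sum (f := fun i => |L i|) (fun i _ => abs_nonneg _) hi
    linarith [le_abs_self (L i)]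
  bc x := by
    rw [Finset.mul_sum]
    exact Finset.sum_congr rfl fun i hi => (h i hi).bc x
  bc_dy x := by
    rw [(dX_sum s fun i hi => (h i hi).differentiableAt _).2,
      (dX_sum s fun i hi => (h i hi).differentiableAt _).2, Finset.mul_sum]
    exact Finset.sum_congr rfl fun i hi => (h i hi).bc_dy x

theorem restrict_strip : (volume.restrict strip : Measure (ℝ × ℝ)) =
    (volume : Measure ℝ).prod (volume.restrict (Ioo (0 : ℝ) (2 * Real.pi))) := by
  rw [strip, Measure.volume_eq_prod, ← Measure.prod_restrict, Measure.restrict_univ]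

theorem integrable_rho : Integrable rho := by
  unfold rho
  simpa [one_div] using integrable_inv_one_add_sq

theorem integrable_strip_of_rho : Integrable (fun p : ℝ × ℝ => rho p.1) (volume.restrict strip) := by
  rw [restrict_strip]
  have := integrable_rho.mul_prod (ν := volume.restrict (Ioo (0 : ℝ) (2 * Real.pi)))
    (g := fun _ => (1 : ℝ)) (integrable_const _)
  simpa using this

theorem memLp_rho : MemLp (fun p : ℝ × ℝ => rho p.1) 2 (volume.restrict strip) := by
  have hc : Continuous fun p : ℝ × ℝ => rho p.1 := continuous_rho.comp continuous_fst
  rw [memLp_two_iff_integrable_sq hc.aestronglyMeasurable]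
  refine integrable_strip_of_rho.mono (hc.pow 2).aestronglyMeasurable (ae_of_all _ fun p => ?_)
  have h0 := rho_pos p.1
  rw [Real.norm_of_nonneg (by positivity), Real.norm_of_nonneg h0.le, sq]
  exact mul_le_of_le_one_left h0.le (rho_le_one _)

theorem memLp_of_norm_le_rho {g : ℝ × ℝ → ℂ} (hg : Continuous g) {c : ℝ}
    (h : ∀ p, ‖g p‖ ≤ c * rho p.1) : MemLp g 2 (volume.restrict strip) := by
  refine (memLp_rho.const_mul c).mono hg.aestronglyMeasurable (ae_of_all _ fun p => ?_)
  exact (h p).trans (le_abs_self _)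

theorem eLpNorm_le_of_norm_le_rho {g : ℝ × ℝ → ℂ} {c : ℝ}
    (h : ∀ p, ‖g p‖ ≤ c * rho p.1) : eLpNorm g 2 (volume.restrict strip) ≤
      ENNReal.ofReal c * eLpNorm (fun p : ℝ × ℝ => rho p.1) 2 (volume.restrict strip) := by
  refine eLpNorm_le_mul_eLpNorm_of_ae_le_mul (ae_of_all _ fun p => ?_) 2
  rw [Real.norm_of_nonneg (rho_pos _).le]
  exact h p

/-- Functions that are limits of test functions in a weighted uniform norm belong to `H_1^β`. -/
theorem memH1_of_approx {u ux uy : ℝ × ℝ → ℂ} (hu : Continuous u) (hux : Continuous ux)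
    (huy : Continuous uy) {c : ℝ} (hb : ∀ p, ‖u p‖ ≤ c * rho p.1)
    (hbx : ∀ p, ‖ux p‖ ≤ c * rho p.1) (hby : ∀ p, ‖uy p‖ ≤ c * rho p.1)
    (happ : ∀ η : ℝ, 0 < η → ∃ φ, IsTestFunction β φ ∧ ∀ p, ‖φ p - u p‖ ≤ η * rho p.1 ∧
      ‖dX φ p - ux p‖ ≤ η * rho p.1 ∧ ‖dY φ p - uy p‖ ≤ η * rho p.1) : MemH1 β u ux uy where
  memLp := memLp_of_norm_le_rho hu hb
  memLp_dx := memLp_of_norm_le_rho hux hbx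
  memLp_dy := memLp_of_norm_le_rho huy hby
  approx := by
    have hpos : ∀ k : ℕ, 0 < 1 / ((k : ℝ) + 1) := fun k => by positivity
    choose φ hφ using fun k : ℕ => happ (1 / ((k : ℝ) + 1)) (hpos k)
    have ht : Tendsto (fun k : ℕ => ENNReal.ofReal (1 / ((k : ℝ) + 1)) *
        eLpNorm (fun p : ℝ × ℝ => rho p.1) 2 (volume.restrict strip)) atTop (𝓝 0) := by
      have h1 := ENNReal.tendsto_ofReal (tendsto_one_div_add_atTop_nhds_zero_nat (𝕜 := ℝ))
      rw [ENNReal.ofReal_zero] at h1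
      have := ENNReal.Tendsto.mul_const h1 (Or.inr memLp_rho.eLpNorm_ne_top)
      rwa [zero_mul] at this
    refine ⟨φ, fun k => (hφ k).1, ?_, ?_, ?_⟩
    · exact tendsto_of_tendsto_of_tendsto_of_le_of_le tendsto_const_nhds ht (fun _ => zero_le)
        fun k => eLpNorm_le_of_norm_le_rho fun p => ((hφ k).2 p).1
    · exact tendsto_of_tendsto_of_tendsto_of_le_of_le tendsto_const_nhds ht (fun _ => zero_le)
        fun k => eLpNorm_le_of_norm_le_rho fun p => ((hφ k).2 p).2.1
    · exact tendsto_of_tendsto_of_tendsto_of_le_of_le tendsto_const_nhds ht (fun _ => zero_le)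
        fun k => eLpNorm_le_of_norm_le_rho fun p => ((hφ k).2 p).2.2

section Series

variable {c : ℤ → ℝ} {g : ℤ → ℝ × ℝ → ℂ}

theorem norm_le_of_rho_sq {c t x : ℝ} (hc : 0 ≤ c) (h : t ≤ c * rho x ^ 2) : t ≤ c * rho x := by
  refine h.trans (mul_le_mul_of_nonneg_left ?_ hc)
  rw [sq]
  exact mul_le_of_le_one_left (rho_pos x).le (rho_le_one x)

theorem continuous_tsum_rho (hc : Summable c) (hc0 : ∀ m, 0 ≤ c m) (hg : ∀ m, Continuous (g m))
    (hb : ∀ m p, ‖g m p‖ ≤ c m * rho p.1) : Continuous fun p => ∑' m, g m p :=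
  continuous_tsum hg hc fun m p =>
    (hb m p).trans (mul_le_of_le_one_right (hc0 m) (rho_le_one _))

theorem summable_rho (hc : Summable c) (hb : ∀ m p, ‖g m p‖ ≤ c m * rho p.1) (p : ℝ × ℝ) :
    Summable fun m => g m p :=
  Summable.of_norm_bounded (hc.mul_right (rho p.1)) fun m => hb m p

theorem norm_tsum_le_rho (hc : Summable c) (hb : ∀ m p, ‖g m p‖ ≤ c m * rho p.1) (p : ℝ × ℝ) :
    ‖∑' m, g m p‖ ≤ (∑' m, c m) * rho p.1 := by
  rw [← tsum_mul_right]
  exact tsum_of_norm_bounded (hc.mul_right (rho p.1)).hasSum fun m => hb m p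

/-- The error splits into the replacements of the finitely many kept terms and the tail of the
majorant. -/
theorem norm_sum_sub_tsum_le (hc : Summable c) (hb : ∀ m p, ‖g m p‖ ≤ c m * rho p.1)
    (s : Finset ℤ) {w : ℤ → ℂ} {η η' : ℝ} (hs : ∑' m, c m - ∑ m ∈ s, c m ≤ η)
    (p : ℝ × ℝ) (hw : ∀ m ∈ s, ‖w m - g m p‖ ≤ η' * rho p.1) :
    ‖∑ m ∈ s, w m - ∑' m, g m p‖ ≤ (s.card * η' + η) * rho p.1 := by
  have hsum := summable_rho hc hb p
  have h1 := hsum.sum_add_tsum_compl (s := s)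
  have h2 := hc.sum_add_tsum_compl (s := s)
  have h3 : ‖∑' m : ↑(↑s : Set ℤ)ᶜ, g m p‖ ≤ (∑' m : ↑(↑s : Set ℤ)ᶜ, c m) * rho p.1 := by
    rw [← tsum_mul_right]
    exact tsum_of_norm_bounded ((hc.subtype _).mul_right (rho p.1)).hasSum fun m => hb m p
  have h4 : (∑' m : ↑(↑s : Set ℤ)ᶜ, c m) ≤ η := by linarith
  have e : ∑ m ∈ s, w m - ∑' m, g m p = ∑ m ∈ s, (w m - g m p) - ∑' m : ↑(↑s : Set ℤ)ᶜ, g m p := by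
    rw [← h1, Finset.sum_sub_distrib]
    ring
  rw [e, add_mul]
  refine (norm_sub_le _ _).trans (add_le_add ?_ (h3.trans
    (mul_le_mul_of_nonneg_right h4 (rho_pos _).le)))
  refine (norm_sum_le_of_le s hw).trans_eq ?_
  rw [Finset.sum_const, nsmul_eq_mul, mul_assoc]

end Series

/-- Finitely many modes carry all but `η/2` of the three series, and each of these modes can be
replaced by a compactly supported smooth one. The finite sum is a test function. -/
theorem memH1_tsum {r r₁ : ℤ → ℝ → ℂ} {c : ℤ → ℝ} (hr : ∀ m x, HasDerivAt (r m) (r₁ m x) x)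
    (hr₁ : ∀ m, Continuous (r₁ m)) (hc : Summable c)
    (hb : ∀ m x, ‖r m x‖ ≤ c m * rho x ^ 2) (hb₁ : ∀ m x, ‖r₁ m x‖ ≤ c m * rho x ^ 2)
    (hb₂ : ∀ (m : ℤ) x, ‖(β + m : ℂ)‖ * ‖r m x‖ ≤ c m * rho x ^ 2) :
    MemH1 β (fun p => ∑' m : ℤ, r m p.1 * quasiMode β m p.2)
      (fun p => ∑' m : ℤ, r₁ m p.1 * quasiMode β m p.2)
      (fun p => ∑' m : ℤ, Complex.I * (β + m) * r m p.1 * quasiMode β m p.2) := by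
  have hc0 : ∀ m, 0 ≤ c m := fun m => by
    have := (norm_nonneg _).trans (hb m 0)
    simpa [rho] using this
  have hrc : ∀ m, Continuous (r m) := fun m =>
    continuous_iff_continuousAt.mpr fun x => (hr m x).continuousAt
  have hqc := fun m : ℤ => continuous_quasiMode β m
  have c1 : ∀ m, Continuous fun p : ℝ × ℝ => r m p.1 * quasiMode β m p.2 := fun m => by
    have := hrc m
    have := hqc m
    fun_prop
  have c2 : ∀ m, Continuous fun p : ℝ × ℝ => r₁ m p.1 * quasiMode β m p.2 := fun m => by
    have := hr₁ m
    have := hqc m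
    fun_prop
  have c3 : ∀ m : ℤ, Continuous fun p : ℝ × ℝ =>
      Complex.I * (β + m) * r m p.1 * quasiMode β m p.2 := fun m => by
    have := hrc m
    have := hqc m
    fun_prop
  have b1 : ∀ m (p : ℝ × ℝ), ‖r m p.1 * quasiMode β m p.2‖ ≤ c m * rho p.1 := fun m p => by
    rw [norm_mul, norm_quasiMode, mul_one]
    exact norm_le_of_rho_sq (hc0 m) (hb m p.1)
  have b2 : ∀ m (p : ℝ × ℝ), ‖r₁ m p.1 * quasiMode β m p.2‖ ≤ c m * rho p.1 := fun m p => by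
    rw [norm_mul, norm_quasiMode, mul_one]
    exact norm_le_of_rho_sq (hc0 m) (hb₁ m p.1)
  have b3 : ∀ (m : ℤ) (p : ℝ × ℝ),
      ‖Complex.I * (β + m) * r m p.1 * quasiMode β m p.2‖ ≤ c m * rho p.1 := fun m p => by
    rw [norm_mul, norm_quasiMode, mul_one, norm_mul, norm_mul, Complex.norm_I, one_mul]
    exact norm_le_of_rho_sq (hc0 m) (hb₂ m p.1)
  refine memH1_of_approx (continuous_tsum_rho hc hc0 c1 b1) (continuous_tsum_rho hc hc0 c2 b2)
    (continuous_tsum_rho hc hc0 c3 b3) (norm_tsum_le_rho hc b1) (norm_tsum_le_rho hc b2)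
    (norm_tsum_le_rho hc b3) fun η hη => ?_
  obtain ⟨s, hs⟩ : ∃ s : Finset ℤ, ∑' m, c m - ∑ m ∈ s, c m ≤ η / 2 := by
    have h := hc.hasSum.eventually_const_lt (show ∑' m, c m - η / 2 < ∑' m, c m by linarith)
    obtain ⟨s, hs⟩ := h.exists
    exact ⟨s, by linarith⟩
  set η' := η / 2 / (s.card + 1) with hη'
  have hη0 : 0 < η' := by positivity
  have hcard : s.card * η' + η / 2 ≤ η := by
    have : η' * (s.card + 1) = η / 2 := by rw [hη']; field_simp
    nlinarith
  -- Dividing by `1 + ‖β + m‖` keeps the error below `η'` even after `∂_y` multiplies it by `β + m`.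
  choose u hu hN hu1 hu2 using fun m : ℤ => exists_contDiff_approx_rho (hr m) (hr₁ m) (hb m) (hb₁ m)
    (show 0 < η' / (1 + ‖(β + m : ℂ)‖) by positivity)
  choose N hN using hN
  have hle : ∀ (m : ℤ), η' / (1 + ‖(β + m : ℂ)‖) ≤ η' ∧
      ‖(β + m : ℂ)‖ * (η' / (1 + ‖(β + m : ℂ)‖)) ≤ η' := fun m => by
    have hn := norm_nonneg (β + m : ℂ)
    constructor
    · exact div_le_self hη0.le (by linarith)
    · rw [mul_div_assoc', div_le_iff₀ (by positivity)]
      nlinarith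
  have ht : ∀ m : ℤ, IsTestFunction β (fun p => u m p.1 * quasiMode β m p.2) := fun m =>
    isTestFunction_mode (hu m) (hN m) m
  have hud : ∀ m x, HasDerivAt (u m) (deriv (u m) x) x := fun m x =>
    (((hu m).differentiable (by simp)) x).hasDerivAt
  refine ⟨_, isTestFunction_sum s fun m _ => ht m, fun p => ⟨?_, ?_, ?_⟩⟩
  · refine (norm_sum_sub_tsum_le hc b1 s hs p (η' := η') fun m _ => ?_).trans
      (mul_le_mul_of_nonneg_right hcard (rho_pos _).le)
    rw [← sub_mul, norm_mul, norm_quasiMode, mul_one]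
    exact (hu1 m p.1).trans (mul_le_mul_of_nonneg_right (hle m).1 (rho_pos _).le)
  · rw [(dX_sum s fun m _ => (ht m).differentiableAt p).1]
    refine (norm_sum_sub_tsum_le hc b2 s hs p (η' := η') fun m _ => ?_).trans
      (mul_le_mul_of_nonneg_right hcard (rho_pos _).le)
    rw [(hasFDerivAt_mode m (hud m p.1)).1, ← sub_mul, norm_mul, norm_quasiMode, mul_one]
    exact (hu2 m p.1).trans (mul_le_mul_of_nonneg_right (hle m).1 (rho_pos _).le)
  · rw [(dX_sum s fun m _ => (ht m).differentiableAt p).2]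
    refine (norm_sum_sub_tsum_le hc b3 s hs p (η' := η') fun m _ => ?_).trans
      (mul_le_mul_of_nonneg_right hcard (rho_pos _).le)
    rw [(hasFDerivAt_mode m (hud m p.1)).2.1, ← sub_mul, ← mul_sub, norm_mul, norm_quasiMode,
      mul_one, norm_mul, norm_mul, Complex.norm_I, one_mul]
    refine (mul_le_mul_of_nonneg_left (hu1 m p.1) (norm_nonneg _)).trans ?_
    rw [← mul_assoc]
    exact mul_le_mul_of_nonneg_right (hle m).2 (rho_pos _).le

end

section

/-! ### Real spectral parameters -/

/-- The decay rate of the `n`-th mode, for real `μ` and `n ≠ 0`. -/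
def decayRate (β μ : ℝ) (n : ℤ) : ℝ := Real.sqrt ((β + n) ^ 2 - (1 - β) ^ 2 + μ ^ 2)

/-- The exponents of the Green functions of all the modes. -/
def modeExponent (β μ : ℝ) (n : ℤ) : ℂ :=
  if n = 0 then -Complex.I * waveNumber β μ else decayRate β μ n

variable {β μ : ℝ}

theorem norm_ofReal_le_muMax (hμ0 : 0 ≤ μ) (hμ : μ ≤ muMax β) : ‖(μ : ℂ)‖ ≤ muMax β := by
  rwa [Complex.norm_real, Real.norm_of_nonneg hμ0]

theorem waveNumber_sq (h0 : 0 < β) (h1 : β < 1 / 2) (hμ0 : 0 ≤ μ) (hμ : μ ≤ muMax β) :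
    waveNumber β μ ^ 2 = 1 - 2 * β - μ ^ 2 := by
  have := (sq_le_of_le_muMax h0 h1 hμ0 hμ).2.1
  unfold waveNumber omegaSq
  rw [Real.sq_sqrt (by nlinarith)]
  ring

theorem waveNumber_pos (h0 : 0 < β) (h1 : β < 1 / 2) (hμ0 : 0 ≤ μ) (hμ : μ ≤ muMax β) :
    0 < waveNumber β μ := by
  have := (sq_le_of_le_muMax h0 h1 hμ0 hμ).2.1
  unfold waveNumber omegaSq
  exact Real.sqrt_pos.mpr (by nlinarith)

theorem decayRate_neg_one (hμ0 : 0 ≤ μ) : decayRate β μ (-1) = μ := by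
  unfold decayRate
  rw [show (β + ((-1 : ℤ) : ℝ)) ^ 2 - (1 - β) ^ 2 + μ ^ 2 = μ ^ 2 by push_cast; ring,
    Real.sqrt_sq hμ0]

theorem modeGap_nonneg (h0 : 0 < β) (h1 : β < 1 / 2) {n : ℤ} (hn : n ≠ 0) :
    0 ≤ (β + n) ^ 2 - (1 - β) ^ 2 := by
  by_cases hn1 : n = -1
  · subst hn1
    push_cast
    nlinarith
  · exact le_trans (by positivity) (modeGap_ge h0 h1 hn hn1)

theorem decayRate_sq (h0 : 0 < β) (h1 : β < 1 / 2) {n : ℤ} (hn : n ≠ 0) :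
    decayRate β μ n ^ 2 = (β + n) ^ 2 - (1 - β) ^ 2 + μ ^ 2 := by
  have := modeGap_nonneg h0 h1 hn
  unfold decayRate
  rw [Real.sq_sqrt (by positivity)]

theorem cpow_half_ofReal {t : ℝ} (ht : 0 ≤ t) : (t : ℂ) ^ (1 / 2 : ℂ) = (Real.sqrt t : ℂ) := by
  rw [Real.sqrt_eq_rpow, Complex.ofReal_cpow ht]
  norm_num

theorem modeNumber_zero_eq (h0 : 0 < β) (h1 : β < 1 / 2) (hμ0 : 0 ≤ μ) (hμ : μ ≤ muMax β) :
    modeNumber β μ 0 = waveNumber β μ := by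
  have := (sq_le_of_le_muMax h0 h1 hμ0 hμ).2.1
  rw [modeNumber, if_pos rfl, waveNumber, ← cpow_half_ofReal (by unfold omegaSq; nlinarith)]
  congr 1
  unfold omegaSq
  push_cast
  ring

theorem modeNumber_eq_decayRate (h0 : 0 < β) (h1 : β < 1 / 2) {n : ℤ} (hn : n ≠ 0) :
    modeNumber β μ n = decayRate β μ n := by
  have := modeGap_nonneg h0 h1 hn
  rw [modeNumber, if_neg hn, decayRate, ← cpow_half_ofReal (by positivity)]
  congr 1
  push_cast
  ring

/-- For a fixed `μ > 0` the threshold channel also decays, at rate `μ`; the divisor `√2` is the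
value of `√(1 + n²)` at `n = -1`. That `b` degenerates as `μ → 0` is harmless, since it serves only
to build solutions at fixed `μ`. -/
theorem exists_decayRate_ge (h0 : 0 < β) (h1 : β < 1 / 2) (hμ0 : 0 < μ) :
    ∃ b, 0 < b ∧ b ≤ 1 ∧ ∀ n : ℤ, n ≠ 0 → b * Real.sqrt (1 + (n : ℝ) ^ 2) ≤ decayRate β μ n := by
  refine ⟨min (min (Real.sqrt (2 * β / 5)) (μ / Real.sqrt 2)) 1, by positivity,
    min_le_right _ _, fun n hn => ?_⟩
  by_cases hn1 : n = -1
  · subst hn1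
    rw [decayRate_neg_one hμ0.le]
    have : (1 : ℝ) + ((-1 : ℤ) : ℝ) ^ 2 = 2 := by norm_num
    rw [this]
    calc _ ≤ μ / Real.sqrt 2 * Real.sqrt 2 := mul_le_mul_of_nonneg_right
          ((min_le_left _ _).trans (min_le_right _ _)) (Real.sqrt_nonneg _)
      _ = μ := by field_simp
  · have hg := modeGap_ge h0 h1 hn hn1
    calc _ ≤ Real.sqrt (2 * β / 5) * Real.sqrt (1 + (n : ℝ) ^ 2) := mul_le_mul_of_nonneg_right
          ((min_le_left _ _).trans (min_le_left _ _)) (Real.sqrt_nonneg _)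
      _ = Real.sqrt (2 * β / 5 * (1 + (n : ℝ) ^ 2)) := (Real.sqrt_mul (by positivity) _).symm
      _ ≤ _ := Real.sqrt_le_sqrt (by linarith [sq_nonneg μ])

theorem modeExponent_ne_zero (h0 : 0 < β) (h1 : β < 1 / 2) (hμ0 : 0 < μ) (hμ : μ ≤ muMax β)
    (n : ℤ) : modeExponent β μ n ≠ 0 := by
  unfold modeExponent
  split_ifs with hn
  · have := (waveNumber_pos h0 h1 hμ0.le hμ).ne'
    simpa using this
  · obtain ⟨b, hb, -, h⟩ := exists_decayRate_ge h0 h1 hμ0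
    have := (mul_pos hb (Real.sqrt_pos.mpr (by positivity : 0 < 1 + (n : ℝ) ^ 2))).trans_le (h n hn)
    exact_mod_cast this.ne'

theorem modeExponent_sq (h0 : 0 < β) (h1 : β < 1 / 2) (hμ0 : 0 ≤ μ) (hμ : μ ≤ muMax β) (n : ℤ) :
    modeExponent β μ n ^ 2 = (β + n) ^ 2 - (omegaSq β μ : ℂ) := by
  unfold modeExponent omegaSq
  split_ifs with hn
  · have := congrArg (fun t : ℝ => (t : ℂ)) (waveNumber_sq h0 h1 hμ0 hμ)
    push_cast at this
    rw [mul_pow, neg_sq, Complex.I_sq, this, hn]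
    push_cast
    ring
  · have := congrArg (fun t : ℝ => (t : ℂ)) (decayRate_sq (μ := μ) h0 h1 hn)
    push_cast at this
    rw [this]
    push_cast
    ring

/-- The kernels differ from the true Green functions only by the constant `1/(2μ)` in channel `-1`.
This constant is the whole singularity at the threshold. -/
theorem kernelH_eq_greenE (h0 : 0 < β) (h1 : β < 1 / 2) (hμ0 : 0 < μ) (hμ : μ ≤ muMax β) (n : ℤ)
    (x : ℝ) : greenE (modeExponent β μ n) |x| =
      kernelH β μ n x + if n = -1 then 1 / (2 * (μ : ℂ)) else 0 := by
  by_cases hn : n = 0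
  · subst hn
    rw [kernelH_zero, modeNumber_zero_eq h0 h1 hμ0.le hμ]
    simp [modeExponent]
  by_cases hn1 : n = -1
  · subst hn1
    have hμc : (μ : ℂ) ≠ 0 := by exact_mod_cast hμ0.ne'
    rw [modeExponent, if_neg (by norm_num), decayRate_neg_one hμ0.le, kernelH,
      if_neg (by norm_num), if_pos rfl, if_neg hμc, if_pos rfl, greenE]
    field_simp
    ring
  · rw [kernelH_of_ne _ _ hn hn1, modeExponent, if_neg hn, if_neg hn1, add_zero,
      modeNumber_eq_decayRate h0 h1 hn]


/-! ### The far field -/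

/-- The profile of the far field in the propagating mode, with incident amplitude `a`. -/
def farProfile (k : ℝ) (a R T : ℂ) (x : ℝ) : ℂ :=
  (Real.smoothTransition x : ℂ) * (T * Complex.exp (Complex.I * k * x)) +
    (Real.smoothTransition (-x) : ℂ) *
      (a * Complex.exp (Complex.I * k * x) + R * Complex.exp (-Complex.I * k * x))

theorem contDiff_farProfile (k : ℝ) (a R T : ℂ) : ContDiff ℝ ∞ (farProfile k a R T) := by
  have h1 : ContDiff ℝ ∞ fun y : ℝ => (y : ℂ) := Complex.ofRealCLM.contDiff
  have h2 : ContDiff ℝ ∞ Real.smoothTransition := Real.smoothTransition.contDiff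
  have h3 : ContDiff ℝ ∞ fun y : ℝ => (Real.smoothTransition y : ℂ) := h1.comp h2
  have h4 : ContDiff ℝ ∞ fun y : ℝ => (Real.smoothTransition (-y) : ℂ) := h3.comp contDiff_neg
  unfold farProfile
  exact (h3.mul (contDiff_const.mul (contDiff_const.mul h1).cexp)).add
    (h4.mul ((contDiff_const.mul (contDiff_const.mul h1).cexp).add
      (contDiff_const.mul (contDiff_const.mul h1).cexp)))

theorem farProfile_of_ge (k : ℝ) (a R T : ℂ) {x : ℝ} (hx : 1 ≤ x) :
    farProfile k a R T x = T * Complex.exp (Complex.I * k * x) := by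
  rw [farProfile, Real.smoothTransition.one_of_one_le hx,
    Real.smoothTransition.zero_of_nonpos (by linarith)]
  simp

theorem farProfile_of_le (k : ℝ) (a R T : ℂ) {x : ℝ} (hx : x ≤ -1) :
    farProfile k a R T x =
      a * Complex.exp (Complex.I * k * x) + R * Complex.exp (-Complex.I * k * x) := by
  rw [farProfile, Real.smoothTransition.one_of_one_le (by linarith : 1 ≤ -x),
    Real.smoothTransition.zero_of_nonpos (by linarith)]
  simp

theorem farField_eq (β μ : ℝ) (R T : ℂ) :
    farField β μ R T =
      fun p => farProfile (waveNumber β μ) 1 R T p.1 * quasiMode β 0 p.2 := by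
  funext p
  unfold farField farProfile planeWave quasiMode
  rw [Complex.exp_add, Complex.exp_add]
  push_cast
  rw [show Complex.I * (β + 0) * (p.2 : ℂ) = Complex.I * β * p.2 by ring,
    show Complex.I * (-(waveNumber β μ : ℂ)) * (p.1 : ℂ) = -Complex.I * (waveNumber β μ) * p.1 by ring]
  ring

end

section

/-! ### Construction of scattering solutions -/

section Convolution

variable {𝕜 : Type*} [NormedField 𝕜] [CompleteSpace 𝕜]

/-- The shear `(m, n) ↦ (n, m - n)`. -/
def shearEquiv : ℤ × ℤ ≃ ℤ × ℤ where
  toFun p := (p.2, p.1 - p.2)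
  invFun p := (p.1 + p.2, p.1)
  left_inv p := by simp
  right_inv p := by simp

theorem hasSum_int_convolution {u v : ℤ → 𝕜} {U V : 𝕜} (hu : Summable fun n => ‖u n‖)
    (hv : Summable fun n => ‖v n‖) (hU : HasSum u U) (hV : HasSum v V) :
    HasSum (fun m => ∑' n, u n * v (m - n)) (U * V) := by
  have h1 : HasSum (fun p : ℤ × ℤ => u p.1 * v p.2) (U * V) :=
    hU.mul hV (summable_mul_of_summable_norm hu hv)
  have h2 : HasSum (fun p : ℤ × ℤ => u p.2 * v (p.1 - p.2)) (U * V) := shearEquiv.hasSum_iff.mpr h1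
  exact h2.prod_fiberwise fun m => (h2.summable.prod_factor m).hasSum

theorem summable_int_convolution {u v : ℤ → ℝ} (hu0 : ∀ n, 0 ≤ u n) (hv0 : ∀ n, 0 ≤ v n)
    (hu : Summable u) (hv : Summable v) (m : ℤ) : Summable fun n => u n * v (m - n) := by
  have h1 : Summable fun p : ℤ × ℤ => u p.1 * v p.2 := hu.mul_of_nonneg hv hu0 hv0
  have h2 : Summable fun p : ℤ × ℤ => u p.2 * v (p.1 - p.2) := shearEquiv.summable_iff.mpr h1
  exact h2.prod_factor m

end Convolution

variable {f : ℝ × ℝ → ℝ} {X β ε μ : ℝ}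

/-- The amplitude of the `n`-th mode generated by the source `A`. -/
def modeAmp (β ε μ : ℝ) (A : SeqSpace X) (n : ℤ) (x : ℝ) : ℂ :=
  (if n = 0 then Complex.exp (Complex.I * waveNumber β μ * x) else 0) +
    2 * gammaC β μ * ε * greenConv (modeExponent β μ n) X (zeroExt (A n)) x

/-- The derivative of `modeAmp`. -/
def modeAmpDeriv (β ε μ : ℝ) (A : SeqSpace X) (n : ℤ) (x : ℝ) : ℂ :=
  (if n = 0 then Complex.I * waveNumber β μ * Complex.exp (Complex.I * waveNumber β μ * x) else 0) +
    2 * gammaC β μ * ε * greenConvDeriv (modeExponent β μ n) X (zeroExt (A n)) x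

theorem hasDerivAt_modeAmp (h0 : 0 < β) (h1 : β < 1 / 2) (hμ0 : 0 < μ) (hμ : μ ≤ muMax β)
    (A : SeqSpace X) (n : ℤ) (hA : Continuous (zeroExt (A n))) (x : ℝ) :
    HasDerivAt (modeAmp β ε μ A n) (modeAmpDeriv β ε μ A n x) x := by
  have h2 := (hasDerivAt_greenConv (X := X) (modeExponent_ne_zero h0 h1 hμ0 hμ n) hA x).const_mul
    (2 * gammaC β μ * ε)
  unfold modeAmp modeAmpDeriv
  refine HasDerivAt.add ?_ h2
  split_ifs
  · exact hasDerivAt_exp_mul _ x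
  · exact hasDerivAt_const x 0

theorem hasDerivAt_modeAmpDeriv (h0 : 0 < β) (h1 : β < 1 / 2) (hμ0 : 0 ≤ μ) (hμ : μ ≤ muMax β)
    (A : SeqSpace X) (n : ℤ) (hA : Continuous (zeroExt (A n))) (x : ℝ) :
    HasDerivAt (modeAmpDeriv β ε μ A n)
      (((β + n) ^ 2 - (omegaSq β μ : ℂ)) * modeAmp β ε μ A n x -
        2 * gammaC β μ * ε * zeroExt (A n) x) x := by
  have h2 := (hasDerivAt_greenConvDeriv (k := modeExponent β μ n) (X := X) hA x).const_mul
    (2 * gammaC β μ * ε)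
  have hsq := modeExponent_sq h0 h1 hμ0 hμ n
  unfold modeAmpDeriv
  have h3 : HasDerivAt (fun x : ℝ => if n = 0 then
      Complex.I * waveNumber β μ * Complex.exp (Complex.I * waveNumber β μ * x) else 0)
      (modeExponent β μ n ^ 2 *
        (if n = 0 then Complex.exp (Complex.I * waveNumber β μ * x) else 0)) x := by
    split_ifs with hn
    · refine ((hasDerivAt_exp_mul (Complex.I * waveNumber β μ) x).const_mul
        (Complex.I * waveNumber β μ)).congr_deriv ?_
      rw [modeExponent, if_pos hn]
      ring
    · rw [mul_zero]
      exact hasDerivAt_const x 0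
  refine (h3.add h2).congr_deriv ?_
  rw [← hsq, modeAmp]
  ring

/-- The reflection coefficient generated by the source `A`. -/
def reflCoef (β ε μ : ℝ) (A : SeqSpace X) : ℂ :=
  2 * gammaC β μ * ε * (1 / (2 * modeExponent β μ 0) *
    expPrim (-modeExponent β μ 0) X (zeroExt (A 0)) X)

/-- The transmission coefficient generated by the source `A`. -/
def transCoef (β ε μ : ℝ) (A : SeqSpace X) : ℂ :=
  1 + 2 * gammaC β μ * ε * (1 / (2 * modeExponent β μ 0) *
    expPrim (modeExponent β μ 0) X (zeroExt (A 0)) X)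

theorem modeAmp_zero_of_ge (hX : 0 < X) (A : SeqSpace X) (hs : ∀ x, X ≤ |x| → zeroExt (A 0) x = 0)
    {x : ℝ} (hx : X ≤ x) : modeAmp β ε μ A 0 x =
      transCoef β ε μ A * Complex.exp (Complex.I * waveNumber β μ * x) := by
  rw [modeAmp, if_pos rfl, greenConv_of_ge hX hs hx, transCoef]
  have : Complex.exp (-modeExponent β μ 0 * x) = Complex.exp (Complex.I * waveNumber β μ * x) := by
    simp [modeExponent]
  rw [this]
  ring

theorem modeAmp_zero_of_le (hX : 0 < X) (A : SeqSpace X) (hs : ∀ x, X ≤ |x| → zeroExt (A 0) x = 0)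
    {x : ℝ} (hx : x ≤ -X) : modeAmp β ε μ A 0 x =
      1 * Complex.exp (Complex.I * waveNumber β μ * x) +
        reflCoef β ε μ A * Complex.exp (-Complex.I * waveNumber β μ * x) := by
  rw [modeAmp, if_pos rfl, greenConv_of_le hX hs hx, reflCoef]
  have : Complex.exp (modeExponent β μ 0 * x) = Complex.exp (-Complex.I * waveNumber β μ * x) := by
    simp [modeExponent]
  rw [this]
  ring

/-- The deviation of the mode amplitudes from the far field. -/
def modeRem (β ε μ : ℝ) (A : SeqSpace X) (n : ℤ) (x : ℝ) : ℂ :=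
  modeAmp β ε μ A n x - if n = 0 then
    farProfile (waveNumber β μ) 1 (reflCoef β ε μ A) (transCoef β ε μ A) x else 0

/-- The derivative of `modeRem`. -/
def modeRemDeriv (β ε μ : ℝ) (A : SeqSpace X) (n : ℤ) (x : ℝ) : ℂ :=
  modeAmpDeriv β ε μ A n x - if n = 0 then
    deriv (farProfile (waveNumber β μ) 1 (reflCoef β ε μ A) (transCoef β ε μ A)) x else 0

theorem hasDerivAt_farProfile (k : ℝ) (a R T : ℂ) (x : ℝ) :
    HasDerivAt (farProfile k a R T) (deriv (farProfile k a R T) x) x :=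
  (((contDiff_farProfile k a R T).differentiable (by simp)) x).hasDerivAt

theorem hasDerivAt_modeRem (h0 : 0 < β) (h1 : β < 1 / 2) (hμ0 : 0 < μ) (hμ : μ ≤ muMax β)
    (A : SeqSpace X) (n : ℤ) (hA : Continuous (zeroExt (A n))) (x : ℝ) :
    HasDerivAt (modeRem β ε μ A n) (modeRemDeriv β ε μ A n x) x := by
  unfold modeRem modeRemDeriv
  refine (hasDerivAt_modeAmp h0 h1 hμ0 hμ A n hA x).sub ?_
  split_ifs
  · exact hasDerivAt_farProfile _ _ _ _ x
  · exact hasDerivAt_const x 0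

theorem continuous_modeRemDeriv (h0 : 0 < β) (h1 : β < 1 / 2) (hμ0 : 0 < μ) (hμ : μ ≤ muMax β)
    (A : SeqSpace X) (n : ℤ) (hA : Continuous (zeroExt (A n))) :
    Continuous (modeRemDeriv β ε μ A n) := by
  have c1 : Continuous (modeAmpDeriv β ε μ A n) := continuous_iff_continuousAt.mpr fun x =>
    (hasDerivAt_modeAmpDeriv h0 h1 hμ0.le hμ A n hA x).continuousAt
  unfold modeRemDeriv
  refine c1.sub ?_
  split_ifs
  · exact (contDiff_farProfile _ _ _ _).continuous_deriv (by simp)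
  · exact continuous_const

theorem exists_rho_sq_bound {g : ℝ → ℂ} (hg : Continuous g) {N : ℝ} (hN : 0 ≤ N)
    (h0 : ∀ x, N < |x| → g x = 0) : ∃ M, 0 ≤ M ∧ ∀ x, ‖g x‖ ≤ M * rho x ^ 2 := by
  obtain ⟨M, hM⟩ := (isCompact_Icc (a := -N) (b := N)).exists_bound_of_continuousOn hg.continuousOn
  have hM0 : 0 ≤ M := (norm_nonneg _).trans (hM 0 ⟨by linarith, hN⟩)
  have hr := rho_pos N
  refine ⟨M / rho N ^ 2, by positivity, fun x => ?_⟩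
  by_cases hx : |x| ≤ N
  · refine (hM x (abs_le.mp hx)).trans ?_
    rw [div_mul_eq_mul_div, le_div_iff₀ (by positivity)]
    have : rho N ≤ rho x := rho_anti (by rwa [abs_of_nonneg hN])
    gcongr
  · rw [h0 x (not_le.mp hx), norm_zero]
    positivity

/-- Beyond the supports of the source and of the transitions of the cut-off, the open channel
consists exactly of plane waves with the chosen coefficients. Its remainder is thus compactly
supported, although the channel itself does not decay. -/
theorem modeRem_zero_eq_zero (hX : 0 < X) (A : SeqSpace X)
    (hs : ∀ x, X ≤ |x| → zeroExt (A 0) x = 0) {x : ℝ} (hx : max X 1 ≤ |x|) :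
    modeRem β ε μ A 0 x = 0 := by
  rw [modeRem, if_pos rfl]
  have h1 := (le_max_left X 1).trans hx
  have h2 := (le_max_right X 1).trans hx
  rcases abs_cases x with ⟨e, -⟩ | ⟨e, -⟩
  · rw [e] at h1 h2
    rw [modeAmp_zero_of_ge hX A hs h1, farProfile_of_ge _ _ _ _ h2, sub_self]
  · rw [e] at h1 h2
    rw [modeAmp_zero_of_le hX A hs (by linarith), farProfile_of_le _ _ _ _ (by linarith), sub_self]

theorem modeRemDeriv_zero_eq_zero (h0 : 0 < β) (h1 : β < 1 / 2) (hμ0 : 0 < μ) (hμ : μ ≤ muMax β)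
    (hX : 0 < X) (A : SeqSpace X) (hA : Continuous (zeroExt (A 0)))
    (hs : ∀ x, X ≤ |x| → zeroExt (A 0) x = 0) {x : ℝ} (hx : max X 1 < |x|) :
    modeRemDeriv β ε μ A 0 x = 0 := by
  have ho : IsOpen {x : ℝ | max X 1 < |x|} := isOpen_lt continuous_const continuous_abs
  have he : modeRem β ε μ A 0 =ᶠ[𝓝 x] fun _ => (0 : ℂ) := by
    filter_upwards [ho.mem_nhds hx] with y hy
    exact modeRem_zero_eq_zero hX A hs (le_of_lt hy)
  rw [← (hasDerivAt_modeRem h0 h1 hμ0 hμ A 0 hA x).deriv, he.deriv_eq]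
  simp

/-- With `d_n = √(1 + n²)`, the Green function estimate gives `‖A_n‖/d_n²` for a closed mode; one
factor `d_n` absorbs `β + n`. The remaining `‖A_n‖/d_n` is summable, being at most `‖A_n‖² +
1/d_n²`. This majorant feeds both membership in the energy space and termwise integration. -/
theorem exists_modeRem_bounds (h0 : 0 < β) (h1 : β < 1 / 2) (hμ0 : 0 < μ) (hμ : μ ≤ muMax β)
    (hX : 0 < X) (A : SeqSpace X) (hs : ∀ n x, X ≤ |x| → zeroExt (A n) x = 0) :
    ∃ c : ℤ → ℝ, Summable c ∧ (∀ n, 0 ≤ c n) ∧ (∀ n x, ‖modeRem β ε μ A n x‖ ≤ c n * rho x ^ 2) ∧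
      (∀ n x, ‖modeRemDeriv β ε μ A n x‖ ≤ c n * rho x ^ 2) ∧
      (∀ (n : ℤ) x, ‖(β + n : ℂ)‖ * ‖modeRem β ε μ A n x‖ ≤ c n * rho x ^ 2) ∧
      ∀ n, ∀ x ∈ Icc (-X) X, ‖modeAmp β ε μ A n x‖ ≤ c n := by
  have hA := fun n => continuous_zeroExt hX (hs n)
  obtain ⟨b, hb, hb1, hbd⟩ := exists_decayRate_ge h0 h1 hμ0
  obtain ⟨C, hC, hCb⟩ := exists_greenConv_bound hb hX
  have hmax : (0 : ℝ) ≤ max X 1 := le_max_of_le_right zero_le_one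
  have hrc : Continuous (modeRem β ε μ A 0) := continuous_iff_continuousAt.mpr fun x =>
    (hasDerivAt_modeRem h0 h1 hμ0 hμ A 0 (hA 0) x).continuousAt
  have hac : Continuous (modeAmp β ε μ A 0) := continuous_iff_continuousAt.mpr fun x =>
    (hasDerivAt_modeAmp h0 h1 hμ0 hμ A 0 (hA 0) x).continuousAt
  obtain ⟨M₁, hM₁, hM₁b⟩ := exists_rho_sq_bound hrc hmax
    fun x hx => modeRem_zero_eq_zero hX A (hs 0) hx.le
  obtain ⟨M₂, hM₂, hM₂b⟩ := exists_rho_sq_bound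
    (continuous_modeRemDeriv (ε := ε) h0 h1 hμ0 hμ A 0 (hA 0)) hmax
    fun x hx => modeRemDeriv_zero_eq_zero h0 h1 hμ0 hμ hX A (hA 0) (hs 0) hx
  obtain ⟨M₃, hM₃b⟩ := (isCompact_Icc (a := -X) (b := X)).exists_bound_of_continuousOn hac.continuousOn
  have hM₃ : 0 ≤ M₃ := (norm_nonneg _).trans (hM₃b 0 ⟨by linarith, hX.le⟩)
  set g := ‖2 * gammaC β μ * (ε : ℂ)‖ with hg
  set d : ℤ → ℝ := fun n => Real.sqrt (1 + (n : ℝ) ^ 2) with hd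
  have hd1 : ∀ n, 1 ≤ d n := fun n => Real.one_le_sqrt.mpr (by linarith [sq_nonneg (n : ℝ)])
  have hdsq : ∀ n, d n ^ 2 = 1 + (n : ℝ) ^ 2 := fun n => Real.sq_sqrt (by positivity)
  have hdn : ∀ n : ℤ, ‖(β + n : ℂ)‖ ≤ 2 * d n := fun n => by
    refine (norm_add_le _ _).trans ?_
    rw [Complex.norm_real, Complex.norm_intCast, Real.norm_of_nonneg h0.le]
    have : |(n : ℝ)| ≤ d n := Real.abs_le_sqrt (by linarith)
    linarith [hd1 n]
  set G := g * C * 2 / b ^ 2 with hG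
  have hGn : 0 ≤ G := by positivity
  let c : ℤ → ℝ := fun n => if n = 0 then M₁ + M₂ + M₃ else G * (‖A n‖ / d n)
  have hc0 : c 0 = M₁ + M₂ + M₃ := if_pos rfl
  have hcn : ∀ n, n ≠ 0 → c n = G * (‖A n‖ / d n) := fun n hn => if_neg hn
  have hmain : ∀ n, n ≠ 0 → ∀ x, ‖modeAmp β ε μ A n x‖ * (2 * d n) ≤ c n * rho x ^ 2 ∧
      ‖modeAmpDeriv β ε μ A n x‖ ≤ c n * rho x ^ 2 := fun n hn x => by
    have hdn0 : 0 < d n := by linarith [hd1 n]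
    have hbk : b ≤ decayRate β μ n := by
      refine le_trans ?_ (hbd n hn)
      exact le_mul_of_one_le_right hb.le (hd1 n)
    obtain ⟨q1, q2⟩ := hCb (decayRate β μ n) (zeroExt (A n)) ‖A n‖ hbk (hs n)
      (norm_zeroExt_le (A n)) x
    have hk : modeExponent β μ n = decayRate β μ n := if_neg hn
    rw [modeAmp, modeAmpDeriv, if_neg hn, if_neg hn, zero_add, zero_add, hk,
      norm_mul (2 * gammaC β μ * (ε : ℂ)), norm_mul (2 * gammaC β μ * (ε : ℂ)), ← hg, hcn n hn]
    have hr := rho_pos x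
    have hkd := hbd n hn
    have hsn := norm_nonneg (A n)
    constructor
    · calc g * ‖greenConv (decayRate β μ n) X (zeroExt (A n)) x‖ * (2 * d n)
          ≤ g * (C * ‖A n‖ / (b * d n) ^ 2 * rho x ^ 2) * (2 * d n) := by
            gcongr
            refine q1.trans ?_
            gcongr
        _ = G * (‖A n‖ / d n) * rho x ^ 2 := by
            rw [hG]
            field_simp
    · calc g * ‖greenConvDeriv (decayRate β μ n) X (zeroExt (A n)) x‖
          ≤ g * (C * ‖A n‖ / (b * d n) * rho x ^ 2) := by
            gcongr
            refine q2.trans ?_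
            gcongr
        _ = g * C * (‖A n‖ / d n) * rho x ^ 2 * (1 / b) := by
            field_simp
        _ ≤ g * C * (‖A n‖ / d n) * rho x ^ 2 * (2 / b ^ 2) := by
            refine mul_le_mul_of_nonneg_left ?_ (by positivity)
            rw [div_le_div_iff₀ hb (by positivity)]
            nlinarith
        _ = _ := by
            rw [hG]
            ring
  have hcnn : ∀ n, 0 ≤ c n := fun n => by
    by_cases hn : n = 0
    · rw [hn, hc0]
      positivity
    · rw [hcn n hn]
      have := hd1 n
      positivity
  have hrem : ∀ n, n ≠ 0 → ∀ x, modeRem β ε μ A n x = modeAmp β ε μ A n x ∧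
      modeRemDeriv β ε μ A n x = modeAmpDeriv β ε μ A n x := fun n hn x => by
    simp [modeRem, modeRemDeriv, hn]
  have hβ : ‖((β : ℂ) + ((0 : ℤ) : ℂ))‖ ≤ 1 := by
    rw [Int.cast_zero, add_zero, Complex.norm_real, Real.norm_of_nonneg h0.le]
    linarith
  refine ⟨c, ?_, hcnn, ?_, ?_, ?_, ?_⟩
  · have hA2 : Summable fun n => ‖A n‖ ^ 2 := by
      have := (lp.memℓp A).summable (by norm_num)
      refine this.congr fun n => ?_
      norm_num
    have h1 : Summable fun n => G * (‖A n‖ ^ 2 + 1 / (1 + (n : ℝ) ^ 2)) :=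
      (hA2.add summable_one_div_one_add_sq).mul_left G
    refine Summable.of_norm_bounded_eventually h1 ?_
    rw [Filter.eventually_cofinite]
    refine (Set.finite_singleton (0 : ℤ)).subset fun n hn => ?_
    by_contra hn0
    refine hn ?_
    rw [Real.norm_of_nonneg (hcnn n), hcn n hn0, ← hdsq]
    refine mul_le_mul_of_nonneg_left ?_ hGn
    have e1 : ‖A n‖ / d n = ‖A n‖ * (1 / d n) := by ring
    have e2 : 1 / d n ^ 2 = (1 / d n) ^ 2 := by rw [one_div_pow]
    rw [e1, e2]
    nlinarith [sq_nonneg (‖A n‖ - 1 / d n), sq_nonneg (‖A n‖), sq_nonneg (1 / d n)]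
  · intro n x
    by_cases hn : n = 0
    · rw [hn, hc0]
      refine (hM₁b x).trans (mul_le_mul_of_nonneg_right ?_ (sq_nonneg _))
      linarith
    · rw [(hrem n hn x).1]
      refine le_trans ?_ (hmain n hn x).1
      exact le_mul_of_one_le_right (norm_nonneg _) (by linarith [hd1 n])
  · intro n x
    by_cases hn : n = 0
    · rw [hn, hc0]
      refine (hM₂b x).trans (mul_le_mul_of_nonneg_right ?_ (sq_nonneg _))
      linarith
    · rw [(hrem n hn x).2]
      exact (hmain n hn x).2
  · intro n x
    by_cases hn : n = 0
    · rw [hn, hc0]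
      refine (mul_le_mul hβ (hM₁b x) (norm_nonneg _) zero_le_one).trans ?_
      rw [one_mul]
      refine mul_le_mul_of_nonneg_right ?_ (sq_nonneg _)
      linarith
    · rw [(hrem n hn x).1, mul_comm]
      exact (mul_le_mul_of_nonneg_left (hdn n) (norm_nonneg _)).trans (hmain n hn x).1
  · intro n x hx
    by_cases hn : n = 0
    · rw [hn, hc0]
      linarith [hM₃b x hx]
    · have h2 : ‖modeAmp β ε μ A n x‖ ≤ ‖modeAmp β ε μ A n x‖ * (2 * d n) :=
        le_mul_of_one_le_right (norm_nonneg _) (by linarith [hd1 n])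
      refine (h2.trans (hmain n hn x).1).trans (mul_le_of_le_one_right (hcnn n) ?_)
      exact pow_le_one₀ (rho_pos x).le (rho_le_one x)

end

/-! ### From mode amplitudes to the weak scattering problem -/

section

variable {f : ℝ × ℝ → ℝ} {X β ε μ : ℝ}

theorem hasSum_add_single {a b : ℤ → ℂ} {c : ℂ} (hb : Summable b)
    (h : ∀ n, a n = b n + if n = 0 then c else 0) : HasSum a (c + ∑' n, b n) := by
  rw [add_comm]
  exact (hb.hasSum.add (hasSum_ite_eq 0 c)).congr_fun h

theorem summable_norm_fourierCoef (hf : IsPerturbation f X) (x : ℝ) :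
    Summable fun j => ‖fourierCoef f j x‖ := by
  obtain ⟨C, hC0, hC⟩ := hf.exists_fourierCoef_bound
  refine Summable.of_nonneg_of_le (fun _ => norm_nonneg _) (fun j => hC j x) ?_
  exact (summable_one_div_one_add_sq.mul_left C).congr fun j => by ring

/-- A priori `A` is only square summable. As the convolution of summable amplitudes with summable
Fourier coefficients it is summable, which permits integrating the source series termwise. -/
theorem summable_norm_source (hf : IsPerturbation f X) (A : SeqSpace X) {c : ℤ → ℝ}
    (hc : Summable c) (hc0 : ∀ n, 0 ≤ c n)
    (hb : ∀ n, ∀ x ∈ Icc (-X) X, ‖modeAmp β ε μ A n x‖ ≤ c n)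
    (hE : ∀ (m : ℤ) (x : Icc (-X) X),
      A m x = ∑' n, modeAmp β ε μ A n x * fourierCoef f (m - n) x) :
    Summable fun m => ‖A m‖ := by
  have hv := summable_norm_coefC hf
  have hs := summable_int_convolution hc0 (fun _ => norm_nonneg _) hc hv
  have hsum := (hasSum_int_convolution (u := c) (v := fun j => ‖coefC hf j‖)
    (hc.congr fun n => (Real.norm_of_nonneg (hc0 n)).symm)
    (hv.congr fun n => (norm_norm _).symm) hc.hasSum hv.hasSum).summable
  refine Summable.of_nonneg_of_le (fun m => norm_nonneg (A m)) (fun m => ?_) hsum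
  refine (ContinuousMap.norm_le _ (tsum_nonneg fun n => mul_nonneg (hc0 n) (norm_nonneg _))).mpr
    fun x => ?_
  rw [hE]
  refine tsum_of_norm_bounded (hs m).hasSum fun n => ?_
  rw [norm_mul]
  exact mul_le_mul (hb n x x.2) ((coefC hf (m - n)).norm_coe_le_norm x) (norm_nonneg _) (hc0 n)

theorem quasiMode_mul_exp (β : ℝ) (n j : ℤ) (y : ℝ) :
    quasiMode β n y * Complex.exp (Complex.I * j * y) = quasiMode β (n + j) y := by
  rw [quasiMode, quasiMode, ← Complex.exp_add]
  congr 1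
  push_cast
  ring

/-- Multiplication of Fourier series: by `hE` the source is the convolution of the amplitudes with
the `f_j`, whose series sums to `2πf`. For `|x| ≥ X` both sides vanish. -/
theorem hasSum_source (hf : IsPerturbation f X) (A : SeqSpace X)
    (hs : ∀ n x, X ≤ |x| → zeroExt (A n) x = 0) {c : ℤ → ℝ}
    (hc : Summable c) (hb : ∀ n, ∀ x ∈ Icc (-X) X, ‖modeAmp β ε μ A n x‖ ≤ c n)
    (hE : ∀ (m : ℤ) (x : Icc (-X) X),
      A m x = ∑' n, modeAmp β ε μ A n x * fourierCoef f (m - n) x) {x y : ℝ} {U : ℂ}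
    (hU : HasSum (fun n => modeAmp β ε μ A n x * quasiMode β n y) U) :
    HasSum (fun m => zeroExt (A m) x * quasiMode β m y) (U * (2 * Real.pi * (f (x, y) : ℂ))) := by
  rcases le_or_gt X |x| with hx | hx
  · have h1 : ∀ m, zeroExt (A m) x * quasiMode β m y = 0 := fun m => by rw [hs m x hx, zero_mul]
    have h2 : (2 * Real.pi * (f (x, y) : ℂ)) = 0 := by
      refine (hf.hasSum_fourier x y).unique ?_
      exact hasSum_zero.congr_fun fun j => by rw [hf.fourierCoef_eq_zero j hx, zero_mul]
    rw [h2, mul_zero]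
    exact hasSum_zero.congr_fun h1
  · have hx' : x ∈ Icc (-X) X := abs_le.mp hx.le
    have hu : Summable fun n => ‖modeAmp β ε μ A n x * quasiMode β n y‖ := by
      refine Summable.of_nonneg_of_le (fun _ => norm_nonneg _) (fun n => ?_) hc
      rw [norm_mul, norm_quasiMode, mul_one]
      exact hb n x hx'
    have hv : Summable fun j : ℤ => ‖fourierCoef f j x * Complex.exp (Complex.I * j * y)‖ := by
      refine (summable_norm_fourierCoef hf x).congr fun j => ?_
      rw [norm_mul, show Complex.I * j * y = ((j * y : ℝ) : ℂ) * Complex.I by push_cast; ring,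
        Complex.norm_exp_ofReal_mul_I, mul_one]
    refine (hasSum_int_convolution hu hv hU (hf.hasSum_fourier x y)).congr_fun fun m => ?_
    have e : zeroExt (A m) x = A m ⟨x, hx'⟩ := zeroExt_coe (A m) ⟨x, hx'⟩
    rw [e, hE, ← tsum_mul_right]
    congr 1
    funext n
    have := quasiMode_mul_exp β n (m - n) y
    rw [add_sub_cancel] at this
    rw [← this]
    ring

/-- A source that is generated by its own modes gives a solution of the scattering problem. -/
theorem areScatteringCoefficients_of_source (hf : IsPerturbation f X) (h0 : 0 < β) (h1 : β < 1 / 2)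
    (hμ0 : 0 < μ) (hμ : μ ≤ muMax β) (A : SeqSpace X)
    (hs : ∀ n x, X ≤ |x| → zeroExt (A n) x = 0)
    (hE : ∀ (m : ℤ) (x : Icc (-X) X),
      A m x = ∑' n, modeAmp β ε μ A n x * fourierCoef f (m - n) x) :
    AreScatteringCoefficients f β ε μ (reflCoef β ε μ A) (transCoef β ε μ A) := by
  have hA := fun n => continuous_zeroExt hf.pos (hs n)
  obtain ⟨c, hc, hc0, hb, hb₁, hb₂, hba⟩ := exists_modeRem_bounds (ε := ε) h0 h1 hμ0 hμ hf.pos A hs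
  have hAs := summable_norm_source hf A hc hc0 hba hE
  have hrd := fun n x => hasDerivAt_modeRem (ε := ε) h0 h1 hμ0 hμ A n (hA n) x
  have had := fun n x => hasDerivAt_modeAmp (ε := ε) h0 h1 hμ0 hμ A n (hA n) x
  have had' := fun n x => hasDerivAt_modeAmpDeriv (ε := ε) h0 h1 hμ0.le hμ A n (hA n) x
  have hac : ∀ n, Continuous (modeAmp β ε μ A n) := fun n =>
    continuous_iff_continuousAt.mpr fun x => (had n x).continuousAt
  have hac' : ∀ n, Continuous (modeAmpDeriv β ε μ A n) := fun n =>
    continuous_iff_continuousAt.mpr fun x => (had' n x).continuousAt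
  set R := reflCoef β ε μ A with hR
  set T := transCoef β ε μ A with hT
  set q := farProfile (waveNumber β μ) 1 R T with hq
  have hfar := farField_eq β μ R T
  have hfd := fun p : ℝ × ℝ => hasFDerivAt_mode (β := β) (p := p) 0
    (hasDerivAt_farProfile (waveNumber β μ) 1 R T p.1)
  have hmem := memH1_tsum (β := β) hrd
    (fun n => continuous_modeRemDeriv h0 h1 hμ0 hμ A n (hA n)) hc hb hb₁ hb₂
  have hle : ∀ {n : ℤ} {x : ℝ} {t : ℝ}, t ≤ c n * rho x ^ 2 → t ≤ c n := fun {n x t} h =>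
    h.trans (mul_le_of_le_one_right (hc0 n) (pow_le_one₀ (rho_pos x).le (rho_le_one x)))
  have s1 : ∀ p : ℝ × ℝ, Summable fun n => modeRem β ε μ A n p.1 * quasiMode β n p.2 := fun p =>
    Summable.of_norm_bounded hc fun n => by
      rw [norm_mul, norm_quasiMode, mul_one]
      exact hle (hb n p.1)
  have s2 : ∀ p : ℝ × ℝ, Summable fun n => modeRemDeriv β ε μ A n p.1 * quasiMode β n p.2 := fun p =>
    Summable.of_norm_bounded hc fun n => by
      rw [norm_mul, norm_quasiMode, mul_one]
      exact hle (hb₁ n p.1)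
  have s3 : ∀ p : ℝ × ℝ, Summable fun n : ℤ =>
      Complex.I * (β + n) * modeRem β ε μ A n p.1 * quasiMode β n p.2 := fun p =>
    Summable.of_norm_bounded hc fun n => by
      rw [norm_mul, norm_quasiMode, mul_one, norm_mul, norm_mul, Complex.norm_I, one_mul]
      exact hle (hb₂ n p.1)
  set Ψ : ℝ × ℝ → ℂ := fun p => farField β μ R T p + ∑' n, modeRem β ε μ A n p.1 * quasiMode β n p.2
    with hΨ
  set Ψx : ℝ × ℝ → ℂ := fun p => dX (farField β μ R T) p +
    ∑' n, modeRemDeriv β ε μ A n p.1 * quasiMode β n p.2 with hΨx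
  set Ψy : ℝ × ℝ → ℂ := fun p => dY (farField β μ R T) p +
    ∑' n : ℤ, Complex.I * (β + n) * modeRem β ε μ A n p.1 * quasiMode β n p.2 with hΨy
  have t1 : ∀ p : ℝ × ℝ, HasSum (fun n => modeAmp β ε μ A n p.1 * quasiMode β n p.2) (Ψ p) :=
    fun p => hasSum_add_single (s1 p) fun n => by
      rw [modeRem, hfar]
      split_ifs with hn
      · rw [hn]; ring
      · ring
  have t2 : ∀ p : ℝ × ℝ, HasSum (fun n => modeAmpDeriv β ε μ A n p.1 * quasiMode β n p.2) (Ψx p) :=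
    fun p => hasSum_add_single (s2 p) fun n => by
      rw [modeRemDeriv, hfar, (hfd p).1]
      split_ifs with hn
      · rw [hn]; ring
      · ring
  have t3 : ∀ p : ℝ × ℝ, HasSum (fun n : ℤ =>
      Complex.I * (β + n) * modeAmp β ε μ A n p.1 * quasiMode β n p.2) (Ψy p) :=
    fun p => hasSum_add_single (s3 p) fun n => by
      rw [modeRem, hfar, (hfd p).2.1]
      split_ifs with hn
      · rw [hn]; ring
      · ring
  refine ⟨Ψ, Ψx, Ψy, ?_, ?_⟩
  · simpa only [hΨ, hΨx, hΨy, add_sub_cancel_left] using hmem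
  intro Φ hΦ
  obtain ⟨L, hL0, hL, hv⟩ := hΦ.exists_vanish
  have hqc := fun m : ℤ => continuous_quasiMode β m
  have hΦc := hΦ.smooth.continuous
  have hXc := hΦ.continuous_dX
  have hYc := hΦ.continuous_dY
  let F : ℤ → ℝ × ℝ → ℂ := fun n p => modeAmpDeriv β ε μ A n p.1 * quasiMode β n p.2 * conj (dX Φ p) +
    Complex.I * (β + n) * modeAmp β ε μ A n p.1 * quasiMode β n p.2 * conj (dY Φ p)
  let G : ℤ → ℝ × ℝ → ℂ := fun n p => (omegaSq β μ * modeAmp β ε μ A n p.1 +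
    2 * gammaC β μ * ε * zeroExt (A n) p.1) * quasiMode β n p.2 * conj (Φ p)
  -- Green's formula turns the ordinary differential equation of each mode into its weak form; what
  -- remains is to sum over `n`, for which the `L¹` norms are shown to be summable.
  have hFG : ∀ n, ∫ p in strip, F n p = ∫ p in strip, G n p := fun n => by
    have hA' := hA n
    have hac1 := hac n
    have := integral_strip_mode hΦ (had n) (had' n) (by fun_prop) n
    refine this.trans ?_
    congr 1
    funext p
    simp only [G]
    ring
  have iF : ∀ n, IntegrableOn (F n) strip := fun n => by
    have := hac n
    have := hac' n
    have := hqc n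
    refine integrableOn_strip (L := L) (by fun_prop) fun p hp hpL => ?_
    simp only [F]
    rw [(hv p hp hpL).2.1, (hv p hp hpL).2.2]
    simp
  have iG : ∀ n, IntegrableOn (G n) strip := fun n => by
    have := hac n
    have := hA n
    have := hqc n
    refine integrableOn_strip (L := L) (by fun_prop) fun p hp hpL => ?_
    simp only [G]
    rw [(hv p hp hpL).1]
    simp
  have iX : IntegrableOn (dX Φ) strip :=
    integrableOn_strip (L := L) hXc fun p hp hpL => (hv p hp hpL).2.1
  have iY : IntegrableOn (dY Φ) strip :=
    integrableOn_strip (L := L) hYc fun p hp hpL => (hv p hp hpL).2.2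
  have iΦ : IntegrableOn Φ strip :=
    integrableOn_strip (L := L) hΦc fun p hp hpL => (hv p hp hpL).1
  have hamp : ∀ n : ℤ, n ≠ 0 → ∀ x, ‖modeAmp β ε μ A n x‖ ≤ c n ∧ ‖modeAmpDeriv β ε μ A n x‖ ≤ c n ∧
      ‖(β + n : ℂ)‖ * ‖modeAmp β ε μ A n x‖ ≤ c n := fun n hn x => by
    have e1 : modeRem β ε μ A n x = modeAmp β ε μ A n x := by simp [modeRem, hn]
    have e2 : modeRemDeriv β ε μ A n x = modeAmpDeriv β ε μ A n x := by simp [modeRemDeriv, hn]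
    rw [← e1, ← e2]
    exact ⟨hle (hb n x), hle (hb₁ n x), hle (hb₂ n x)⟩
  have hev : ∀ {P : ℤ → Prop}, (∀ n, n ≠ 0 → P n) → ∀ᶠ n in cofinite, P n := fun {P} hP => by
    rw [Filter.eventually_cofinite]
    refine (Set.finite_singleton (0 : ℤ)).subset fun n hn => ?_
    by_contra hn0
    exact hn (hP n hn0)
  have sF : Summable fun n => ∫ p in strip, ‖F n p‖ := by
    refine Summable.of_norm_bounded_eventually
      (hc.mul_right (∫ p in strip, (‖dX Φ p‖ + ‖dY Φ p‖))) (hev fun n hn => ?_)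
    rw [Real.norm_of_nonneg (integral_nonneg fun _ => norm_nonneg _), ← integral_const_mul]
    refine integral_mono (iF n).norm ((iX.norm.add iY.norm).const_mul _) fun p => ?_
    obtain ⟨a1, a2, a3⟩ := hamp n hn p.1
    refine (norm_add_le _ _).trans ?_
    rw [norm_mul, norm_mul, norm_mul, norm_mul, norm_mul, norm_mul, norm_quasiMode, Complex.norm_I,
      mul_one, one_mul, mul_one, RCLike.norm_conj, RCLike.norm_conj, mul_add]
    exact add_le_add (mul_le_mul_of_nonneg_right a2 (norm_nonneg _))
      (mul_le_mul_of_nonneg_right a3 (norm_nonneg _))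
  have sG : Summable fun n => ∫ p in strip, ‖G n p‖ := by
    refine Summable.of_norm_bounded_eventually
      (((hc.mul_left ‖(omegaSq β μ : ℂ)‖).add (hAs.mul_left ‖2 * gammaC β μ * (ε : ℂ)‖)).mul_right
        (∫ p in strip, ‖Φ p‖)) (hev fun n hn => ?_)
    rw [Real.norm_of_nonneg (integral_nonneg fun _ => norm_nonneg _), ← integral_const_mul]
    refine integral_mono (iG n).norm (iΦ.norm.const_mul _) fun p => ?_
    obtain ⟨a1, -, -⟩ := hamp n hn p.1
    simp only [G]
    rw [norm_mul, norm_mul, norm_quasiMode, mul_one, RCLike.norm_conj]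
    refine mul_le_mul_of_nonneg_right ((norm_add_le _ _).trans ?_) (norm_nonneg _)
    rw [norm_mul, norm_mul (2 * gammaC β μ * (ε : ℂ))]
    exact add_le_add (mul_le_mul_of_nonneg_left a1 (norm_nonneg _))
      (mul_le_mul_of_nonneg_left (norm_zeroExt_le (A n) _) (norm_nonneg _))
  have hF := hasSum_integral_of_summable_integral_norm iF sF
  have hG := hasSum_integral_of_summable_integral_norm iG sG
  have hFs : ∀ p, ∑' n, F n p = Ψx p * conj (dX Φ p) + Ψy p * conj (dY Φ p) := fun p =>
    (((t2 p).mul_right _).add ((t3 p).mul_right _)).tsum_eq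
  -- This is the reason for the normalization of `γ`: the coefficients `f_j` lack the factor
  -- `1/(2π)`.
  have hω : 2 * gammaC β μ * (2 * Real.pi) = omegaSq β μ := by
    have : (Real.pi : ℂ) ≠ 0 := by exact_mod_cast Real.pi_ne_zero
    unfold gammaC omegaSq
    push_cast
    field_simp
    ring
  have hGs : ∀ p, ∑' n, G n p =
      (omegaSq β μ : ℂ) * ((1 + (ε : ℂ) * (f p : ℂ)) * Ψ p * conj (Φ p)) := fun p => by
    have h2 := hasSum_source hf A hs hc hba hE (t1 p)
    have h3 := ((((t1 p).mul_left (omegaSq β μ : ℂ)).add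
      (h2.mul_left (2 * gammaC β μ * ε))).mul_right (conj (Φ p))).tsum_eq
    refine Eq.trans ?_ (h3.trans ?_)
    · congr 1
      funext n
      simp only [G]
      ring
    · linear_combination ((ε : ℂ) * Ψ p * (f p : ℂ) * conj (Φ p)) * hω
  simp only [hFs] at hF
  simp only [hGs] at hG
  rw [← integral_const_mul]
  refine hF.unique ?_
  simp only [hFG]
  exact hG

end

section

/-! ### The sesquilinear pairing on the strip -/

variable {f : ℝ × ℝ → ℝ} {X β ε μ : ℝ}

/-- The inner product of `L²(Π)`, linear in the first argument. -/
def pairing (u v : ℝ × ℝ → ℂ) : ℂ := ∫ p in strip, u p * conj (v p)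

/-- Square integrability on the strip. -/
abbrev MemL2 (u : ℝ × ℝ → ℂ) : Prop := MemLp u 2 (volume.restrict strip)

theorem MemL2.conj {u : ℝ × ℝ → ℂ} (hu : MemL2 u) : MemL2 fun p => conj (u p) := hu.star

theorem MemL2.integrable_mul_conj {u v : ℝ × ℝ → ℂ} (hu : MemL2 u) (hv : MemL2 v) :
    Integrable (fun p => u p * conj (v p)) (volume.restrict strip) :=
  MemLp.integrable_mul hu hv.conj

theorem pairing_add {u u' v : ℝ × ℝ → ℂ} (hu : MemL2 u) (hu' : MemL2 u') (hv : MemL2 v) :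
    pairing (fun p => u p + u' p) v = pairing u v + pairing u' v := by
  unfold pairing
  rw [← integral_add (hu.integrable_mul_conj hv) (hu'.integrable_mul_conj hv)]
  congr 1
  funext p
  ring

theorem pairing_sub {u u' v : ℝ × ℝ → ℂ} (hu : MemL2 u) (hu' : MemL2 u') (hv : MemL2 v) :
    pairing (fun p => u p - u' p) v = pairing u v - pairing u' v := by
  unfold pairing
  rw [← integral_sub (hu.integrable_mul_conj hv) (hu'.integrable_mul_conj hv)]
  congr 1
  funext p
  ring

theorem conj_pairing (u v : ℝ × ℝ → ℂ) : conj (pairing u v) = pairing v u := by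
  unfold pairing
  rw [← integral_conj]
  congr 1
  funext p
  rw [map_mul, Complex.conj_conj, mul_comm]

theorem pairing_real_mul (V : ℝ × ℝ → ℝ) (u v : ℝ × ℝ → ℂ) :
    pairing (fun p => V p * u p) v = pairing u fun p => V p * v p := by
  unfold pairing
  congr 1
  funext p
  rw [map_mul, Complex.conj_ofReal]
  ring

theorem tendsto_pairing {u w : ℝ × ℝ → ℂ} {φ : ℕ → ℝ × ℝ → ℂ} (hu : MemL2 u) (hw : MemL2 w)
    (hφ : ∀ k, MemL2 (φ k))
    (h : Tendsto (fun k => eLpNorm (fun p => φ k p - w p) 2 (volume.restrict strip)) atTop (𝓝 0)) :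
    Tendsto (fun k => pairing u (φ k)) atTop (𝓝 (pairing u w)) := by
  refine tendsto_integral_of_L1' (f := fun p => u p * conj (w p))
    (hu.integrable_mul_conj hw).aestronglyMeasurable
    (Eventually.of_forall fun k => hu.integrable_mul_conj (hφ k)) ?_
  have hb : ∀ k, eLpNorm ((fun p => u p * conj (φ k p)) - fun p => u p * conj (w p)) 1
      (volume.restrict strip) ≤ eLpNorm u 2 (volume.restrict strip) *
        eLpNorm (fun p => φ k p - w p) 2 (volume.restrict strip) := fun k => by
    have hd : MemL2 fun p => φ k p - w p := (hφ k).sub hw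
    have := eLpNorm_smul_le_mul_eLpNorm (r := 1) (p := 2) (q := 2) hd.star.aestronglyMeasurable
      hu.aestronglyMeasurable
    rw [eLpNorm_star] at this
    convert this using 2
    funext p
    simp [mul_sub]
  refine tendsto_of_tendsto_of_tendsto_of_le_of_le tendsto_const_nhds ?_ (fun _ => zero_le) hb
  have := ENNReal.Tendsto.const_mul (a := eLpNorm u 2 (volume.restrict strip)) h
    (Or.inr hu.eLpNorm_ne_top)
  rwa [mul_zero] at this

theorem memL2_of_vanish {L : ℝ} {g : ℝ × ℝ → ℂ} (hg : Continuous g)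
    (h0 : ∀ p ∈ strip, L < |p.1| → g p = 0) : MemL2 g := by
  refine (memLp_two_iff_integrable_sq_norm hg.aestronglyMeasurable).mpr ?_
  have h2 : Continuous fun p => ((‖g p‖ ^ 2 : ℝ) : ℂ) := by fun_prop
  have := integrableOn_strip (L := L) h2 fun p hp hL => by simp [h0 p hp hL]
  exact this.re

theorem IsTestFunction.memL2 {Φ : ℝ × ℝ → ℂ} (h : IsTestFunction β Φ) :
    MemL2 Φ ∧ MemL2 (dX Φ) ∧ MemL2 (dY Φ) := by
  obtain ⟨L, -, -, hv⟩ := h.exists_vanish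
  exact ⟨memL2_of_vanish (L := L) h.smooth.continuous fun p hp hL => (hv p hp hL).1,
    memL2_of_vanish (L := L) h.continuous_dX fun p hp hL => (hv p hp hL).2.1,
    memL2_of_vanish (L := L) h.continuous_dY fun p hp hL => (hv p hp hL).2.2⟩

theorem IsTestFunction.sub {φ ψ : ℝ × ℝ → ℂ} (hφ : IsTestFunction β φ) (hψ : IsTestFunction β ψ) :
    IsTestFunction β (fun p => φ p - ψ p) ∧
      (∀ p, dX (fun p => φ p - ψ p) p = dX φ p - dX ψ p) ∧
      ∀ p, dY (fun p => φ p - ψ p) p = dY φ p - dY ψ p := by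
  have hd : ∀ p, fderiv ℝ (fun p => φ p - ψ p) p = fderiv ℝ φ p - fderiv ℝ ψ p := fun p =>
    fderiv_fun_sub (hφ.differentiableAt p) (hψ.differentiableAt p)
  have hx : ∀ p, dX (fun p => φ p - ψ p) p = dX φ p - dX ψ p := fun p => by
    unfold dX
    rw [hd]
    rfl
  have hy : ∀ p, dY (fun p => φ p - ψ p) p = dY φ p - dY ψ p := fun p => by
    unfold dY
    rw [hd]
    rfl
  refine ⟨⟨hφ.smooth.sub hψ.smooth, ?_, fun x => ?_, fun x => ?_⟩, hx, hy⟩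
  · obtain ⟨L, hL⟩ := hφ.vanish
    obtain ⟨M, hM⟩ := hψ.vanish
    exact ⟨max L M, fun x y h hy => by
      rw [hL x y ((le_max_left _ _).trans_lt h) hy, hM x y ((le_max_right _ _).trans_lt h) hy,
        sub_zero]⟩
  · rw [hφ.bc, hψ.bc, mul_sub]
  · rw [hy, hy, hφ.bc_dy, hψ.bc_dy, mul_sub]

theorem tendsto_eLpNorm_sub {a b : ℕ → ℝ × ℝ → ℂ} {u v : ℝ × ℝ → ℂ}
    (ha : ∀ k, MemL2 (a k)) (hb : ∀ k, MemL2 (b k)) (hu : MemL2 u) (hv : MemL2 v)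
    (h1 : Tendsto (fun k => eLpNorm (fun p => a k p - u p) 2 (volume.restrict strip)) atTop (𝓝 0))
    (h2 : Tendsto (fun k => eLpNorm (fun p => b k p - v p) 2 (volume.restrict strip)) atTop (𝓝 0)) :
    Tendsto (fun k => eLpNorm (fun p => (a k p - b k p) - (u p - v p)) 2 (volume.restrict strip))
      atTop (𝓝 0) := by
  have h := h1.add h2
  rw [add_zero] at h
  refine tendsto_of_tendsto_of_tendsto_of_le_of_le tendsto_const_nhds h (fun _ => zero_le)
    fun k => ?_
  have := eLpNorm_sub_le ((ha k).sub hu).aestronglyMeasurable ((hb k).sub hv).aestronglyMeasurable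
    (one_le_two (α := ℝ≥0∞))
  refine le_of_eq_of_le ?_ this
  congr 1
  funext p
  simp only [Pi.sub_apply]
  ring

theorem MemH1.sub {u ux uy v vx vy : ℝ × ℝ → ℂ} (hu : MemH1 β u ux uy) (hv : MemH1 β v vx vy) :
    MemH1 β (fun p => u p - v p) (fun p => ux p - vx p) (fun p => uy p - vy p) where
  memLp := hu.memLp.sub hv.memLp
  memLp_dx := hu.memLp_dx.sub hv.memLp_dx
  memLp_dy := hu.memLp_dy.sub hv.memLp_dy
  approx := by
    obtain ⟨a, ha, a1, a2, a3⟩ := hu.approx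
    obtain ⟨b, hb, b1, b2, b3⟩ := hv.approx
    refine ⟨fun k p => a k p - b k p, fun k => ((ha k).sub (hb k)).1, ?_, ?_, ?_⟩
    · exact tendsto_eLpNorm_sub (fun k => (ha k).memL2.1) (fun k => (hb k).memL2.1) hu.memLp hv.memLp
        a1 b1
    · simp only [fun k => ((ha k).sub (hb k)).2.1]
      exact tendsto_eLpNorm_sub (fun k => (ha k).memL2.2.1) (fun k => (hb k).memL2.2.1) hu.memLp_dx
        hv.memLp_dx a2 b2
    · simp only [fun k => ((ha k).sub (hb k)).2.2]
      exact tendsto_eLpNorm_sub (fun k => (ha k).memL2.2.2) (fun k => (hb k).memL2.2.2) hu.memLp_dy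
        hv.memLp_dy a3 b3

theorem IsPerturbation.exists_bound (hf : IsPerturbation f X) : ∃ M, ∀ p, |f p| ≤ M := by
  obtain ⟨C, hC0, hC⟩ := hf.exists_fourierCoef_bound
  refine ⟨∑' j : ℤ, C * (1 / (1 + (j : ℝ) ^ 2)), fun p => ?_⟩
  have h := (hf.hasSum_fourier p.1 p.2).tsum_eq
  have h2 : ‖(2 * Real.pi * (f (p.1, p.2) : ℂ))‖ ≤ ∑' j : ℤ, C * (1 / (1 + (j : ℝ) ^ 2)) := by
    rw [← h]
    refine tsum_of_norm_bounded (summable_one_div_one_add_sq.mul_left C).hasSum fun j => ?_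
    rw [norm_mul, show Complex.I * j * p.2 = ((j * p.2 : ℝ) : ℂ) * Complex.I by push_cast; ring,
      Complex.norm_exp_ofReal_mul_I, mul_one]
    exact (hC j p.1).trans_eq (by ring)
  rw [norm_mul, norm_mul, Complex.norm_real, Complex.norm_real, Real.norm_eq_abs, Real.norm_eq_abs,
    abs_of_pos Real.pi_pos, Complex.norm_two] at h2
  have := Real.pi_gt_three
  nlinarith [abs_nonneg (f (p.1, p.2))]

theorem MemL2.bounded_mul {u : ℝ × ℝ → ℂ} (hu : MemL2 u) {V : ℝ × ℝ → ℝ} (hV : Continuous V) {M : ℝ}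
    (hM : ∀ p, |V p| ≤ M) : MemL2 fun p => V p * u p := by
  refine MemLp.of_le_mul (c := M) hu ?_ (ae_of_all _ fun p => ?_)
  · exact (Complex.continuous_ofReal.comp hV).aestronglyMeasurable.mul hu.aestronglyMeasurable
  · rw [norm_mul, Complex.norm_real, Real.norm_eq_abs]
    exact mul_le_mul_of_nonneg_right (hM p) (norm_nonneg _)

end

section

/-! ### Uniqueness of the scattering coefficients -/

variable {f : ℝ × ℝ → ℝ} {X β ε μ : ℝ}

theorem hasDerivAt_deriv_cutoff (L : ℝ) (x : ℝ) :
    HasDerivAt (fun x => deriv cutoffBump (x / L) / L) (deriv (deriv cutoffBump) (x / L) / L ^ 2) x := by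
  have hs : ContDiff ℝ 2 cutoffBump := cutoffBump.contDiff
  have hs1 : ContDiff ℝ 1 (deriv cutoffBump) := hs.deriv'
  have h : HasDerivAt (deriv cutoffBump) (deriv (deriv cutoffBump) (x / L)) (x / L) :=
    (hs1.differentiable one_ne_zero _).hasDerivAt
  have := (h.comp x ((hasDerivAt_id x).div_const L)).div_const L
  refine this.congr_deriv ?_
  ring

theorem exists_cutoff_deriv2_bound : ∃ M, 0 ≤ M ∧ ∀ x, |deriv (deriv cutoffBump) x| ≤ M := by
  have hs : ContDiff ℝ 2 cutoffBump := cutoffBump.contDiff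
  have hs1 : ContDiff ℝ 1 (deriv cutoffBump) := hs.deriv'
  obtain ⟨M, hM⟩ := (hs1.continuous_deriv le_rfl).bounded_above_of_compact_support
    cutoffBump.hasCompactSupport.deriv.deriv
  exact ⟨M, (norm_nonneg _).trans (hM 0), hM⟩

theorem deriv_cutoffBump_eq_zero_of_gt {x : ℝ} (hx : 2 < |x|) :
    deriv cutoffBump x = 0 ∧ deriv (deriv cutoffBump) x = 0 := by
  have he : (cutoffBump : ℝ → ℝ) =ᶠ[𝓝 x] fun _ => (0 : ℝ) := by
    filter_upwards [(isOpen_lt continuous_const continuous_abs).mem_nhds hx] with y hy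
    refine cutoffBump.zero_of_le_dist ?_
    rw [dist_zero_right, Real.norm_eq_abs]
    exact hy.le
  constructor
  · rw [he.deriv_eq]
    simp
  · rw [he.deriv.deriv_eq]
    simp

theorem deriv_deriv_cutoffBump_eq_zero {x : ℝ} (hx : |x| < 1) : deriv (deriv cutoffBump) x = 0 := by
  have he : deriv cutoffBump =ᶠ[𝓝 x] fun _ => (0 : ℝ) := by
    filter_upwards [(isOpen_lt continuous_abs continuous_const).mem_nhds hx] with y hy
    exact deriv_cutoffBump_eq_zero hy
  rw [he.deriv_eq]
  simp

/-- The error term `2 θ' q' + θ'' q` produced by cutting off the profile `q` at `|x| ~ L`. -/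
def cutoffError (q : ℝ → ℂ) (L : ℝ) (x : ℝ) : ℂ :=
  2 * ((deriv cutoffBump (x / L) / L : ℝ) : ℂ) * deriv q x +
    ((deriv (deriv cutoffBump) (x / L) / L ^ 2 : ℝ) : ℂ) * q x

theorem continuous_cutoffError {q : ℝ → ℂ} (hq : ContDiff ℝ ∞ q) (L : ℝ) :
    Continuous (cutoffError q L) := by
  have hs : ContDiff ℝ 2 cutoffBump := cutoffBump.contDiff
  have hs1 : ContDiff ℝ 1 (deriv cutoffBump) := hs.deriv'
  have h1 := hs1.continuous
  have h2 := hs1.continuous_deriv le_rfl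
  have h3 := hq.continuous
  have h4 := hq.continuous_deriv (by simp)
  unfold cutoffError
  fun_prop

theorem cutoffError_eq_zero {q : ℝ → ℂ} {L x : ℝ} (hL : 0 < L) (hx : |x| < L ∨ 2 * L < |x|) :
    cutoffError q L x = 0 := by
  have h : deriv cutoffBump (x / L) = 0 ∧ deriv (deriv cutoffBump) (x / L) = 0 := by
    rcases hx with hx | hx
    · have : |x / L| < 1 := by rwa [abs_div, abs_of_pos hL, div_lt_one hL]
      exact ⟨deriv_cutoffBump_eq_zero this, deriv_deriv_cutoffBump_eq_zero this⟩
    · exact deriv_cutoffBump_eq_zero_of_gt (by rwa [abs_div, abs_of_pos hL, lt_div_iff₀ hL])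
  simp [cutoffError, h.1, h.2]

/-- The error is `O(1/L)` and lives in `|x| ≤ 2L`, where `1 + x² ≤ 5L²`. Its square thus has an
integrable majorant independent of `L`. -/
theorem exists_cutoffError_bound {q : ℝ → ℂ} {B : ℝ} (hB : ∀ x, ‖q x‖ ≤ B ∧ ‖deriv q x‖ ≤ B) :
    ∃ C, 0 ≤ C ∧ ∀ L x, 1 ≤ L → ‖cutoffError q L x‖ ^ 2 ≤ C * rho x := by
  obtain ⟨M₁, hM₁, h1⟩ := exists_cutoff_deriv_bound
  obtain ⟨M₂, hM₂, h2⟩ := exists_cutoff_deriv2_bound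
  have hB0 : 0 ≤ B := (norm_nonneg _).trans (hB 0).1
  refine ⟨((2 * M₁ + M₂) * B) ^ 2 * 5, by positivity, fun L x hL => ?_⟩
  have hL0 : 0 < L := by linarith
  rcases lt_or_ge (2 * L) |x| with hx | hx
  · rw [cutoffError_eq_zero hL0 (Or.inr hx), norm_zero, zero_pow two_ne_zero]
    have := rho_pos x
    positivity
  have e : ‖cutoffError q L x‖ ≤ (2 * M₁ + M₂) * B / L := by
    have e1 : ‖((deriv cutoffBump (x / L) / L : ℝ) : ℂ)‖ ≤ M₁ / L := by
      rw [Complex.norm_real, norm_div, Real.norm_of_nonneg hL0.le]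
      exact div_le_div_of_nonneg_right (h1 _) hL0.le
    have e2 : ‖((deriv (deriv cutoffBump) (x / L) / L ^ 2 : ℝ) : ℂ)‖ ≤ M₂ / L := by
      rw [Complex.norm_real, norm_div, Real.norm_of_nonneg (by positivity : 0 ≤ L ^ 2)]
      exact div_le_div₀ hM₂ (h2 _) hL0 (by nlinarith)
    refine (norm_add_le _ _).trans ?_
    rw [norm_mul, norm_mul, norm_mul, Complex.norm_two]
    calc 2 * ‖((deriv cutoffBump (x / L) / L : ℝ) : ℂ)‖ * ‖deriv q x‖ +
          ‖((deriv (deriv cutoffBump) (x / L) / L ^ 2 : ℝ) : ℂ)‖ * ‖q x‖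
        ≤ 2 * (M₁ / L) * B + M₂ / L * B := by
          gcongr
          · exact (hB x).2
          · exact (hB x).1
      _ = _ := by ring
  have hr : 1 / L ^ 2 ≤ 5 * rho x := by
    unfold rho
    rw [mul_one_div, div_le_div_iff₀ (by positivity) (by positivity)]
    have : x ^ 2 ≤ (2 * L) ^ 2 := sq_le_sq' (by linarith [neg_abs_le x]) (by linarith [le_abs_self x])
    nlinarith
  calc ‖cutoffError q L x‖ ^ 2 ≤ ((2 * M₁ + M₂) * B / L) ^ 2 :=
        pow_le_pow_left₀ (norm_nonneg _) e 2
    _ = ((2 * M₁ + M₂) * B) ^ 2 * (1 / L ^ 2) := by ring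
    _ ≤ ((2 * M₁ + M₂) * B) ^ 2 * (5 * rho x) := by gcongr
    _ = _ := by ring

/-- Dominated convergence: at each point the error vanishes as soon as the cut-off radius exceeds
`|x|`, and the product is dominated by `C rho + ‖w‖²`. -/
theorem tendsto_pairing_cutoffError {q : ℝ → ℂ} (hq : ContDiff ℝ ∞ q) {B : ℝ}
    (hB : ∀ x, ‖q x‖ ≤ B ∧ ‖deriv q x‖ ≤ B) {w : ℝ × ℝ → ℂ} (hw : MemL2 w) :
    Tendsto (fun n : ℕ => pairing (fun p => cutoffError q (n + 1) p.1 * quasiMode β 0 p.2) w) atTop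
      (𝓝 0) := by
  obtain ⟨C, hC0, hC⟩ := exists_cutoffError_bound hB
  have hw2 := (memLp_two_iff_integrable_sq_norm hw.aestronglyMeasurable).mp hw
  have hc := fun L => continuous_cutoffError hq L
  have hm := continuous_quasiMode β 0
  have h0 : (0 : ℂ) = ∫ _ in strip, (0 : ℂ) := by simp
  unfold pairing
  rw [h0]
  refine tendsto_integral_of_dominated_convergence (fun p => C * rho p.1 + ‖w p‖ ^ 2) (fun n => ?_)
    ((integrable_strip_of_rho.const_mul C).add hw2) (fun n => ae_of_all _ fun p => ?_)
    (ae_of_all _ fun p => ?_)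
  · have := hc (n + 1)
    exact (Continuous.aestronglyMeasurable (by fun_prop)).mul hw.conj.aestronglyMeasurable
  · rw [norm_mul, norm_mul, norm_quasiMode, mul_one, RCLike.norm_conj]
    have h1 := hC (n + 1) p.1 (by linarith [n.cast_nonneg (α := ℝ)])
    nlinarith [sq_nonneg (‖cutoffError q (n + 1) p.1‖ - ‖w p‖), sq_nonneg ‖w p‖,
      sq_nonneg ‖cutoffError q (n + 1) p.1‖]
  · refine tendsto_const_nhds.congr' ?_
    obtain ⟨N, hN⟩ := exists_nat_gt |p.1|
    filter_upwards [eventually_ge_atTop N] with n hn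
    have : (N : ℝ) ≤ n := by exact_mod_cast hn
    rw [cutoffError_eq_zero (by positivity) (Or.inl (by linarith)), zero_mul, zero_mul]

end

/-! ### Outgoing profiles and their energy flux -/

section

variable {f : ℝ × ℝ → ℝ} {X β ε μ : ℝ}

theorem deriv_exp_mul (c k : ℂ) (x : ℝ) :
    HasDerivAt (fun x : ℝ => c * Complex.exp (k * x)) (k * (c * Complex.exp (k * x))) x := by
  refine ((hasDerivAt_exp_mul k x).const_mul c).congr_deriv ?_
  ring

/-- Outside `[-1, 1]` the profile of an outgoing wave is a multiple of `e^{ik|x|}`. -/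
theorem farProfile_outgoing (k : ℝ) (r t : ℂ) {x : ℝ} :
    (1 < x → farProfile k 0 r t x = t * Complex.exp (Complex.I * k * x) ∧
      deriv (farProfile k 0 r t) x = Complex.I * k * farProfile k 0 r t x) ∧
    (x < -1 → farProfile k 0 r t x = r * Complex.exp (-Complex.I * k * x) ∧
      deriv (farProfile k 0 r t) x = -Complex.I * k * farProfile k 0 r t x) := by
  constructor
  · intro hx
    have e := farProfile_of_ge k 0 r t hx.le
    refine ⟨e, ?_⟩
    have he : farProfile k 0 r t =ᶠ[𝓝 x] fun y : ℝ => t * Complex.exp (Complex.I * k * y) := by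
      filter_upwards [lt_mem_nhds hx] with y hy
      exact farProfile_of_ge k 0 r t hy.le
    rw [he.deriv_eq, (deriv_exp_mul t (Complex.I * k) x).deriv, e]
  · intro hx
    have e : ∀ y : ℝ, y < -1 → farProfile k 0 r t y = r * Complex.exp (-Complex.I * k * y) :=
      fun y hy => by rw [farProfile_of_le k 0 r t hy.le, zero_mul, zero_add]
    refine ⟨e x hx, ?_⟩
    have he : farProfile k 0 r t =ᶠ[𝓝 x] fun y : ℝ => r * Complex.exp (-Complex.I * k * y) := by
      filter_upwards [gt_mem_nhds hx] with y hy
      exact e y hy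
    rw [he.deriv_eq, (deriv_exp_mul r (-Complex.I * k) x).deriv, e x hx]

theorem deriv_deriv_farProfile (k : ℝ) (r t : ℂ) {x : ℝ} (hx : 1 < |x|) :
    deriv (deriv (farProfile k 0 r t)) x = -(k : ℂ) ^ 2 * farProfile k 0 r t x := by
  have hI := Complex.I_mul_I
  rcases lt_abs.mp hx with hx | hx
  · have he : deriv (farProfile k 0 r t) =ᶠ[𝓝 x] fun y => Complex.I * k * farProfile k 0 r t y := by
      filter_upwards [lt_mem_nhds hx] with y hy
      exact ((farProfile_outgoing k r t).1 hy).2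
    rw [he.deriv_eq, deriv_const_mul_field, ((farProfile_outgoing k r t).1 hx).2]
    linear_combination ((k : ℂ) ^ 2 * farProfile k 0 r t x) * hI
  · have hx' : x < -1 := by linarith
    have he : deriv (farProfile k 0 r t) =ᶠ[𝓝 x] fun y => -Complex.I * k * farProfile k 0 r t y := by
      filter_upwards [gt_mem_nhds hx'] with y hy
      exact ((farProfile_outgoing k r t).2 hy).2
    rw [he.deriv_eq, deriv_const_mul_field, ((farProfile_outgoing k r t).2 hx').2]
    linear_combination ((k : ℂ) ^ 2 * farProfile k 0 r t x) * hI

theorem exists_farProfile_bound (k : ℝ) (r t : ℂ) :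
    ∃ B, ∀ x, ‖farProfile k 0 r t x‖ ≤ B ∧ ‖deriv (farProfile k 0 r t) x‖ ≤ B := by
  have hs := contDiff_farProfile k 0 r t
  have hc := hs.continuous
  have hc' := hs.continuous_deriv (by simp)
  obtain ⟨B₁, h1⟩ := isCompact_Icc.exists_bound_of_continuousOn (s := Icc (-1 : ℝ) 1) hc.continuousOn
  obtain ⟨B₂, h2⟩ := isCompact_Icc.exists_bound_of_continuousOn (s := Icc (-1 : ℝ) 1) hc'.continuousOn
  set A := ‖r‖ + ‖t‖
  have hA : 0 ≤ A := by positivity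
  have hr : ‖r‖ ≤ A := le_add_of_nonneg_right (norm_nonneg _)
  have ht : ‖t‖ ≤ A := le_add_of_nonneg_left (norm_nonneg _)
  have hout : ∀ x, 1 < |x| → ‖farProfile k 0 r t x‖ ≤ A ∧
      ‖deriv (farProfile k 0 r t) x‖ ≤ |k| * A := fun x hx => by
    rcases lt_abs.mp hx with hx | hx
    · obtain ⟨e, e'⟩ := (farProfile_outgoing k r t).1 hx
      have hn : ‖farProfile k 0 r t x‖ ≤ A := by
        rw [e, norm_mul, show Complex.I * k * x = ((k * x : ℝ) : ℂ) * Complex.I by push_cast; ring,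
          Complex.norm_exp_ofReal_mul_I, mul_one]
        exact ht
      refine ⟨hn, ?_⟩
      rw [e', norm_mul, norm_mul, Complex.norm_I, one_mul, Complex.norm_real, Real.norm_eq_abs]
      gcongr
    · obtain ⟨e, e'⟩ := (farProfile_outgoing k r t).2 (show x < -1 by linarith)
      have hn : ‖farProfile k 0 r t x‖ ≤ A := by
        rw [e, norm_mul, show -Complex.I * k * x = ((-k * x : ℝ) : ℂ) * Complex.I by push_cast; ring,
          Complex.norm_exp_ofReal_mul_I, mul_one]
        exact hr
      refine ⟨hn, ?_⟩
      rw [e', norm_mul, norm_mul, norm_neg, Complex.norm_I, one_mul, Complex.norm_real,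
        Real.norm_eq_abs]
      gcongr
  have hB₁ : 0 ≤ B₁ := (norm_nonneg _).trans (h1 0 (by simp))
  have hB₂ : 0 ≤ B₂ := (norm_nonneg _).trans (h2 0 (by simp))
  have hkA : 0 ≤ |k| * A := by positivity
  refine ⟨B₁ + B₂ + A + |k| * A, fun x => ?_⟩
  rcases le_or_gt |x| 1 with hx | hx
  · have hx' : x ∈ Icc (-1 : ℝ) 1 := abs_le.mp hx
    exact ⟨by linarith [h1 x hx'], by linarith [h2 x hx']⟩
  · exact ⟨by linarith [hout x hx], by linarith [hout x hx]⟩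

theorem conj_exp_I (k x : ℝ) : conj (Complex.exp (Complex.I * k * x)) = Complex.exp (-Complex.I * k * x) := by
  rw [← Complex.exp_conj]
  simp

theorem farProfile_mul_conj (k : ℝ) (r t : ℂ) {x : ℝ} :
    (1 < x → farProfile k 0 r t x * conj (farProfile k 0 r t x) = t * conj t) ∧
      (x < -1 → farProfile k 0 r t x * conj (farProfile k 0 r t x) = r * conj r) := by
  have h : Complex.exp (Complex.I * k * x) * Complex.exp (-Complex.I * k * x) = 1 := by
    rw [← Complex.exp_add]
    simp
  constructor <;> intro hx
  · rw [((farProfile_outgoing k r t).1 hx).1, map_mul, conj_exp_I]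
    linear_combination (t * conj t) * h
  · rw [((farProfile_outgoing k r t).2 hx).1, map_mul, ← conj_exp_I, Complex.conj_conj, conj_exp_I]
    linear_combination (r * conj r) * h

/-- The flux identity `∫ (q'' q̄ - q q̄'') dx = 2ik (|r|² + |t|²)`. -/
theorem integral_flux (k : ℝ) (r t : ℂ) :
    ∫ x, (deriv (deriv (farProfile k 0 r t)) x * conj (farProfile k 0 r t x) -
        farProfile k 0 r t x * conj (deriv (deriv (farProfile k 0 r t)) x)) =
      2 * Complex.I * k * (r * conj r + t * conj t) := by
  have hs := contDiff_farProfile k 0 r t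
  set q := farProfile k 0 r t with hq
  have hs' : ContDiff ℝ ∞ (deriv q) := hs.deriv'
  have h1 : ∀ x, HasDerivAt q (deriv q x) x := fun x => (hs.differentiable (by simp) x).hasDerivAt
  have h2 : ∀ x, HasDerivAt (deriv q) (deriv (deriv q) x) x := fun x =>
    (hs'.differentiable (by simp) x).hasDerivAt
  have hF : ∀ x, HasDerivAt (fun x => deriv q x * conj (q x) - q x * conj (deriv q x))
      (deriv (deriv q) x * conj (q x) - q x * conj (deriv (deriv q) x)) x := fun x => by
    have c1 : HasDerivAt (fun x => conj (q x)) (conj (deriv q x)) x := (h1 x).star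
    have c2 : HasDerivAt (fun x => conj (deriv q x)) (conj (deriv (deriv q) x)) x := (h2 x).star
    refine (((h2 x).mul c1).sub ((h1 x).mul c2)).congr_deriv ?_
    ring
  have k1 := hs.continuous
  have k2 := hs'.continuous_deriv (by simp)
  -- Where `q'' = -k²q` with real `k` the integrand cancels, so the integral over the line is the
  -- difference of the Wronskian `q' q̄ - q q̄'` at `±2`.
  have hsupp : Function.support (fun x => deriv (deriv q) x * conj (q x) -
      q x * conj (deriv (deriv q) x)) ⊆ Ioc (-2) 2 := by
    intro x hx
    by_contra hn
    refine hx ?_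
    have hx1 : 1 < |x| := by
      by_contra h
      have := abs_le.mp (not_lt.mp h)
      exact hn ⟨by linarith [this.1], by linarith [this.2]⟩
    simp only [hq, deriv_deriv_farProfile k r t hx1]
    rw [map_mul, map_neg, map_pow, Complex.conj_ofReal]
    ring
  rw [← intervalIntegral.integral_eq_integral_of_support_subset hsupp,
    intervalIntegral.integral_eq_sub_of_hasDerivAt (fun x _ => hF x)
      (Continuous.intervalIntegrable (by fun_prop) _ _)]
  have a1 := (farProfile_outgoing k r t (x := 2)).1 (by norm_num)
  have a2 := (farProfile_outgoing k r t (x := -2)).2 (by norm_num)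
  have b1 := (farProfile_mul_conj k r t (x := 2)).1 (by norm_num)
  have b2 := (farProfile_mul_conj k r t (x := -2)).2 (by norm_num)
  rw [← hq] at a1 a2 b1 b2
  rw [a1.2, a2.2]
  simp only [map_mul, map_neg, Complex.conj_I, Complex.conj_ofReal]
  linear_combination (2 * Complex.I * k) * b1 + (2 * Complex.I * k) * b2

/-- Green's formula holds for test functions, and all three pairings are continuous in the norm in
which `w` is approximated. -/
theorem MemH1.pairing_mode {w wx wy : ℝ × ℝ → ℂ} (hw : MemH1 β w wx wy) {Q Q₁ Q₂ : ℝ → ℂ} {N : ℝ}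
    (hQ : ∀ x, HasDerivAt Q (Q₁ x) x) (hQ₁ : ∀ x, HasDerivAt Q₁ (Q₂ x) x) (hQ₂ : Continuous Q₂)
    (hN : ∀ x, N < |x| → Q x = 0 ∧ Q₁ x = 0 ∧ Q₂ x = 0) :
    pairing (fun p => Q₁ p.1 * quasiMode β 0 p.2) wx +
        pairing (fun p => Complex.I * (β + (0 : ℤ)) * Q p.1 * quasiMode β 0 p.2) wy =
      pairing (fun p => ((β + (0 : ℤ)) ^ 2 * Q p.1 - Q₂ p.1) * quasiMode β 0 p.2) w := by
  have c0 : Continuous Q := continuous_iff_continuousAt.mpr fun x => (hQ x).continuousAt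
  have c1 : Continuous Q₁ := continuous_iff_continuousAt.mpr fun x => (hQ₁ x).continuousAt
  have hm := continuous_quasiMode β 0
  obtain ⟨φ, hφ, l0, l1, l2⟩ := hw.approx
  have m0 : MemL2 fun p => ((β + (0 : ℤ)) ^ 2 * Q p.1 - Q₂ p.1) * quasiMode β 0 p.2 :=
    memL2_of_vanish (L := N) (by fun_prop) fun p _ hp => by simp [hN p.1 hp]
  have m1 : MemL2 fun p => Q₁ p.1 * quasiMode β 0 p.2 :=
    memL2_of_vanish (L := N) (by fun_prop) fun p _ hp => by simp [hN p.1 hp]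
  have m2 : MemL2 fun p => Complex.I * (β + (0 : ℤ)) * Q p.1 * quasiMode β 0 p.2 :=
    memL2_of_vanish (L := N) (by fun_prop) fun p _ hp => by simp [hN p.1 hp]
  have t1 := (tendsto_pairing m1 hw.memLp_dx (fun k => (hφ k).memL2.2.1) l1).add
    (tendsto_pairing m2 hw.memLp_dy (fun k => (hφ k).memL2.2.2) l2)
  have t0 := tendsto_pairing m0 hw.memLp (fun k => (hφ k).memL2.1) l0
  refine tendsto_nhds_unique t1 (t0.congr fun k => ?_)
  have := integral_strip_mode (hφ k) hQ hQ₁ hQ₂ 0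
  unfold pairing
  rw [← this, ← integral_add (m1.integrable_mul_conj (hφ k).memL2.2.1)
    (m2.integrable_mul_conj (hφ k).memL2.2.2)]

end

/-! ### Uniqueness through conservation of flux -/

section

variable {f : ℝ × ℝ → ℝ} {X β ε μ : ℝ}

/-- `∂_x² q - β² q + V q` times the propagating mode. -/
def profileSource (β : ℝ) (V : ℝ × ℝ → ℝ) (Q Q₂ : ℝ → ℂ) (p : ℝ × ℝ) : ℂ :=
  (Q₂ p.1 - (β + (0 : ℤ)) ^ 2 * Q p.1 + V p * Q p.1) * quasiMode β 0 p.2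

/-- An outgoing wave that satisfies the homogeneous equation up to a function in `H_1^β` carries no
energy to infinity. -/
theorem eq_zero_of_outgoing {k : ℝ} (hk : 0 < k) {r t : ℂ} {V : ℝ × ℝ → ℝ} (hV : Continuous V)
    {M : ℝ} (hM : ∀ p, |V p| ≤ M) {Y : ℝ} (hY : ∀ p : ℝ × ℝ, Y < |p.1| → V p = k ^ 2 + β ^ 2)
    {w wx wy : ℝ × ℝ → ℂ} (hw : MemH1 β w wx wy)
    (hweak : ∀ Φ, IsTestFunction β Φ → pairing wx (dX Φ) + pairing wy (dY Φ) =
      pairing (fun p => V p * w p) Φ +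
        pairing (profileSource β V (farProfile k 0 r t) (deriv (deriv (farProfile k 0 r t)))) Φ) :
    r = 0 ∧ t = 0 := by
  have hs := contDiff_farProfile k 0 r t
  obtain ⟨B, hB⟩ := exists_farProfile_bound k r t
  have hout := fun x => deriv_deriv_farProfile k r t (x := x)
  have hflux := integral_flux k r t
  set q := farProfile k 0 r t with hq
  have hs' : ContDiff ℝ ∞ (deriv q) := hs.deriv'
  have d1 : ∀ x, HasDerivAt q (deriv q x) x := fun x => (hs.differentiable (by simp) x).hasDerivAt
  have d2 : ∀ x, HasDerivAt (deriv q) (deriv (deriv q) x) x := fun x =>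
    (hs'.differentiable (by simp) x).hasDerivAt
  have c0 := hs.continuous
  have c2 := hs'.continuous_deriv (by simp)
  have hm := continuous_quasiMode β 0
  have hVc : Continuous fun p => (V p : ℂ) := Complex.continuous_ofReal.comp hV
  set g := profileSource β V q (deriv (deriv q)) with hg
  have hgc : Continuous g := by
    rw [hg]
    unfold profileSource
    fun_prop
  have hg0 : ∀ p : ℝ × ℝ, max Y 1 < |p.1| → g p = 0 := fun p hp => by
    have e := hY p ((le_max_left _ _).trans_lt hp)
    simp only [hg, profileSource, hout p.1 ((le_max_right _ _).trans_lt hp), e]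
    push_cast
    ring
  have hgm : MemL2 g := memL2_of_vanish (L := max Y 1) hgc fun p _ hp => hg0 p hp
  have hVw : MemL2 fun p => V p * w p := MemL2.bounded_mul hw.memLp hV hM
  -- the pairing of the source with `w` is real
  have hreal : pairing w g = pairing g w := by
    obtain ⟨φ, hφ, l0, l1, l2⟩ := hw.approx
    have t1 := (tendsto_pairing hw.memLp_dx hw.memLp_dx (fun k => (hφ k).memL2.2.1) l1).add
      (tendsto_pairing hw.memLp_dy hw.memLp_dy (fun k => (hφ k).memL2.2.2) l2)
    have t2 := (tendsto_pairing hVw hw.memLp (fun k => (hφ k).memL2.1) l0).add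
      (tendsto_pairing hgm hw.memLp (fun k => (hφ k).memL2.1) l0)
    have e := tendsto_nhds_unique t1 (t2.congr fun k => (hweak _ (hφ k)).symm)
    rw [← conj_pairing, show pairing g w = pairing wx wx + pairing wy wy -
      pairing (fun p => V p * w p) w by rw [e]; ring, map_sub, map_add, conj_pairing, conj_pairing,
      conj_pairing, ← pairing_real_mul]
  set P : ℝ × ℝ → ℂ := fun p => q p.1 * quasiMode β 0 p.2 with hP
  set e : ℕ → ℂ := fun n => pairing (fun p => cutoffError q (n + 1) p.1 * quasiMode β 0 p.2) w with he
  -- Testing with the cut-off profile and applying Green's formula to `w` gives `conj ⟨g,P⟩ =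
  -- -(⟨g,w⟩ + e_n)`. As `⟨g,w⟩` is real, the imaginary part of `⟨g,P⟩` equals that of the
  -- commutator error `e_n`, which tends to zero as the cut-off radius grows.
  have hcut : ∀ n : ℕ, max Y 1 ≤ (n + 1 : ℝ) →
      pairing g P - conj (pairing g P) = e n - conj (e n) := by
    intro n hn
    have hL : (0 : ℝ) < n + 1 := by positivity
    generalize hLn : (n + 1 : ℝ) = L at hn hL
    let Q : ℝ → ℂ := fun x => (cutoff L x : ℂ) * q x
    let Q₁ : ℝ → ℂ := fun x => ((deriv cutoffBump (x / L) / L : ℝ) : ℂ) * q x +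
      (cutoff L x : ℂ) * deriv q x
    let Q₂ : ℝ → ℂ := fun x => cutoffError q L x + (cutoff L x : ℂ) * deriv (deriv q) x
    have hce := continuous_cutoffError hs L
    have hcc : Continuous (cutoff L) := (contDiff_cutoff L).continuous
    have hQ : ∀ x, HasDerivAt Q (Q₁ x) x := fun x => (hasDerivAt_cutoff L x).ofReal_comp.mul (d1 x)
    have hQ₁ : ∀ x, HasDerivAt Q₁ (Q₂ x) x := fun x => by
      refine (((hasDerivAt_deriv_cutoff L x).ofReal_comp.mul (d1 x)).add
        ((hasDerivAt_cutoff L x).ofReal_comp.mul (d2 x))).congr_deriv ?_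
      simp only [Q₂, cutoffError]
      ring
    have hQ₂ : Continuous Q₂ := by fun_prop
    have hQs : ContDiff ℝ ∞ Q := (Complex.ofRealCLM.contDiff.comp (contDiff_cutoff L)).mul hs
    have hN : ∀ x, 2 * L < |x| → Q x = 0 ∧ Q₁ x = 0 ∧ Q₂ x = 0 := fun x hx => by
      have a1 := cutoff_eq_zero hL hx.le
      have a2 := cutoffError_eq_zero (q := q) hL (Or.inr hx)
      have a3 : deriv cutoffBump (x / L) = 0 := (deriv_cutoffBump_eq_zero_of_gt
        (by rwa [abs_div, abs_of_pos hL, lt_div_iff₀ hL])).1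
      simp only [Q, Q₁, Q₂, a1, a2, a3]
      simp
    have hT : IsTestFunction β fun p => Q p.1 * quasiMode β 0 p.2 :=
      isTestFunction_mode hQs (N := 2 * L)
        (fun x hx => by simp only [Q, cutoff_eq_zero hL hx, Complex.ofReal_zero, zero_mul]) 0
    have hI := hw.pairing_mode hQ hQ₁ hQ₂ hN
    have hW := hweak _ hT
    have eX : dX (fun p => Q p.1 * quasiMode β 0 p.2) = fun p => Q₁ p.1 * quasiMode β 0 p.2 :=
      funext fun p => (hasFDerivAt_mode (β := β) 0 (hQ p.1)).1
    have eY : dY (fun p => Q p.1 * quasiMode β 0 p.2) =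
        fun p => Complex.I * (β + (0 : ℤ)) * Q p.1 * quasiMode β 0 p.2 :=
      funext fun p => (hasFDerivAt_mode (β := β) 0 (hQ p.1)).2.1
    rw [eX, eY] at hW
    have hW' := congrArg conj hW
    rw [map_add, map_add, conj_pairing, conj_pairing, conj_pairing, hI, ← pairing_real_mul] at hW'
    have mQ : MemL2 fun p => V p * (Q p.1 * quasiMode β 0 p.2) := hT.memL2.1.bounded_mul hV hM
    have mE : MemL2 fun p => cutoffError q L p.1 * quasiMode β 0 p.2 :=
      memL2_of_vanish (L := 2 * L) (by fun_prop) fun p _ hp => by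
        rw [cutoffError_eq_zero hL (Or.inr hp), zero_mul]
    have c0' : Continuous Q := continuous_iff_continuousAt.mpr fun x => (hQ x).continuousAt
    have mI : MemL2 fun p => ((β + (0 : ℤ)) ^ 2 * Q p.1 - Q₂ p.1) * quasiMode β 0 p.2 :=
      memL2_of_vanish (L := 2 * L) (by fun_prop) fun p _ hp => by simp [hN p.1 hp]
    have hcg : ∀ p : ℝ × ℝ, (cutoff L p.1 : ℂ) * g p = g p := fun p => by
      rcases le_or_gt |p.1| L with hx | hx
      · rw [cutoff_eq_one hL hx, Complex.ofReal_one, one_mul]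
      · rw [hg0 p (hn.trans_lt hx), mul_zero]
    have s1 : pairing (fun p => V p * (Q p.1 * quasiMode β 0 p.2)) w -
        pairing (fun p => ((β + (0 : ℤ)) ^ 2 * Q p.1 - Q₂ p.1) * quasiMode β 0 p.2) w =
        pairing g w + pairing (fun p => cutoffError q L p.1 * quasiMode β 0 p.2) w := by
      rw [← pairing_sub mQ mI hw.memLp, ← pairing_add hgm mE hw.memLp]
      congr 1
      funext p
      rw [← hcg p]
      simp only [hg, profileSource, Q, Q₂]
      ring
    have s2 : pairing g (fun p => Q p.1 * quasiMode β 0 p.2) = pairing g P := by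
      have := pairing_real_mul (fun p => cutoff L p.1) g P
      simp only [hcg] at this
      rw [show (fun p => g p) = g from rfl] at this
      rw [this]
      congr 1
      funext p
      simp only [Q, hP]
      ring
    rw [s2] at hW
    have hen : e n = pairing (fun p => cutoffError q L p.1 * quasiMode β 0 p.2) w := by
      simp only [he, hLn]
    have h3 : conj (pairing g P) = -(pairing g w + e n) := by
      have h4 := congrArg conj hW
      rw [map_add, map_add, conj_pairing, conj_pairing, hI, conj_pairing, ← pairing_real_mul] at h4
      rw [hen]
      linear_combination -h4 - s1
    have h5 := congrArg conj h3
    rw [Complex.conj_conj, map_neg, map_add, conj_pairing, hreal] at h5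
    linear_combination h5 - h3
  have hzero : pairing g P - conj (pairing g P) = 0 := by
    have hlim := tendsto_pairing_cutoffError (β := β) hs hB hw.memLp
    have hlim' := hlim.sub ((Complex.continuous_conj.tendsto _).comp hlim)
    simp only [map_zero, sub_zero] at hlim'
    refine tendsto_nhds_unique (tendsto_const_nhds.congr' ?_) hlim'
    obtain ⟨N, hN⟩ := exists_nat_gt (max Y 1)
    filter_upwards [eventually_ge_atTop N] with n hn
    have : (N : ℝ) ≤ n := by exact_mod_cast hn
    exact hcut n (by linarith)
  have hPc : Continuous P := by fun_prop
  have i1 : Integrable (fun p => g p * conj (P p)) (volume.restrict strip) :=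
    integrableOn_strip (L := max Y 1) (by fun_prop) fun p _ hp => by rw [hg0 p hp, zero_mul]
  have i2 : Integrable (fun p => P p * conj (g p)) (volume.restrict strip) :=
    integrableOn_strip (L := max Y 1) (by fun_prop) fun p _ hp => by rw [hg0 p hp, map_zero, mul_zero]
  rw [conj_pairing] at hzero
  unfold pairing at hzero
  rw [← integral_sub i1 i2, restrict_strip] at hzero
  -- The terms with real coefficients cancel and the transversal mode has modulus one, so only the
  -- one-dimensional flux density is left.
  have hint : (fun p : ℝ × ℝ => g p * conj (P p) - P p * conj (g p)) =
      fun p => (fun x => deriv (deriv q) x * conj (q x) - q x * conj (deriv (deriv q) x)) p.1 := by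
    funext p
    have hn : quasiMode β 0 p.2 * conj (quasiMode β 0 p.2) = 1 := by
      rw [Complex.mul_conj, Complex.normSq_eq_norm_sq, norm_quasiMode]
      simp
    simp only [hg, hP, profileSource, map_mul, map_add, map_sub, Complex.conj_ofReal, map_pow,
      Int.cast_zero, map_zero]
    linear_combination (deriv (deriv q) p.1 * conj (q p.1) - q p.1 * conj (deriv (deriv q) p.1)) * hn
  have hfst := integral_fun_fst (μ := volume) (ν := volume.restrict (Ioo (0 : ℝ) (2 * Real.pi)))
    fun x => deriv (deriv q) x * conj (q x) - q x * conj (deriv (deriv q) x)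
  rw [hint, hfst, hflux] at hzero
  have hpi : (volume.restrict (Ioo (0 : ℝ) (2 * Real.pi))).real univ ≠ 0 := by
    rw [Measure.real, Measure.restrict_apply_univ, Real.volume_Ioo, sub_zero,
      ENNReal.toReal_ofReal Real.two_pi_pos.le]
    exact Real.two_pi_pos.ne'
  rw [smul_eq_zero, or_iff_right hpi] at hzero
  have hk' : (2 * Complex.I * k : ℂ) ≠ 0 := by
    simp [hk.ne']
  have hsum := (mul_eq_zero.mp hzero).resolve_left hk'
  rw [Complex.mul_conj, Complex.mul_conj, ← Complex.ofReal_add, Complex.ofReal_eq_zero] at hsum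
  have n1 := Complex.normSq_nonneg r
  have n2 := Complex.normSq_nonneg t
  exact ⟨Complex.normSq_eq_zero.mp (by linarith), Complex.normSq_eq_zero.mp (by linarith)⟩

/-- The potential `ω² (1 + ε f)`. -/
def potential (f : ℝ × ℝ → ℝ) (β ε μ : ℝ) (p : ℝ × ℝ) : ℝ := omegaSq β μ * (1 + ε * f p)

/-- Green's formula moves the far field, which has infinite energy, to the right-hand side. The
remainder then satisfies an equation in the energy space, and two such equations can be subtracted.
-/
theorem weak_identity (hf : IsPerturbation f X) {R T : ℂ} {Ψ Ψx Ψy : ℝ × ℝ → ℂ}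
    (h : IsScatteringSolution f β ε μ R T Ψ Ψx Ψy) {Φ : ℝ × ℝ → ℂ} (hΦ : IsTestFunction β Φ) :
    pairing (fun p => Ψx p - dX (farField β μ R T) p) (dX Φ) +
        pairing (fun p => Ψy p - dY (farField β μ R T) p) (dY Φ) =
      pairing (fun p => potential f β ε μ p * (Ψ p - farField β μ R T p)) Φ +
        pairing (profileSource β (potential f β ε μ) (farProfile (waveNumber β μ) 1 R T)
          (deriv (deriv (farProfile (waveNumber β μ) 1 R T)))) Φ := by
  have hs := contDiff_farProfile (waveNumber β μ) 1 R T
  have hfar := farField_eq β μ R T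
  set q := farProfile (waveNumber β μ) 1 R T with hq
  have hs' : ContDiff ℝ ∞ (deriv q) := hs.deriv'
  have d1 : ∀ x, HasDerivAt q (deriv q x) x := fun x => (hs.differentiable (by simp) x).hasDerivAt
  have d2 : ∀ x, HasDerivAt (deriv q) (deriv (deriv q) x) x := fun x =>
    (hs'.differentiable (by simp) x).hasDerivAt
  have c0 := hs.continuous
  have c1 := hs'.continuous
  have c2 := hs'.continuous_deriv (by simp)
  have hm := continuous_quasiMode β 0
  have hfc := hf.smooth.continuous
  have eX : dX (farField β μ R T) = fun p => deriv q p.1 * quasiMode β 0 p.2 := by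
    rw [hfar]
    exact funext fun p => (hasFDerivAt_mode (β := β) 0 (d1 p.1)).1
  have eY : dY (farField β μ R T) = fun p => Complex.I * (β + (0 : ℤ)) * q p.1 * quasiMode β 0 p.2 := by
    rw [hfar]
    exact funext fun p => (hasFDerivAt_mode (β := β) 0 (d1 p.1)).2.1
  have hI := integral_strip_mode hΦ d1 d2 c2 0
  have hid := h.identity Φ hΦ
  obtain ⟨rm, rmx, rmy⟩ := (⟨h.remainder.memLp, h.remainder.memLp_dx, h.remainder.memLp_dy⟩ :
    MemL2 _ ∧ MemL2 _ ∧ MemL2 _)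
  obtain ⟨L, hL0, -, hv⟩ := hΦ.exists_vanish
  obtain ⟨p0, p1, p2⟩ := hΦ.memL2
  have hΦc := hΦ.smooth.continuous
  have hXc := hΦ.continuous_dX
  have hYc := hΦ.continuous_dY
  have hpc : Continuous (potential f β ε μ) := by
    unfold potential
    fun_prop
  have hpc' : Continuous fun p => (potential f β ε μ p : ℂ) := Complex.continuous_ofReal.comp hpc
  obtain ⟨M, hM⟩ := hf.exists_bound
  have hVb : ∀ p, |potential f β ε μ p| ≤ |omegaSq β μ| * (1 + |ε| * M) := fun p => by
    unfold potential
    rw [abs_mul]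
    gcongr
    refine (abs_add_le _ _).trans ?_
    rw [abs_one, abs_mul]
    gcongr
    exact hM p
  have mV := rm.bounded_mul hpc hVb
  have i1 : IntegrableOn (fun p => deriv q p.1 * quasiMode β 0 p.2 * conj (dX Φ p) +
      Complex.I * (β + (0 : ℤ)) * q p.1 * quasiMode β 0 p.2 * conj (dY Φ p)) strip :=
    integrableOn_strip (L := L) (by fun_prop) fun p hp hpL => by
      rw [(hv p hp hpL).2.1, (hv p hp hpL).2.2]
      simp
  have i2 : IntegrableOn (fun p => (potential f β ε μ p : ℂ) * farField β μ R T p * conj (Φ p)) strip := by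
    rw [hfar]
    refine integrableOn_strip (L := L) (by fun_prop) fun p hp hpL => ?_
    rw [(hv p hp hpL).1]
    simp
  have i3 : IntegrableOn (fun p => profileSource β (potential f β ε μ) q (deriv (deriv q)) p *
      conj (Φ p)) strip := by
    unfold profileSource
    refine integrableOn_strip (L := L) (by fun_prop) fun p hp hpL => ?_
    rw [(hv p hp hpL).1]
    simp
  have j1 := (rmx.integrable_mul_conj p1).add (rmy.integrable_mul_conj p2)
  have j2 := mV.integrable_mul_conj p0
  have e1 := integral_add j1 i1
  have e2 := integral_add j2 i2
  have e3 : ∫ p in strip, ((β + (0 : ℤ)) ^ 2 * q p.1 - deriv (deriv q) p.1) * quasiMode β 0 p.2 *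
      conj (Φ p) = (∫ p in strip, (potential f β ε μ p : ℂ) * farField β μ R T p * conj (Φ p)) -
      ∫ p in strip, profileSource β (potential f β ε μ) q (deriv (deriv q)) p * conj (Φ p) := by
    rw [← integral_sub i2 i3]
    congr 1
    funext p
    rw [hfar, profileSource]
    ring
  have e4 := integral_add (rmx.integrable_mul_conj p1) (rmy.integrable_mul_conj p2)
  rw [← integral_const_mul] at hid
  have hl : ∫ p in strip, (Ψx p * conj (dX Φ p) + Ψy p * conj (dY Φ p)) =
      ∫ p in strip, (((fun p => (Ψx p - dX (farField β μ R T) p) * conj (dX Φ p)) +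
        (fun p => (Ψy p - dY (farField β μ R T) p) * conj (dY Φ p))) p +
        (deriv q p.1 * quasiMode β 0 p.2 * conj (dX Φ p) +
      Complex.I * (β + (0 : ℤ)) * q p.1 * quasiMode β 0 p.2 * conj (dY Φ p))) := by
    congr 1
    funext p
    rw [Pi.add_apply, eX, eY]
    ring
  have hr : ∫ p in strip, (omegaSq β μ : ℂ) * ((1 + (ε : ℂ) * (f p : ℂ)) * Ψ p * conj (Φ p)) =
      ∫ p in strip, ((potential f β ε μ p : ℂ) * (Ψ p - farField β μ R T p) * conj (Φ p) +
        (potential f β ε μ p : ℂ) * farField β μ R T p * conj (Φ p)) := by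
    congr 1
    funext p
    rw [potential]
    push_cast
    ring
  have e1' := hl.trans e1
  have e2' := hr.trans e2
  have e4' : ∫ p in strip, ((fun p => (Ψx p - dX (farField β μ R T) p) * conj (dX Φ p)) +
        (fun p => (Ψy p - dY (farField β μ R T) p) * conj (dY Φ p))) p =
      pairing (fun p => Ψx p - dX (farField β μ R T) p) (dX Φ) +
        pairing (fun p => Ψy p - dY (farField β μ R T) p) (dY Φ) := e4
  rw [e4', hI, e3] at e1'
  refine Eq.trans ?_ (rfl : (∫ p in strip, (potential f β ε μ p : ℂ) *
    (Ψ p - farField β μ R T p) * conj (Φ p)) +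
    (∫ p in strip, profileSource β (potential f β ε μ) q (deriv (deriv q)) p * conj (Φ p)) = _)
  linear_combination hid - e1' + e2'

/-- The reflection and transmission coefficients are unique. -/
theorem AreScatteringCoefficients.unique (hf : IsPerturbation f X) (h0 : 0 < β) (h1 : β < 1 / 2)
    (hμ0 : 0 < μ) (hμ : μ ≤ muMax β) {R T R' T' : ℂ} (h : AreScatteringCoefficients f β ε μ R T)
    (h' : AreScatteringCoefficients f β ε μ R' T') : R = R' ∧ T = T' := by
  obtain ⟨Ψ, Ψx, Ψy, hΨ⟩ := h
  obtain ⟨Θ, Θx, Θy, hΘ⟩ := h'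
  have hk := waveNumber_pos h0 h1 hμ0.le hμ
  have hk2 := waveNumber_sq h0 h1 hμ0.le hμ
  have hfc := hf.smooth.continuous
  have hpc : Continuous (potential f β ε μ) := by
    unfold potential
    fun_prop
  obtain ⟨M, hM⟩ := hf.exists_bound
  have hVb : ∀ p, |potential f β ε μ p| ≤ |omegaSq β μ| * (1 + |ε| * M) := fun p => by
    unfold potential
    rw [abs_mul]
    gcongr
    refine (abs_add_le _ _).trans ?_
    rw [abs_one, abs_mul]
    gcongr
    exact hM p
  set k := waveNumber β μ with hkd
  -- Both profiles have incident amplitude `1`, so their difference is purely outgoing.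
  have hlin : farProfile k 0 (R - R') (T - T') =
      fun x => farProfile k 1 R T x - farProfile k 1 R' T' x := by
    funext x
    simp only [farProfile]
    ring
  have hs := contDiff_farProfile k 1 R T
  have hs' := contDiff_farProfile k 1 R' T'
  have hlin1 : deriv (farProfile k 0 (R - R') (T - T')) =
      fun x => deriv (farProfile k 1 R T) x - deriv (farProfile k 1 R' T') x := by
    rw [hlin]
    funext x
    exact deriv_fun_sub (hs.differentiable (by simp) x) (hs'.differentiable (by simp) x)
  have hlin2 : deriv (deriv (farProfile k 0 (R - R') (T - T'))) =
      fun x => deriv (deriv (farProfile k 1 R T)) x - deriv (deriv (farProfile k 1 R' T')) x := by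
    rw [hlin1]
    funext x
    have e1 : ContDiff ℝ ∞ (deriv (farProfile k 1 R T)) := hs.deriv'
    have e2 : ContDiff ℝ ∞ (deriv (farProfile k 1 R' T')) := hs'.deriv'
    exact deriv_fun_sub (e1.differentiable (by simp) x) (e2.differentiable (by simp) x)
  have hsrc : profileSource β (potential f β ε μ) (farProfile k 0 (R - R') (T - T'))
      (deriv (deriv (farProfile k 0 (R - R') (T - T')))) = fun p =>
      profileSource β (potential f β ε μ) (farProfile k 1 R T) (deriv (deriv (farProfile k 1 R T))) p -
      profileSource β (potential f β ε μ) (farProfile k 1 R' T')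
        (deriv (deriv (farProfile k 1 R' T'))) p := by
    funext p
    rw [hlin2, hlin]
    simp only [profileSource]
    ring
  have hres := eq_zero_of_outgoing (r := R - R') (t := T - T') hk hpc hVb (Y := X) (fun p hp => ?_)
    (hΨ.remainder.sub hΘ.remainder) (fun Φ hΦ => ?_)
  · exact ⟨sub_eq_zero.mp hres.1, sub_eq_zero.mp hres.2⟩
  · have : f p = 0 := hf.supp p.1 p.2 hp
    rw [potential, omegaSq, this, hk2]
    ring
  · obtain ⟨p0, p1, p2⟩ := hΦ.memL2
    have a1 := pairing_sub (u := _) hΨ.remainder.memLp_dx hΘ.remainder.memLp_dx p1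
    have a2 := pairing_sub (u := _) hΨ.remainder.memLp_dy hΘ.remainder.memLp_dy p2
    have a3 := pairing_sub (MemL2.bounded_mul hΨ.remainder.memLp hpc hVb)
      (MemL2.bounded_mul hΘ.remainder.memLp hpc hVb) p0
    have w1 := weak_identity hf hΨ hΦ
    have w2 := weak_identity hf hΘ hΦ
    obtain ⟨L, hL0, -, hv⟩ := hΦ.exists_vanish
    have hΦc := hΦ.smooth.continuous
    have hm := continuous_quasiMode β 0
    have hpc' : Continuous fun p => (potential f β ε μ p : ℂ) := Complex.continuous_ofReal.comp hpc
    have hi : ∀ q : ℝ → ℂ, ContDiff ℝ ∞ q → IntegrableOn (fun p =>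
        profileSource β (potential f β ε μ) q (deriv (deriv q)) p * conj (Φ p)) strip := fun q hq => by
      have q1 : ContDiff ℝ ∞ (deriv q) := hq.deriv'
      have q0 := hq.continuous
      have q2 := q1.continuous_deriv (by simp)
      unfold profileSource
      refine integrableOn_strip (L := L) (by fun_prop) fun p hp hpL => ?_
      rw [(hv p hp hpL).1]
      simp
    have a4 : pairing (profileSource β (potential f β ε μ) (farProfile k 0 (R - R') (T - T'))
        (deriv (deriv (farProfile k 0 (R - R') (T - T'))))) Φ =
        pairing (profileSource β (potential f β ε μ) (farProfile k 1 R T)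
          (deriv (deriv (farProfile k 1 R T)))) Φ -
        pairing (profileSource β (potential f β ε μ) (farProfile k 1 R' T')
          (deriv (deriv (farProfile k 1 R' T')))) Φ := by
      rw [hsrc]
      unfold pairing
      rw [← integral_sub (hi _ hs) (hi _ hs')]
      congr 1
      funext p
      ring
    have a5 : pairing (fun p => (potential f β ε μ p : ℂ) *
        (Ψ p - farField β μ R T p - (Θ p - farField β μ R' T' p))) Φ =
        pairing (fun p => (potential f β ε μ p : ℂ) * (Ψ p - farField β μ R T p)) Φ -
        pairing (fun p => (potential f β ε μ p : ℂ) * (Θ p - farField β μ R' T' p)) Φ := by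
      rw [← a3]
      congr 1
      funext p
      ring
    rw [a1, a2, a4, a5]
    linear_combination w1 - w2

end

section

/-! ### Reduction of the scattering problem to the dispersion relation -/

variable {f : ℝ × ℝ → ℝ} {X β ε μ : ℝ}

/-- The functional `A ↦ ∫ e^{kξ} A(ξ) dξ`. -/
def expMean (X : ℝ) (k : ℂ) : C(Icc (-X) X, ℂ) →L[ℂ] ℂ :=
  LinearMap.mkContinuousOfExistsBound
    { toFun := fun A => ∫ ξ : Icc (-X) X, Complex.exp (k * (ξ : ℝ)) * A ξ ∂(intervalMeasure X)
      map_add' := fun A B => by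
        rw [← integral_add]
        · congr 1
          funext ξ
          simp [mul_add]
        · exact Continuous.integrable_of_hasCompactSupport (by fun_prop) (HasCompactSupport.of_compactSpace _)
        · exact Continuous.integrable_of_hasCompactSupport (by fun_prop) (HasCompactSupport.of_compactSpace _)
      map_smul' := fun c A => by
        rw [RingHom.id_apply, smul_eq_mul, ← integral_const_mul]
        congr 1
        funext ξ
        simp only [ContinuousMap.smul_apply, smul_eq_mul]
        ring }
    ⟨(intervalMeasure X).real univ * Real.exp (‖k‖ * |X|), fun A => by
      refine (norm_integral_le_of_norm_le_const (C := Real.exp (‖k‖ * |X|) * ‖A‖)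
        (ae_of_all _ fun ξ => ?_)).trans_eq (by ring)
      rw [norm_mul, Complex.norm_exp]
      gcongr
      · refine (Complex.re_le_norm _).trans ?_
        rw [norm_mul, Complex.norm_real]
        gcongr
        exact (abs_le.mpr ξ.2).trans (le_abs_self X)
      · exact A.norm_coe_le_norm ξ⟩

theorem expMean_apply (k : ℂ) (A : C(Icc (-X) X, ℂ)) :
    expMean X k A = ∫ ξ : Icc (-X) X, Complex.exp (k * (ξ : ℝ)) * A ξ ∂(intervalMeasure X) := rfl

theorem expMean_zero (A : C(Icc (-X) X, ℂ)) :
    expMean X 0 A = ∫ ξ : Icc (-X) X, A ξ ∂(intervalMeasure X) := by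
  rw [expMean_apply]
  simp

theorem expPrim_zeroExt (hX : 0 < X) (k : ℂ) (A : C(Icc (-X) X, ℂ)) :
    expPrim k X (zeroExt A) X = expMean X k A := by
  rw [expMean_apply, expPrim, ← integral_intervalMeasure hX fun ξ : ℝ => Complex.exp (k * ξ) * zeroExt A ξ]
  simp only [zeroExt_coe]

/-- The functional `A ↦ ∫ e^{kξ} A_m(ξ) dξ` on the sequence space. -/
def modeMean (X : ℝ) (k : ℂ) (m : ℤ) : SeqSpace X →L[ℂ] ℂ :=
  (expMean X k).comp (lp.evalCLM ℂ (fun _ : ℤ => C(Icc (-X) X, ℂ)) 2 m)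

theorem modeMean_apply (k : ℂ) (m : ℤ) (A : SeqSpace X) : modeMean X k m A = expMean X k (A m) := rfl

/-- The exponential `e^{kx}` on `[-X, X]`. -/
def expC (X : ℝ) (k : ℂ) : C(Icc (-X) X, ℂ) := ⟨fun x => Complex.exp (k * (x : ℝ)), by fun_prop⟩

/-- The sequence `(f_{m+j} e^{kx})_m`. -/
def shiftedCoef (hf : IsPerturbation f X) (j : ℤ) (k : ℂ) : SeqSpace X :=
  ⟨fun m => coefC hf (m + j) * expC X k, memℓp_shift_coefC hf j (expC X k)⟩

theorem shiftedCoef_apply (hf : IsPerturbation f X) (j : ℤ) (k : ℂ) (m : ℤ) (x : Icc (-X) X) :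
    shiftedCoef hf j k m x = fourierCoef f (m + j) x * Complex.exp (k * (x : ℝ)) := rfl

theorem reflCoef_eq (hX : 0 < X) (A : SeqSpace X) : reflCoef β ε μ A =
    Complex.I * gammaC β μ * ε / waveNumber β μ *
      modeMean X (Complex.I * waveNumber β μ) 0 A := by
  rw [reflCoef, expPrim_zeroExt hX, modeExponent, if_pos rfl, modeMean_apply]
  rcases eq_or_ne (waveNumber β μ) 0 with h | h
  · simp [h]
  have : (waveNumber β μ : ℂ) ≠ 0 := by exact_mod_cast h
  rw [neg_mul, neg_neg]
  field_simp
  linear_combination (-gammaC β μ * ε * expMean X (Complex.I * waveNumber β μ) (A 0)) * Complex.I_sq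

theorem transCoef_eq (hX : 0 < X) (A : SeqSpace X) : transCoef β ε μ A =
    1 + Complex.I * gammaC β μ * ε / waveNumber β μ *
      modeMean X (-Complex.I * waveNumber β μ) 0 A := by
  rw [transCoef, expPrim_zeroExt hX, modeExponent, if_pos rfl, modeMean_apply]
  rcases eq_or_ne (waveNumber β μ) 0 with h | h
  · simp [h]
  have : (waveNumber β μ : ℂ) ≠ 0 := by exact_mod_cast h
  field_simp
  linear_combination (-gammaC β μ * ε * expMean X (-(Complex.I * waveNumber β μ)) (A 0)) * Complex.I_sq

theorem summable_operatorT (hf : IsPerturbation f X) (h0 : 0 < β) (h1 : β < 1 / 2) {μ : ℂ}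
    (hμ : ‖μ‖ ≤ muMax β) (A : SeqSpace X) (m : ℤ) (x : Icc (-X) X) :
    Summable fun n : ℤ => (∫ ξ : Icc (-X) X, kernelH β μ n ((x : ℝ) - (ξ : ℝ)) * A n ξ
      ∂(intervalMeasure X)) * fourierCoef f (m - n) x := by
  have hX := hf.pos.le
  obtain ⟨M, hM0, hM, -⟩ := exists_kernelH_bounds h0 h1 (by positivity : 0 ≤ 2 * X)
  have hs := ((Equiv.subLeft m).summable_iff.mpr (summable_norm_fourierCoef hf x)).mul_left
    (2 * X * (M * ‖A‖))
  refine Summable.of_norm_bounded hs fun n => ?_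
  rw [norm_mul]
  refine mul_le_mul_of_nonneg_right (norm_integral_intervalMeasure_le hX fun ξ => ?_) (norm_nonneg _)
  rw [norm_mul]
  refine mul_le_mul (hM μ hμ n _ ?_) (((A n).norm_coe_le_norm ξ).trans
    (lp.norm_apply_le_norm (by norm_num) A n)) (norm_nonneg _) hM0
  rw [abs_le]
  exact ⟨by linarith [x.2.1, ξ.2.2], by linarith [x.2.2, ξ.2.1]⟩

/-- Solutions of the reduced system generate solutions of the scattering problem. -/
theorem areScatteringCoefficients_of_reduced (hf : IsPerturbation f X) (h0 : 0 < β) (h1 : β < 1 / 2)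
    (hμ0 : 0 < μ) (hμ : μ ≤ muMax β) (A : SeqSpace X) (c : ℂ)
    (hA : ∀ (m : ℤ) (x : Icc (-X) X), A m x =
      fourierCoef f m x * Complex.exp (Complex.I * waveNumber β μ * (x : ℝ)) +
        c * fourierCoef f (m + 1) x + ε * operatorT f X β μ A m x)
    (hc : c * μ = ε * (gammaC β μ * modeMean X 0 (-1) A)) :
    AreScatteringCoefficients f β ε μ (reflCoef β ε μ A) (transCoef β ε μ A) := by
  have hs : ∀ n x, X ≤ |x| → zeroExt (A n) x = 0 := fun n x hx => by
    unfold zeroExt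
    split_ifs with h
    · rw [hA, operatorT, hf.fourierCoef_eq_zero _ hx, hf.fourierCoef_eq_zero _ hx]
      simp only [hf.fourierCoef_eq_zero _ hx, mul_zero, tsum_zero, zero_mul, add_zero]
    · rfl
  refine areScatteringCoefficients_of_source hf h0 h1 hμ0 hμ A hs fun m x => ?_
  have hμ' := norm_ofReal_le_muMax hμ0.le hμ
  have hμc : (μ : ℂ) ≠ 0 := by exact_mod_cast hμ0.ne'
  have hS := (summable_operatorT hf h0 h1 hμ' A m x).hasSum.mul_left (2 * gammaC β μ * ε)
  have e0 := hasSum_ite_eq (0 : ℤ)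
    (fourierCoef f m x * Complex.exp (Complex.I * waveNumber β μ * (x : ℝ)))
  have e1 := hasSum_ite_eq (-1 : ℤ) (c * fourierCoef f (m + 1) x)
  -- The constant part of the threshold Green function contributes a multiple of `⟨A_{-1}⟩`
  -- independent of `x`; after multiplication by `2γε` it is the amplitude `c`.
  have hconv : ∀ n : ℤ, greenConv (modeExponent β μ n) X (zeroExt (A n)) x =
      (∫ ξ : Icc (-X) X, kernelH β μ n ((x : ℝ) - (ξ : ℝ)) * A n ξ ∂(intervalMeasure X)) +
        if n = -1 then 1 / (2 * (μ : ℂ)) * modeMean X 0 (-1) A else 0 := fun n => by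
    rw [greenConv_eq_integral hf.pos (hs n)]
    have hk := continuous_kernelH β μ n
    simp only [kernelH_eq_greenE h0 h1 hμ0 hμ n, add_mul]
    rw [integral_add]
    · congr 1
      rw [integral_const_mul]
      split_ifs with hn
      · rw [hn, modeMean_apply, expMean_zero]
      · rw [zero_mul]
    · exact Continuous.integrable_of_hasCompactSupport (by fun_prop)
        (HasCompactSupport.of_compactSpace _)
    · exact Continuous.integrable_of_hasCompactSupport (by fun_prop)
        (HasCompactSupport.of_compactSpace _)
  have hsum := (e0.add e1).add hS
  rw [hA, operatorT]
  refine Eq.symm (((hsum.congr_fun fun n => ?_).tsum_eq).trans ?_)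
  · rw [modeAmp, hconv]
    split_ifs with n0 n1 n1
    · omega
    · rw [n0, sub_zero]
      ring
    · rw [n1, sub_neg_eq_add]
      have : 2 * gammaC β μ * ε * (1 / (2 * (μ : ℂ)) * modeMean X 0 (-1) A) = c := by
        field_simp
        linear_combination -hc
      linear_combination fourierCoef f (m + 1) x * this
    · ring
  · ring

/-- The denominator of the scattering amplitudes. -/
def dispersion (hf : IsPerturbation f X) (β : ℝ) (T : ℂ → SeqSpace X →L[ℂ] SeqSpace X) (ε : ℝ)
    (μ : ℂ) : ℂ :=
  gammaC β μ * modeMean X 0 (-1) (solve ((ε : ℂ) • T μ) (shiftedCoef hf 1 0))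

/-- The amplitude `⟨e^{kx} A_0⟩` of the solution of the reduced system. -/
def amplitude (hf : IsPerturbation f X) (β : ℝ) (T : ℂ → SeqSpace X →L[ℂ] SeqSpace X) (ε ν : ℝ)
    (k : ℂ) : ℂ :=
  modeMean X k 0 (solve ((ε : ℂ) • T (ε * ν)) (shiftedCoef hf 0 (Complex.I * waveNumber β (ε * ν)))) +
    gammaC β (ε * ν) * modeMean X 0 (-1)
      (solve ((ε : ℂ) • T (ε * ν)) (shiftedCoef hf 0 (Complex.I * waveNumber β (ε * ν)))) /
      (ν - dispersion hf β T ε (ε * ν)) *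
    modeMean X k 0 (solve ((ε : ℂ) • T (ε * ν)) (shiftedCoef hf 1 0))

/-- By superposition `A = y₁ + c y₂`, with `y₁` driven by the incident wave and `y₂` by a constant
amplitude in mode `-1`. Self-consistency of that amplitude is the scalar equation `c (ν - γF) =
γ⟨(y₁)_{-1}⟩`, solvable off the zeros of the dispersion relation. -/
theorem areScatteringCoefficients_of_dispersion (hf : IsPerturbation f X) (h0 : 0 < β)
    (h1 : β < 1 / 2) {K ν : ℝ} {T : ℂ → SeqSpace X →L[ℂ] SeqSpace X}
    (H : IsOperatorFamily T (muMax β) K)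
    (hT : ∀ μ, ‖μ‖ ≤ muMax β → ∀ A m x, T μ A m x = operatorT f X β μ A m x)
    (hε : 0 < ε) (hKε : K * ε ≤ 1 / 2) (hν : 0 < ν) (hμ : ε * ν ≤ muMax β)
    (hD : (ν : ℂ) - dispersion hf β T ε (ε * ν) ≠ 0) :
    AreScatteringCoefficients f β ε (ε * ν)
      (Complex.I * gammaC β (ε * ν) * ε / waveNumber β (ε * ν) *
        amplitude hf β T ε ν (Complex.I * waveNumber β (ε * ν)))
      (1 + Complex.I * gammaC β (ε * ν) * ε / waveNumber β (ε * ν) *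
        amplitude hf β T ε ν (-Complex.I * waveNumber β (ε * ν))) := by
  have hμ0 : 0 < ε * ν := mul_pos hε hν
  have hμ' := norm_ofReal_le_muMax hμ0.le hμ
  have hcast : ((ε * ν : ℝ) : ℂ) = ε * ν := by push_cast; rfl
  set y₁ := solve ((ε : ℂ) • T (ε * ν)) (shiftedCoef hf 0 (Complex.I * waveNumber β (ε * ν))) with hy₁
  set y₂ := solve ((ε : ℂ) • T (ε * ν)) (shiftedCoef hf 1 0) with hy₂
  set c : ℂ := gammaC β (ε * ν) * modeMean X 0 (-1) y₁ / (ν - dispersion hf β T ε (ε * ν)) with hc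
  rw [hcast] at hμ'
  have s1 := H.solve_spec hε.le hKε hμ' (shiftedCoef hf 0 (Complex.I * waveNumber β (ε * ν)))
  have s2 := H.solve_spec hε.le hKε hμ' (shiftedCoef hf 1 0)
  rw [← hy₁] at s1
  rw [← hy₂] at s2
  let A : SeqSpace X := y₁ + c • y₂
  have hamp : ∀ k, modeMean X k 0 A = amplitude hf β T ε ν k := fun k => by
    simp only [A, map_add, map_smul, smul_eq_mul]
    rfl
  have hmean : modeMean X 0 (-1) A = modeMean X 0 (-1) y₁ + c * modeMean X 0 (-1) y₂ := by
    simp only [A, map_add, map_smul, smul_eq_mul]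
  have hAx : ∀ m x, A m x = y₁ m x + c * y₂ m x := fun m x => rfl
  have hTA : ∀ m x, T (ε * ν) A m x = T (ε * ν) y₁ m x + c * T (ε * ν) y₂ m x := fun m x => by
    simp only [← evalAt_apply, A, map_add, map_smul, smul_eq_mul]
  have hx1 : ∀ m x, y₁ m x - ε * T (ε * ν) y₁ m x =
      fourierCoef f (m + 0) x * Complex.exp (Complex.I * waveNumber β (ε * ν) * (x : ℝ)) :=
    fun m x => by
      rw [← shiftedCoef_apply hf, ← s1]
      rfl
  have hx2 : ∀ m x, y₂ m x - ε * T (ε * ν) y₂ m x = fourierCoef f (m + 1) x := fun m x => by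
    have : shiftedCoef hf 1 0 m x = fourierCoef f (m + 1) x := by
      rw [shiftedCoef_apply]
      simp
    rw [← this, ← s2]
    rfl
  have key := areScatteringCoefficients_of_reduced (ε := ε) hf h0 h1 hμ0 hμ A c (fun m x => ?_) ?_
  · rw [reflCoef_eq hf.pos, transCoef_eq hf.pos, hamp, hamp, hcast] at key
    exact key
  · rw [hcast, ← hT _ hμ', hTA, hAx]
    have a1 := hx1 m x
    rw [add_zero] at a1
    linear_combination a1 + c * hx2 m x
  · rw [hcast, hmean]
    have hcD : c * (ν - dispersion hf β T ε (ε * ν)) = gammaC β (ε * ν) * modeMean X 0 (-1) y₁ :=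
      div_mul_cancel₀ _ hD
    have hd : dispersion hf β T ε (ε * ν) = gammaC β (ε * ν) * modeMean X 0 (-1) y₂ := rfl
    rw [hd] at hcD
    linear_combination (ε : ℂ) * hcD

end

section

/-! ### The width of the resonance -/

variable {f : ℝ × ℝ → ℝ} {X β ε μ : ℝ}

/-- The form `⟨h * a, a⟩` over `[-X, X]`. -/
def convForm (X : ℝ) (h : ℝ → ℂ) (a : C(Icc (-X) X, ℂ)) : ℂ :=
  ∫ x : Icc (-X) X, (∫ ξ : Icc (-X) X, h ((x : ℝ) - ξ) * a ξ ∂(intervalMeasure X)) * conj (a x)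
    ∂(intervalMeasure X)

theorem integrable_intervalMeasure {g : Icc (-X) X → ℂ} (hg : Continuous g) :
    Integrable g (intervalMeasure X) :=
  hg.integrable_of_hasCompactSupport (HasCompactSupport.of_compactSpace _)

theorem continuous_convolution (hX : 0 ≤ X) {h : ℝ → ℂ} (hc : Continuous h) (a : C(Icc (-X) X, ℂ)) :
    Continuous fun x : Icc (-X) X => ∫ ξ : Icc (-X) X, h ((x : ℝ) - ξ) * a ξ ∂(intervalMeasure X) :=
  (convCLM hX ⟨h, hc⟩ a).continuous

/-- Fubini and the evenness of `h` show that conjugating the form conjugates the kernel; only the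
imaginary part of the kernel survives. -/
theorem convForm_sub_conj (hX : 0 ≤ X) {h : ℝ → ℂ} (hc : Continuous h) (he : ∀ x, h (-x) = h x)
    (a : C(Icc (-X) X, ℂ)) :
    convForm X h a - conj (convForm X h a) = convForm X (fun x => h x - conj (h x)) a := by
  have h1 : conj (convForm X h a) = convForm X (fun x => conj (h x)) a := by
    unfold convForm
    rw [← integral_conj]
    have e1 : ∀ x : Icc (-X) X, conj ((∫ ξ : Icc (-X) X, h ((x : ℝ) - ξ) * a ξ ∂(intervalMeasure X)) *
        conj (a x)) = ∫ ξ : Icc (-X) X, conj (h ((x : ℝ) - ξ)) * conj (a ξ) * a x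
          ∂(intervalMeasure X) := fun x => by
      rw [map_mul, Complex.conj_conj, ← integral_conj, ← integral_mul_const]
      simp only [map_mul]
    simp only [e1]
    rw [integral_integral_swap]
    · congr 1
      funext ξ
      rw [← integral_mul_const]
      congr 1
      funext x
      rw [← he, neg_sub]
      ring
    · exact Continuous.integrable_of_hasCompactSupport
        (by unfold Function.uncurry; fun_prop) (HasCompactSupport.of_compactSpace _)
  have hc' : Continuous fun x => conj (h x) := Complex.continuous_conj.comp hc
  rw [h1]
  unfold convForm
  rw [← integral_sub]
  · congr 1
    funext x
    rw [← sub_mul, ← integral_sub]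
    · simp only [sub_mul]
    · exact integrable_intervalMeasure (by fun_prop)
    · exact integrable_intervalMeasure (by fun_prop)
  · have := continuous_convolution hX hc a
    exact integrable_intervalMeasure (by fun_prop)
  · have := continuous_convolution hX hc' a
    exact integrable_intervalMeasure (by fun_prop)

/-- The kernel `e^{k(x-ξ)}` separates, and for imaginary `k` the two factors are conjugate, so the
form is a squared Fourier coefficient. -/
theorem convForm_exp (k : ℂ) (hk : conj k = -k) (a : C(Icc (-X) X, ℂ)) :
    convForm X (fun x => Complex.exp (k * x)) a = expMean X (-k) a * conj (expMean X (-k) a) := by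
  have e : ∀ x : Icc (-X) X, ∫ ξ : Icc (-X) X, Complex.exp (k * ((x : ℝ) - (ξ : ℝ) : ℝ)) * a ξ
      ∂(intervalMeasure X) = Complex.exp (k * (x : ℝ)) * expMean X (-k) a := fun x => by
    rw [expMean_apply, ← integral_const_mul]
    congr 1
    funext ξ
    rw [← mul_assoc, ← Complex.exp_add]
    congr 2
    push_cast
    ring
  unfold convForm
  simp only [e]
  rw [expMean_apply (-k), ← integral_conj, ← integral_const_mul]
  congr 1
  funext x
  rw [map_mul, ← Complex.exp_conj, map_mul, map_neg, hk, Complex.conj_ofReal, neg_neg]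
  ring

theorem convForm_add (hX : 0 ≤ X) {h h' : ℝ → ℂ} (hc : Continuous h) (hc' : Continuous h') (c : ℂ)
    (a : C(Icc (-X) X, ℂ)) :
    convForm X (fun x => c * (h x + h' x)) a = c * (convForm X h a + convForm X h' a) := by
  unfold convForm
  have k1 := continuous_convolution hX hc a
  have k2 := continuous_convolution hX hc' a
  rw [← integral_add (integrable_intervalMeasure (by fun_prop))
    (integrable_intervalMeasure (by fun_prop)), ← integral_const_mul]
  congr 1
  funext x
  rw [← add_mul, ← mul_assoc, ← integral_add (integrable_intervalMeasure (by fun_prop))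
    (integrable_intervalMeasure (by fun_prop)), ← integral_const_mul]
  congr 2
  funext ξ
  ring

theorem fourierHat_eq (hf : IsPerturbation f X) (j : ℤ) (ξ : ℝ) :
    fourierHat f j ξ = expMean X (-Complex.I * ξ) (coefC hf j) := by
  have hX := hf.pos
  have e := integral_intervalMeasure hX fun x : ℝ => Complex.exp (-Complex.I * ξ * x) * fourierCoef f j x
  rw [expMean_apply]
  refine Eq.trans ?_ e.symm
  rw [fourierHat]
  refine (intervalIntegral.integral_eq_integral_of_support_subset fun x hx => ?_).symm
  by_contra hn
  refine hx ?_
  have : X ≤ |x| := by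
    by_contra h
    have h := abs_lt.mp (not_le.mp h)
    exact hn ⟨h.1, h.2.le⟩
  simp only [hf.fourierCoef_eq_zero j this, mul_zero]

theorem waveNumber_zero (β : ℝ) : waveNumber β 0 = kappa β := by
  unfold waveNumber kappa omegaSq
  congr 1
  ring

theorem kappa_pos (h1 : β < 1 / 2) : 0 < kappa β := Real.sqrt_pos.mpr (by linarith)

theorem gammaC_zero (β : ℝ) : gammaC β 0 = gammaZero β := by
  unfold gammaC gammaZero
  push_cast
  ring

theorem kernelH_neg (β : ℝ) (μ : ℂ) (n : ℤ) (x : ℝ) : kernelH β μ n (-x) = kernelH β μ n x := by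
  unfold kernelH
  rw [abs_neg]

theorem conj_kernelH_zero (h0 : 0 < β) (h1 : β < 1 / 2) {n : ℤ} (hn : n ≠ 0) (x : ℝ) :
    conj (kernelH β 0 n x) = kernelH β 0 n x := by
  unfold kernelH
  rw [if_neg hn]
  split_ifs with hn1 hz
  · rw [map_div₀, map_neg, Complex.conj_ofReal, Complex.conj_ofNat]
  · exact absurd rfl hz
  · have := modeNumber_eq_decayRate (μ := 0) h0 h1 hn
    rw [Complex.ofReal_zero] at this
    rw [this, map_mul, map_div₀, map_one, map_mul, ← Complex.exp_conj, map_mul, map_neg,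
      Complex.conj_ofReal, Complex.conj_ofReal, Complex.conj_ofNat]

/-- Twice `i` times the imaginary part of the outgoing Green function is `(i/κ) cos(κx)`; being
even, the cosine makes the modulus of `x` disappear, leaving two separable exponentials. -/
theorem kernelH_zero_sub_conj (h0 : 0 < β) (h1 : β < 1 / 2) (x : ℝ) :
    kernelH β 0 0 x - conj (kernelH β 0 0 x) = Complex.I / (2 * kappa β) *
      (Complex.exp (Complex.I * kappa β * x) + Complex.exp (-(Complex.I * kappa β) * x)) := by
  have e := modeNumber_zero_eq (μ := 0) h0 h1 le_rfl (muMax_pos h0 h1).le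
  rw [Complex.ofReal_zero, waveNumber_zero] at e
  have hc : conj (Complex.exp (Complex.I * kappa β * (|x| : ℝ))) =
      Complex.exp (-(Complex.I * kappa β) * (|x| : ℝ)) := by
    rw [← Complex.exp_conj]
    simp
  rw [kernelH, if_pos rfl, e, map_mul, hc, map_div₀, map_mul, Complex.conj_I, Complex.conj_ofReal,
    Complex.conj_ofNat]
  rcases abs_choice x with h | h
  · rw [h]
    ring
  · rw [h]
    push_cast
    rw [mul_neg, mul_neg, neg_mul, neg_neg]
    ring

/-- Energy leaks only through the open channel: the other kernels are real at the threshold. The two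
directions of propagation give the two terms of `Γ`. -/
theorem convForm_kernelH (hf : IsPerturbation f X) (h0 : 0 < β) (h1 : β < 1 / 2) (n : ℤ) :
    convForm X (kernelH β 0 n) (coefC hf (n + 1)) -
        conj (convForm X (kernelH β 0 n) (coefC hf (n + 1))) =
      if n = 0 then Complex.I / (2 * kappa β) *
        ((‖fourierHat f 1 (kappa β)‖ ^ 2 + ‖fourierHat f 1 (-kappa β)‖ ^ 2 : ℝ) : ℂ) else 0 := by
  rw [convForm_sub_conj hf.pos.le (continuous_kernelH β 0 n) (kernelH_neg β 0 n)]
  split_ifs with hn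
  · subst hn
    simp only [kernelH_zero_sub_conj h0 h1]
    have hI : conj (Complex.I * kappa β) = -(Complex.I * kappa β) := by simp
    rw [convForm_add hf.pos.le (by fun_prop) (by fun_prop), convForm_exp _ hI,
      convForm_exp _ (by rw [map_neg, hI]), fourierHat_eq hf, fourierHat_eq hf, zero_add]
    rw [Complex.mul_conj, Complex.mul_conj, Complex.normSq_eq_norm_sq, Complex.normSq_eq_norm_sq]
    push_cast
    rw [neg_mul, neg_mul, mul_neg]
  · simp only [conj_kernelH_zero h0 h1 hn, sub_self]
    simp [convForm]

/-- The imaginary part of the second order term of the dispersion relation. -/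
theorem im_secondOrder (hf : IsPerturbation f X) (h0 : 0 < β) (h1 : β < 1 / 2)
    {T : ℂ → SeqSpace X →L[ℂ] SeqSpace X}
    (hT : ∀ μ, ‖μ‖ ≤ muMax β → ∀ A m x, T μ A m x = operatorT f X β μ A m x) :
    (gammaC β 0 * modeMean X 0 (-1) (T 0 (shiftedCoef hf 1 0))).im = width f β / 2 := by
  have hX := hf.pos.le
  have hμ : ‖(0 : ℂ)‖ ≤ muMax β := by
    rw [norm_zero]
    exact (muMax_pos h0 h1).le
  set g := shiftedCoef hf 1 0 with hg
  have hgx : ∀ m, g m = coefC hf (m + 1) := fun m => by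
    ext x
    rw [hg, shiftedCoef_apply, coefC_apply]
    simp
  obtain ⟨M, hM0, hM, -⟩ := exists_kernelH_bounds h0 h1 (by positivity : 0 ≤ 2 * X)
  let F : ℤ → Icc (-X) X → ℂ := fun n x =>
    (∫ ξ : Icc (-X) X, kernelH β 0 n ((x : ℝ) - ξ) * g n ξ ∂(intervalMeasure X)) *
      fourierCoef f (-1 - n) x
  have hFc : ∀ n, Continuous (F n) := fun n => by
    have k1 := continuous_convolution hX (continuous_kernelH β 0 n) (g n)
    have k2 := (coefC hf (-1 - n)).continuous
    exact k1.mul k2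
  -- Since `f` is real, `f_{-1-n}` is the conjugate of `f_{n+1}`; this makes the second order term a
  -- sum of sesquilinear forms.
  have hFint : ∀ n, ∫ x, F n x ∂(intervalMeasure X) =
      convForm X (kernelH β 0 n) (coefC hf (n + 1)) := fun n => by
    unfold convForm
    congr 1
    funext x
    simp only [F, hgx]
    congr 1
    rw [coefC_apply, conj_fourierCoef]
    congr 1
    ring
  have hbd : ∀ n x, ‖F n x‖ ≤ 2 * X * (M * ‖g‖) * ‖coefC hf (-1 - n)‖ := fun n x => by
    simp only [F]
    rw [norm_mul]
    refine mul_le_mul (norm_integral_intervalMeasure_le hX fun ξ => ?_)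
      ((coefC hf (-1 - n)).norm_coe_le_norm x) (norm_nonneg _) (by positivity)
    rw [norm_mul]
    exact mul_le_mul (hM 0 hμ n _ (Icc_sub_abs_le x ξ)) (((g n).norm_coe_le_norm ξ).trans
      (lp.norm_apply_le_norm (by norm_num) g n)) (norm_nonneg _) hM0
  have hsum : Summable fun n => ∫ x, ‖F n x‖ ∂(intervalMeasure X) := by
    have hs := ((Equiv.subLeft (-1 : ℤ)).summable_iff.mpr (summable_norm_coefC hf)).mul_left
      (2 * X * (2 * X * (M * ‖g‖)))
    refine Summable.of_nonneg_of_le (fun n => integral_nonneg fun _ => norm_nonneg _) (fun n => ?_) hs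
    have := norm_integral_intervalMeasure_le (g := fun x => ((‖F n x‖ : ℝ) : ℂ)) hX fun x => by
      rw [Complex.norm_real, norm_norm]
      exact hbd n x
    rw [integral_complex_ofReal, Complex.norm_real, Real.norm_of_nonneg
      (integral_nonneg fun _ => norm_nonneg _)] at this
    exact this.trans_eq (by simp only [Function.comp, Equiv.subLeft_apply]; ring)
  have hS := hasSum_integral_of_summable_integral_norm
    (fun n => integrable_intervalMeasure (hFc n)) hsum
  simp only [hFint] at hS
  set S := ∫ x, ∑' n, F n x ∂(intervalMeasure X) with hSdef
  have hval : modeMean X 0 (-1) (T 0 g) = 2 * gammaC β 0 * S := by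
    rw [modeMean_apply, expMean_zero, hSdef, ← integral_const_mul]
    congr 1
    funext x
    rw [hT 0 hμ]
    rfl
  have hconj : HasSum (fun n => conj (convForm X (kernelH β 0 n) (coefC hf (n + 1)))) (conj S) :=
    hS.map (starRingEnd ℂ) Complex.continuous_conj
  have hdiff := hS.sub hconj
  simp only [convForm_kernelH hf h0 h1] at hdiff
  have hv := hdiff.unique (hasSum_ite_eq (0 : ℤ) _)
  have hκ := (kappa_pos h1).ne'
  have him : S.im = (‖fourierHat f 1 (kappa β)‖ ^ 2 + ‖fourierHat f 1 (-kappa β)‖ ^ 2) /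
      (4 * kappa β) := by
    rw [Complex.sub_conj] at hv
    have h2 : ((2 * S.im : ℝ) : ℂ) = (((‖fourierHat f 1 (kappa β)‖ ^ 2 +
        ‖fourierHat f 1 (-kappa β)‖ ^ 2) / (2 * kappa β) : ℝ) : ℂ) := by
      have hI := Complex.I_ne_zero
      refine mul_right_cancel₀ hI (hv.trans ?_)
      push_cast
      ring
    have h3 := Complex.ofReal_injective h2
    field_simp at h3 ⊢
    linarith
  rw [hval, gammaC_zero, ← mul_assoc, show (gammaZero β : ℂ) * (2 * gammaZero β) =
    ((gammaZero β * (2 * gammaZero β) : ℝ) : ℂ) by push_cast; ring, Complex.im_ofReal_mul, him, width]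
  field_simp
  ring

end

section

/-! ### The resonance -/

variable {f : ℝ × ℝ → ℝ} {X β ε K : ℝ} {T : ℂ → SeqSpace X →L[ℂ] SeqSpace X}

theorem shiftedCoef_one_apply (hf : IsPerturbation f X) (m : ℤ) (x : Icc (-X) X) :
    shiftedCoef hf 1 0 m x = fourierCoef f (m + 1) x := by
  rw [shiftedCoef_apply]
  simp

/-- Uniqueness for `(1 - εT)Y = g` identifies every admissible `Y` with the Neumann solution, so
roots are fixed points. -/
theorem isDispersionRoot_iff (hf : IsPerturbation f X) (H : IsOperatorFamily T (muMax β) K)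
    (hT : ∀ μ, ‖μ‖ ≤ muMax β → ∀ A m x, T μ A m x = operatorT f X β μ A m x)
    (hε : 0 ≤ ε) (hKε : K * ε ≤ 1 / 2) {ν : ℂ} (hν : ‖(ε : ℂ) * ν‖ ≤ muMax β) :
    IsDispersionRoot f X β ε ν ↔ ν = dispersion hf β T ε (ε * ν) := by
  constructor
  · rintro ⟨Y, hY, h⟩
    have e : Y - (ε : ℂ) • T (ε * ν) Y = shiftedCoef hf 1 0 := by
      ext m x
      rw [shiftedCoef_one_apply, ← hY m x, ← hT _ hν]
      rfl
    have := H.eq_solve hε hKε hν e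
    rw [dispersion, ← this, modeMean_apply, expMean_zero]
    exact sub_eq_zero.mp h
  · intro h
    refine ⟨solve ((ε : ℂ) • T (ε * ν)) (shiftedCoef hf 1 0), fun m x => ?_, ?_⟩
    · have e := H.solve_spec hε hKε hν (shiftedCoef hf 1 0)
      rw [← shiftedCoef_one_apply hf, ← hT _ hν]
      conv_rhs => rw [← e]
      rfl
    · rw [dispersion, modeMean_apply, expMean_zero] at h
      exact sub_eq_zero.mpr h

theorem eventually_small (hK : 0 < K) : ∀ᶠ ε in 𝓝[>] (0 : ℝ), 0 < ε ∧ K * ε ≤ 1 / 2 := by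
  have h2 : ∀ᶠ ε in 𝓝[>] (0 : ℝ), ε ≤ 1 / (2 * K) :=
    nhdsWithin_le_nhds (eventually_le_nhds (by positivity))
  filter_upwards [self_mem_nhdsWithin, h2] with ε h0 h
  refine ⟨h0, ?_⟩
  rw [le_div_iff₀ (by positivity)] at h
  linarith

theorem dispersion_bounds (hf : IsPerturbation f X) (h0 : 0 < β) (h1 : β < 1 / 2)
    (H : IsOperatorFamily T (muMax β) K) :
    ∃ C, 0 < C ∧ ∀ ε : ℝ, 0 ≤ ε → K * ε ≤ 1 / 2 →
      (∀ μ, ‖μ‖ ≤ muMax β → ‖dispersion hf β T ε μ‖ ≤ C) ∧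
      (∀ μ μ', ‖μ‖ ≤ muMax β → ‖μ'‖ ≤ muMax β →
        ‖dispersion hf β T ε μ - dispersion hf β T ε μ'‖ ≤
          C * (‖μ ^ 2 - μ' ^ 2‖ + ε * ‖μ - μ'‖)) ∧
      ‖dispersion hf β T ε 0 - gammaC β 0 * (modeMean X 0 (-1) (shiftedCoef hf 1 0) +
        ε * modeMean X 0 (-1) (T 0 (shiftedCoef hf 1 0)))‖ ≤ C * ε ^ 2 :=
  exists_dispersion_bounds H (modeMean X 0 (-1)) (shiftedCoef hf 1 0)
    (fun _ hμ => norm_gammaC_le h0 h1 hμ) (norm_gammaC_sub_le β)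

theorem exists_isResonance (hf : IsPerturbation f X) (h0 : 0 < β) (h1 : β < 1 / 2) :
    ∃ ν₀ : ℝ → ℂ, IsResonance f X β ν₀ := by
  obtain ⟨K, T, H, hT⟩ := exists_operatorFamily hf h0 h1
  obtain ⟨C, hC, hb⟩ := dispersion_bounds hf h0 h1 H
  have hK := H.bound_pos
  have hle : ∀ ε, ε ≤ 1 / (2 * K) → K * ε ≤ 1 / 2 := fun ε h => by
    rw [le_div_iff₀ (by positivity)] at h
    linarith
  have hr := exists_root_of_lipschitz (Φ := dispersion hf β T) hC H.r_pos
    (by positivity : 0 < 1 / (2 * K)) (fun ε hε h => (hb ε hε (hle ε h)).1)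
    (fun ε hε h => (hb ε hε (hle ε h)).2.1)
  classical
  let ν₀ : ℝ → ℂ := fun ε =>
    if h : ∃ ν : ℂ, ‖ν‖ ≤ C ∧ dispersion hf β T ε (ε * ν) = ν then h.choose else 0
  have hν₀ : ∀ᶠ ε in 𝓝[>] (0 : ℝ), ‖ν₀ ε‖ ≤ C ∧ dispersion hf β T ε (ε * ν₀ ε) = ν₀ ε := by
    filter_upwards [hr] with ε h
    have e : ν₀ ε = h.choose := dif_pos h
    rw [e]
    exact h.choose_spec
  have ht : Tendsto (fun ε : ℝ => (ε : ℂ) * ν₀ ε) (𝓝[>] (0 : ℝ)) (𝓝 0) := by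
    refine squeeze_zero_norm' (a := fun ε => ε * C) ?_ ?_
    · filter_upwards [hν₀, self_mem_nhdsWithin] with ε h hε
      rw [norm_mul, Complex.norm_real, Real.norm_of_nonneg (le_of_lt hε)]
      exact mul_le_mul_of_nonneg_left h.1 (le_of_lt hε)
    · have : Tendsto (fun ε : ℝ => ε * C) (𝓝 0) (𝓝 (0 * C)) :=
        (continuous_id.mul continuous_const).tendsto 0
      rw [zero_mul] at this
      exact this.mono_left nhdsWithin_le_nhds
  refine ⟨ν₀, ?_, ht⟩
  filter_upwards [hν₀, eventually_small hK, (tendsto_zero_iff_norm_tendsto_zero.mp ht).eventually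
    (eventually_le_nhds H.r_pos)] with ε h hε hμ
  exact (isDispersionRoot_iff hf H hT hε.1.le hε.2 hμ).mpr h.2.symm

/-- The leading term is a real multiple of the integral of `f_0`, which is real for real `f`; the
width thus starts at order `ε`. -/
theorem im_firstOrder (hf : IsPerturbation f X) :
    (gammaC β 0 * modeMean X 0 (-1) (shiftedCoef hf 1 0)).im = 0 := by
  refine Complex.conj_eq_iff_im.mp ?_
  rw [map_mul, gammaC_zero, Complex.conj_ofReal, modeMean_apply, expMean_zero, ← integral_conj]
  simp only [shiftedCoef_one_apply, conj_fourierCoef]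
  simp

/-- Size and width of the resonance. -/
theorem IsResonance.bounds (hf : IsPerturbation f X) (h0 : 0 < β) (h1 : β < 1 / 2)
    (H : IsOperatorFamily T (muMax β) K)
    (hT : ∀ μ, ‖μ‖ ≤ muMax β → ∀ A m x, T μ A m x = operatorT f X β μ A m x) {ν₀ : ℝ → ℂ}
    (hν : IsResonance f X β ν₀) :
    ∃ C, 0 < C ∧ ∀ᶠ ε in 𝓝[>] (0 : ℝ), ‖ν₀ ε‖ ≤ C ∧ ‖(ε : ℂ) * ν₀ ε‖ ≤ muMax β ∧
      ν₀ ε = dispersion hf β T ε (ε * ν₀ ε) ∧ |(ν₀ ε).im - ε * width f β / 2| ≤ C * ε ^ 2 := by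
  obtain ⟨C, hC, hb⟩ := dispersion_bounds hf h0 h1 H
  refine ⟨C * (C ^ 2 + C + 1) + C, by positivity, ?_⟩
  filter_upwards [hν.root, eventually_small H.bound_pos,
    (tendsto_zero_iff_norm_tendsto_zero.mp hν.tendsto).eventually (eventually_le_nhds H.r_pos)]
    with ε hroot hε hμ
  obtain ⟨b1, b2, b3⟩ := hb ε hε.1.le hε.2
  have hd := (isDispersionRoot_iff hf H hT hε.1.le hε.2 hμ).mp hroot
  -- Only `εν₀ → 0` is given; boundedness of `ν₀` follows from the equation it solves.
  have hn : ‖ν₀ ε‖ ≤ C := by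
    rw [hd]
    exact b1 _ hμ
  have hz : ‖(0 : ℂ)‖ ≤ muMax β := by
    rw [norm_zero]
    exact H.r_pos.le
  -- Since `ν₀` is bounded, replacing `εν₀` by `0` in the dispersion function costs only `O(ε²)`.
  have b4 := b2 _ _ hμ hz
  rw [← hd] at b4
  refine ⟨hn.trans (by nlinarith [sq_nonneg C, mul_pos hC hC]), hμ, hd, ?_⟩
  have e1 : ‖ν₀ ε - gammaC β 0 * (modeMean X 0 (-1) (shiftedCoef hf 1 0) +
        ε * modeMean X 0 (-1) (T 0 (shiftedCoef hf 1 0)))‖ ≤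
      (C * (C ^ 2 + C + 1) + C) * ε ^ 2 := by
    have hsq : ‖((ε : ℂ) * ν₀ ε) ^ 2 - 0 ^ 2‖ ≤ ε ^ 2 * C ^ 2 := by
      rw [zero_pow two_ne_zero, sub_zero, norm_pow, norm_mul, Complex.norm_real,
        Real.norm_of_nonneg hε.1.le, mul_pow]
      gcongr
    have hli : ‖(ε : ℂ) * ν₀ ε - 0‖ ≤ ε * C := by
      rw [sub_zero, norm_mul, Complex.norm_real, Real.norm_of_nonneg hε.1.le]
      exact mul_le_mul_of_nonneg_left hn hε.1.le
    have h3 : C * (‖((ε : ℂ) * ν₀ ε) ^ 2 - 0 ^ 2‖ + ε * ‖(ε : ℂ) * ν₀ ε - 0‖) ≤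
        C * (ε ^ 2 * C ^ 2 + ε * (ε * C)) := by
      have := hε.1
      gcongr
    have := norm_sub_le_norm_sub_add_norm_sub (ν₀ ε) (dispersion hf β T ε 0)
      (gammaC β 0 * (modeMean X 0 (-1) (shiftedCoef hf 1 0) +
        ε * modeMean X 0 (-1) (T 0 (shiftedCoef hf 1 0))))
    nlinarith [mul_nonneg hC.le (sq_nonneg ε)]
  have e2 := (Complex.abs_im_le_norm _).trans e1
  have e3 : (gammaC β 0 * (modeMean X 0 (-1) (shiftedCoef hf 1 0) +
        ε * modeMean X 0 (-1) (T 0 (shiftedCoef hf 1 0)))).im = ε * width f β / 2 := by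
    rw [mul_add, mul_left_comm, Complex.add_im, im_firstOrder hf, Complex.im_ofReal_mul,
      im_secondOrder hf h0 h1 hT]
    ring
  rwa [Complex.sub_im, e3] at e2

end

section

/-! ### Quantities that differ from a constant by `O(ε)` -/

variable {f : ℝ × ℝ → ℝ} {X β K : ℝ} {T : ℂ → SeqSpace X →L[ℂ] SeqSpace X}
  {l : Filter (ℝ × ℝ)} {u v : ℝ × ℝ → ℂ} {a b : ℂ}

/-- `u = c + O(ε)`, where `ε` is the first parameter. -/
def NearConst (l : Filter (ℝ × ℝ)) (u : ℝ × ℝ → ℂ) (c : ℂ) : Prop :=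
  (fun p => u p - c) =O[l] fun p => p.1

theorem isBigO_mul_bounded (hu : u =O[l] fun p => p.1) (hv : v =O[l] fun _ => (1 : ℝ)) :
    (fun p => u p * v p) =O[l] fun p => p.1 := by
  have := Asymptotics.IsBigO.mul hu hv
  simp only [mul_one] at this
  exact this

theorem NearConst.const (l : Filter (ℝ × ℝ)) (a : ℂ) : NearConst l (fun _ => a) a := by
  unfold NearConst
  simp only [sub_self]
  exact Asymptotics.isBigO_zero _ _

theorem NearConst.tendsto (hl : Tendsto Prod.fst l (𝓝 (0 : ℝ))) (h : NearConst l u a) :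
    Tendsto u l (𝓝 a) :=
  tendsto_sub_nhds_zero_iff.mp (Asymptotics.IsBigO.trans_tendsto h hl)

theorem NearConst.add (hu : NearConst l u a) (hv : NearConst l v b) :
    NearConst l (fun p => u p + v p) (a + b) :=
  (Asymptotics.IsBigO.add hu hv).congr_left fun p => by ring

theorem NearConst.mul (hl : Tendsto Prod.fst l (𝓝 (0 : ℝ))) (hu : NearConst l u a)
    (hv : NearConst l v b) : NearConst l (fun p => u p * v p) (a * b) := by
  have h1 := isBigO_mul_bounded hu ((hv.tendsto hl).isBigO_one ℝ)
  have h2 := Asymptotics.IsBigO.const_mul_left hv a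
  exact (h1.add h2).congr_left fun p => by ring

theorem NearConst.inv (hl : Tendsto Prod.fst l (𝓝 (0 : ℝ))) (hu : NearConst l u a) (ha : a ≠ 0) :
    NearConst l (fun p => (u p)⁻¹) a⁻¹ := by
  have ht := hu.tendsto hl
  have h1 : (fun p => (u p)⁻¹ * (-a⁻¹)) =O[l] fun _ => (1 : ℝ) :=
    ((ht.inv₀ ha).mul_const _).isBigO_one ℝ
  refine (isBigO_mul_bounded hu h1).congr' ?_ EventuallyEq.rfl
  filter_upwards [ht.eventually_ne ha] with p hp
  field_simp
  ring

theorem NearConst.of_bound {C : ℝ} (h : ∀ᶠ p in l, 0 ≤ p.1 ∧ ‖u p - a‖ ≤ C * p.1) : NearConst l u a :=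
  Asymptotics.IsBigO.of_bound C (h.mono fun p hp => by
    rw [Real.norm_of_nonneg hp.1]
    exact hp.2)

theorem NearConst.congr (hu : NearConst l u a) (h : ∀ᶠ p in l, u p = v p) (hab : a = b) :
    NearConst l v b := by
  subst hab
  exact Asymptotics.IsBigO.congr' hu (h.mono fun p hp => by simp only [hp]) EventuallyEq.rfl

/-! ### Means of the solutions of the reduced system -/

theorem norm_exp_coe_le {M : ℝ} {k : ℂ} (hk : ‖k‖ ≤ M) (x : Icc (-X) X) :
    (k * ((x : ℝ) : ℂ)).re ≤ M * X := by
  refine (Complex.re_le_norm _).trans ?_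
  rw [norm_mul, Complex.norm_real]
  exact mul_le_mul hk (abs_le.mpr x.2) (norm_nonneg _) ((norm_nonneg _).trans hk)

theorem norm_expMean_le (hX : 0 ≤ X) {M : ℝ} {k : ℂ} (hk : ‖k‖ ≤ M) (A : C(Icc (-X) X, ℂ)) :
    ‖expMean X k A‖ ≤ 2 * X * (Real.exp (M * X) * ‖A‖) := by
  rw [expMean_apply]
  refine norm_integral_intervalMeasure_le hX fun ξ => ?_
  rw [norm_mul, Complex.norm_exp]
  exact mul_le_mul (Real.exp_le_exp.mpr (norm_exp_coe_le hk ξ)) (A.norm_coe_le_norm ξ)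
    (norm_nonneg _) (Real.exp_pos _).le

theorem norm_expMean_sub_le (hX : 0 ≤ X) {M : ℝ} {k k' : ℂ} (hk : ‖k‖ ≤ M) (hk' : ‖k'‖ ≤ M)
    (A : C(Icc (-X) X, ℂ)) :
    ‖expMean X k A - expMean X k' A‖ ≤ 2 * X * (Real.exp (M * X) * X * ‖A‖) * ‖k - k'‖ := by
  rw [expMean_apply, expMean_apply, ← integral_sub (integrable_intervalMeasure (by fun_prop))
    (integrable_intervalMeasure (by fun_prop))]
  refine (norm_integral_intervalMeasure_le (M := Real.exp (M * X) * X * ‖A‖ * ‖k - k'‖) hX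
    fun ξ => ?_).trans_eq (by ring)
  rw [← sub_mul, norm_mul]
  calc ‖Complex.exp (k * (ξ : ℝ)) - Complex.exp (k' * (ξ : ℝ))‖ * ‖A ξ‖
      ≤ Real.exp (M * X) * ‖k * (ξ : ℝ) - k' * (ξ : ℝ)‖ * ‖A‖ := by
        gcongr
        · exact norm_exp_sub_exp_le (norm_exp_coe_le hk ξ) (norm_exp_coe_le hk' ξ)
        · exact A.norm_coe_le_norm ξ
    _ ≤ Real.exp (M * X) * (‖k - k'‖ * X) * ‖A‖ := by
        rw [← sub_mul, norm_mul, Complex.norm_real]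
        gcongr
        exact abs_le.mpr ξ.2
    _ = _ := by ring

theorem modeMean_shiftedCoef (hf : IsPerturbation f X) (k k' : ℂ) (m j : ℤ) :
    modeMean X k m (shiftedCoef hf j k') = expMean X (k + k') (coefC hf (m + j)) := by
  rw [modeMean_apply, expMean_apply, expMean_apply]
  congr 1
  funext ξ
  rw [shiftedCoef_apply, coefC_apply, add_mul, Complex.exp_add]
  ring

theorem norm_shiftedCoef_le (hf : IsPerturbation f X) {M : ℝ} {k : ℂ} (hk : ‖k‖ ≤ M) (j : ℤ) :
    ‖shiftedCoef hf j k‖ ≤ Real.exp (M * X) * ‖shiftedCoef hf j 0‖ := by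
  have e : shiftedCoef hf j k = mulCLM (expC X k) (shiftedCoef hf j 0) := by
    ext m x
    rw [mulCLM_apply, ContinuousMap.mul_apply, shiftedCoef_apply, shiftedCoef_apply, zero_mul,
      Complex.exp_zero, mul_one, mul_comm]
    rfl
  rw [e]
  refine ContinuousLinearMap.le_of_opNorm_le _ ((norm_mulCLM_le _).trans ?_) _
  refine (ContinuousMap.norm_le _ (Real.exp_pos _).le).mpr fun x => ?_
  have : expC X k x = Complex.exp (k * (x : ℝ)) := rfl
  rw [this, Complex.norm_exp]
  exact Real.exp_le_exp.mpr (norm_exp_coe_le hk x)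

theorem norm_modeMean_le (hX : 0 ≤ X) {M : ℝ} {k : ℂ} (hk : ‖k‖ ≤ M) (m : ℤ) (A : SeqSpace X) :
    ‖modeMean X k m A‖ ≤ 2 * X * (Real.exp (M * X) * ‖A‖) := by
  rw [modeMean_apply]
  refine (norm_expMean_le hX hk _).trans ?_
  have := lp.norm_apply_le_norm (by norm_num : (2 : ℝ≥0∞) ≠ 0) A m
  gcongr

theorem nearConst_expMean (hX : 0 ≤ X) (hl : Tendsto Prod.fst l (𝓝 (0 : ℝ)))
    (hu : NearConst l u a) (A : C(Icc (-X) X, ℂ)) :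
    NearConst l (fun p => expMean X (u p) A) (expMean X a A) := by
  have hn : ∀ᶠ p in l, ‖u p‖ ≤ ‖a‖ + 1 :=
    (hu.tendsto hl).norm.eventually (eventually_le_nhds (by linarith))
  refine Asymptotics.IsBigO.trans (Asymptotics.IsBigO.of_bound
    (2 * X * (Real.exp ((‖a‖ + 1) * X) * X * ‖A‖)) ?_) hu
  filter_upwards [hn] with p hp
  exact norm_expMean_sub_le hX hp (by linarith) A

/-- The Neumann solution is its right-hand side up to `O(ε)`, so each mean reduces to the Fourier
transform of the single coefficient `f_{m+j}` at the limiting frequency. -/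
theorem nearConst_modeMean_solve (hf : IsPerturbation f X) (H : IsOperatorFamily T (muMax β) K)
    (hl : Tendsto Prod.fst l (𝓝 (0 : ℝ))) {μ : ℝ × ℝ → ℂ}
    (hl0 : ∀ᶠ p in l, 0 ≤ p.1 ∧ K * p.1 ≤ 1 / 2 ∧ ‖μ p‖ ≤ muMax β)
    (hu : NearConst l u a) (hv : NearConst l v b) (m j : ℤ) :
    NearConst l (fun p => modeMean X (u p) m (solve ((p.1 : ℂ) • T (μ p)) (shiftedCoef hf j (v p))))
      (expMean X (a + b) (coefC hf (m + j))) := by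
  have hX := hf.pos.le
  have hK := H.bound_pos
  have h1 := nearConst_expMean hX hl (hu.add hv) (coefC hf (m + j))
  have hn : ∀ᶠ p in l, ‖u p‖ ≤ ‖a‖ + 1 :=
    (hu.tendsto hl).norm.eventually (eventually_le_nhds (by linarith))
  have hn' : ∀ᶠ p in l, ‖v p‖ ≤ ‖b‖ + 1 :=
    (hv.tendsto hl).norm.eventually (eventually_le_nhds (by linarith))
  have h2 : NearConst l (fun p => modeMean X (u p) m (solve ((p.1 : ℂ) • T (μ p))
      (shiftedCoef hf j (v p)) - shiftedCoef hf j (v p))) 0 := by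
    refine NearConst.of_bound (C := 2 * X * (Real.exp ((‖a‖ + 1) * X) *
      (2 * K * (Real.exp ((‖b‖ + 1) * X) * ‖shiftedCoef hf j 0‖)))) ?_
    filter_upwards [hl0, hn, hn'] with p h0 hp hp'
    refine ⟨h0.1, ?_⟩
    rw [sub_zero]
    refine (norm_modeMean_le hX hp m _).trans ?_
    have e1 := H.norm_solve_sub_le h0.1 h0.2.1 h0.2.2 (shiftedCoef hf j (v p))
    have e2 := norm_shiftedCoef_le hf hp' j
    calc _ ≤ 2 * X * (Real.exp ((‖a‖ + 1) * X) * (2 * K * p.1 *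
          (Real.exp ((‖b‖ + 1) * X) * ‖shiftedCoef hf j 0‖))) := by
          have := h0.1
          refine mul_le_mul_of_nonneg_left (mul_le_mul_of_nonneg_left (e1.trans ?_)
            (Real.exp_pos _).le) (by positivity)
          exact mul_le_mul_of_nonneg_left e2 (by positivity)
      _ = _ := by ring
  refine (h1.add h2).congr (Eventually.of_forall fun p => ?_) (add_zero _)
  rw [map_sub, modeMean_shiftedCoef]
  ring

end

section

/-! ### The parameter region around the resonance -/

variable {f : ℝ × ℝ → ℝ} {X β K : ℝ} {T : ℂ → SeqSpace X →L[ℂ] SeqSpace X} {ν₀ : ℝ → ℂ} {δ₀ : ℝ → ℝ}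

/-- The parameters `(ε, δ)` with `ε → 0+`, `|δ| < δ₀(ε)` and `Re ν₀(ε) + δ > 0`. -/
def paramFilter (ν₀ : ℝ → ℂ) (δ₀ : ℝ → ℝ) : Filter (ℝ × ℝ) :=
  comap Prod.fst (𝓝[>] (0 : ℝ)) ⊓
    𝓟 {p | -δ₀ p.1 < p.2 ∧ p.2 < δ₀ p.1 ∧ 0 < (ν₀ p.1).re + p.2}

theorem eventually_paramFilter_iff {P : ℝ × ℝ → Prop} :
    (∀ᶠ p in paramFilter ν₀ δ₀, P p) ↔ ∃ ε₀ : ℝ, 0 < ε₀ ∧ ∀ ε : ℝ, 0 < ε → ε < ε₀ →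
      ∀ δ : ℝ, -δ₀ ε < δ → δ < δ₀ ε → 0 < (ν₀ ε).re + δ → P (ε, δ) := by
  unfold paramFilter
  rw [eventually_inf_principal, eventually_comap]
  constructor
  · intro h
    obtain ⟨ε₀, h0, h1⟩ := mem_nhdsGT_iff_exists_Ioo_subset.mp h
    exact ⟨ε₀, h0, fun ε e0 e1 δ d1 d2 d3 => h1 ⟨e0, e1⟩ (ε, δ) rfl ⟨d1, d2, d3⟩⟩
  · rintro ⟨ε₀, h0, h1⟩
    refine mem_nhdsGT_iff_exists_Ioo_subset.mpr ⟨ε₀, h0, ?_⟩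
    rintro ε ⟨e0, e1⟩ ⟨ε', δ⟩ rfl ⟨d1, d2, d3⟩
    exact h1 ε' e0 e1 δ d1 d2 d3

theorem tendsto_fst_paramFilter : Tendsto Prod.fst (paramFilter ν₀ δ₀) (𝓝[>] (0 : ℝ)) :=
  tendsto_comap.mono_left inf_le_left

theorem eventually_paramFilter_of {P : ℝ → Prop} (h : ∀ᶠ ε in 𝓝[>] (0 : ℝ), P ε) :
    ∀ᶠ p in paramFilter ν₀ δ₀, P p.1 := tendsto_fst_paramFilter.eventually h

/-- The real spectral parameter `ν = Re ν₀ + δ`. -/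
def realParam (ν₀ : ℝ → ℂ) (p : ℝ × ℝ) : ℝ := (ν₀ p.1).re + p.2

theorem eventually_realParam_pos : ∀ᶠ p in paramFilter ν₀ δ₀, 0 < realParam ν₀ p :=
  eventually_inf_principal.mpr (Eventually.of_forall fun _ hp => hp.2.2)

/-- The detuning `δ` itself may be unbounded; what is controlled is `εδ²`, hence also `ε|δ| ≤ 1`. -/
theorem eventually_param_small (hδ : Tendsto (fun ε => ε * δ₀ ε ^ 2) (𝓝[>] (0 : ℝ)) (𝓝 0)) :
    ∀ᶠ p in paramFilter ν₀ δ₀, 0 < p.1 ∧ p.1 + p.1 * p.2 ^ 2 ≤ 1 := by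
  have h1 : ∀ᶠ p in paramFilter ν₀ δ₀, -δ₀ p.1 < p.2 ∧ p.2 < δ₀ p.1 :=
    eventually_inf_principal.mpr (Eventually.of_forall fun _ hp => ⟨hp.1, hp.2.1⟩)
  have h2 : ∀ᶠ ε in 𝓝[>] (0 : ℝ), ε * δ₀ ε ^ 2 ≤ 1 / 2 :=
    hδ.eventually (eventually_le_nhds (by norm_num))
  have h3 : ∀ᶠ ε in 𝓝[>] (0 : ℝ), ε ≤ 1 / 2 :=
    nhdsWithin_le_nhds (eventually_le_nhds (by norm_num))
  filter_upwards [h1, eventually_paramFilter_of h2, eventually_paramFilter_of h3,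
    eventually_paramFilter_of self_mem_nhdsWithin] with p p1 p2 p3 p4
  have p4 : 0 < p.1 := p4
  refine ⟨p4, ?_⟩
  have : p.2 ^ 2 ≤ δ₀ p.1 ^ 2 := sq_le_sq' p1.1.le p1.2.le
  nlinarith

/-- Here `μ² = ε²ν²` is of order `ε(ε + εδ²)`, hence `O(ε)` uniformly in `δ`. As `k₀` and `γ` depend
on `μ` through `μ²`, they are constant up to `O(ε)`. -/
theorem eventually_realParam_le {C : ℝ} (hC : ∀ᶠ ε in 𝓝[>] (0 : ℝ), ‖ν₀ ε‖ ≤ C)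
    (hδ : Tendsto (fun ε => ε * δ₀ ε ^ 2) (𝓝[>] (0 : ℝ)) (𝓝 0)) {r : ℝ} (hr : 0 < r) :
    ∀ᶠ p in paramFilter ν₀ δ₀, (p.1 * realParam ν₀ p) ^ 2 ≤ 2 * (C ^ 2 + 1) * p.1 ∧
      p.1 * realParam ν₀ p ≤ r := by
  have h3 : ∀ᶠ ε in 𝓝[>] (0 : ℝ), ε ≤ r ^ 2 / (2 * (C ^ 2 + 1)) :=
    nhdsWithin_le_nhds (eventually_le_nhds (by positivity))
  filter_upwards [eventually_param_small hδ, eventually_paramFilter_of hC,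
    eventually_paramFilter_of h3] with p p1 p2 p3
  rw [le_div_iff₀ (by positivity)] at p3
  have hre := (Complex.abs_re_le_norm (ν₀ p.1)).trans p2
  have h1 : realParam ν₀ p ^ 2 ≤ 2 * (C ^ 2 + 1) * (1 + p.2 ^ 2) := by
    have : (ν₀ p.1).re ^ 2 ≤ C ^ 2 := sq_le_sq' (abs_le.mp hre).1 (abs_le.mp hre).2
    unfold realParam
    nlinarith [sq_nonneg ((ν₀ p.1).re - p.2), mul_nonneg (sq_nonneg C) (sq_nonneg p.2)]
  have h2 : (p.1 * realParam ν₀ p) ^ 2 ≤ 2 * (C ^ 2 + 1) * p.1 := by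
    calc (p.1 * realParam ν₀ p) ^ 2 = p.1 ^ 2 * realParam ν₀ p ^ 2 := by ring
      _ ≤ p.1 ^ 2 * (2 * (C ^ 2 + 1) * (1 + p.2 ^ 2)) := by gcongr
      _ = 2 * (C ^ 2 + 1) * p.1 * (p.1 + p.1 * p.2 ^ 2) := by ring
      _ ≤ 2 * (C ^ 2 + 1) * p.1 * 1 := by
        have := p1.1
        have := p1.2
        gcongr
      _ = _ := mul_one _
  refine ⟨h2, ?_⟩
  have h4 : (p.1 * realParam ν₀ p) ^ 2 ≤ r ^ 2 := by linarith
  exact (le_abs_self _).trans (abs_le_of_sq_le_sq h4 hr.le)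

/-- The distance `δ - iεΓ/2` to the resonance. -/
def detuning (G : ℝ) (p : ℝ × ℝ) : ℂ := (p.2 : ℂ) - Complex.I * (p.1 * G / 2 : ℝ)

theorem abs_le_norm_detuning (G : ℝ) (p : ℝ × ℝ) :
    |p.2| ≤ ‖detuning G p‖ ∧ |p.1 * G / 2| ≤ ‖detuning G p‖ := by
  have h1 := Complex.abs_re_le_norm (detuning G p)
  have h2 := Complex.abs_im_le_norm (detuning G p)
  have e1 : (detuning G p).re = p.2 := by
    simp [detuning]
  have e2 : (detuning G p).im = -(p.1 * G / 2) := by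
    simp [detuning]
  rw [e1] at h1
  rw [e2, abs_neg] at h2
  exact ⟨h1, h2⟩

theorem norm_detuning_sq (G : ℝ) (p : ℝ × ℝ) :
    ‖detuning G p‖ ^ 2 = p.2 ^ 2 + p.1 ^ 2 * G ^ 2 / 4 := by
  rw [← Complex.normSq_eq_norm_sq, Complex.normSq_apply]
  have e1 : (detuning G p).re = p.2 := by simp [detuning]
  have e2 : (detuning G p).im = -(p.1 * G / 2) := by simp [detuning]
  rw [e1, e2]
  ring

theorem breitWigner_eq {G : ℝ} {p : ℝ × ℝ} (h : 0 < p.1) (hz : detuning G p ≠ 0) :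
    breitWigner G (p.2 / p.1) = Complex.I * p.1 / detuning G p := by
  have h' : (p.1 : ℂ) ≠ 0 := by exact_mod_cast h.ne'
  have e : ((p.2 / p.1 : ℝ) : ℂ) - Complex.I * G / 2 = detuning G p / p.1 := by
    unfold detuning
    push_cast
    field_simp
  rw [breitWigner, e]
  field_simp

/-- The denominator of the scattering amplitudes is `(δ - iεΓ/2)(1 + O(ε))`. -/
theorem nearConst_denominator (hf : IsPerturbation f X) (h0 : 0 < β) (h1 : β < 1 / 2)
    (H : IsOperatorFamily T (muMax β) K)
    (hT : ∀ μ, ‖μ‖ ≤ muMax β → ∀ A m x, T μ A m x = operatorT f X β μ A m x)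
    (hν : IsResonance f X β ν₀) (hΓ : 0 < width f β)
    (hδ : Tendsto (fun ε => ε * δ₀ ε ^ 2) (𝓝[>] (0 : ℝ)) (𝓝 0)) :
    NearConst (paramFilter ν₀ δ₀) (fun p => (realParam ν₀ p -
      dispersion hf β T p.1 (p.1 * realParam ν₀ p)) / detuning (width f β) p) 1 := by
  obtain ⟨C, hC, hb⟩ := hν.bounds hf h0 h1 H hT
  obtain ⟨C₁, hC₁, hd⟩ := dispersion_bounds hf h0 h1 H
  set G := width f β with hG
  refine NearConst.of_bound (C := C₁ * (1 + 2 * C / G) * (2 * C + 2) + 2 * C / G) ?_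
  filter_upwards [eventually_paramFilter_of hb, eventually_paramFilter_of (eventually_small H.bound_pos),
    eventually_param_small hδ, eventually_realParam_le (hb.mono fun _ h => h.1) hδ H.r_pos,
    eventually_realParam_pos] with p hp hK hs hr hpos
  obtain ⟨b1, b2, b3, b4⟩ := hp
  obtain ⟨hε, hs⟩ := hs
  refine ⟨hε.le, ?_⟩
  obtain ⟨z1, z2⟩ := abs_le_norm_detuning G p
  set ν := realParam ν₀ p with hνp
  set Z := ‖detuning G p‖ with hZ
  have hε1 : p.1 ≤ 1 := by nlinarith [mul_nonneg hε.le (sq_nonneg p.2)]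
  have hεδ : p.1 * |p.2| ≤ 1 := by
    have : |p.2| ≤ 1 + p.2 ^ 2 := by nlinarith [sq_abs p.2, sq_nonneg (|p.2| - 1)]
    nlinarith
  rw [abs_of_pos (by positivity)] at z2
  have hZ0 : 0 < Z := lt_of_lt_of_le (by positivity) z2
  have hz : detuning G p ≠ 0 := norm_pos_iff.mp hZ0
  -- Here `Γ > 0` enters: `|δ - iεΓ/2| ≥ εΓ/2` converts absolute errors `ε²` into relative errors
  -- `ε`.
  have hε2 : p.1 ^ 2 ≤ 2 / G * p.1 * Z := by
    have h := mul_le_mul_of_nonneg_left z2 (by positivity : 0 ≤ 2 / G * p.1)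
    refine le_of_eq_of_le ?_ h
    field_simp
  have hε2' : C * p.1 ^ 2 ≤ 2 * C / G * p.1 * Z := by
    have := mul_le_mul_of_nonneg_left hε2 hC.le
    refine this.trans_eq ?_
    ring
  -- The distance from `ν` to the exact resonance is the detuning up to the `O(ε²)` error in `Im
  -- ν₀`.
  have hdec : (ν₀ p.1 : ℂ) - ν = -(detuning G p) + Complex.I * ((ν₀ p.1).im - p.1 * G / 2 : ℝ) := by
    apply Complex.ext
    · simp [detuning, hνp, realParam]
    · simp [detuning, hνp, realParam]
  have hdn : ‖(ν₀ p.1 : ℂ) - ν‖ ≤ (1 + 2 * C / G) * Z := by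
    rw [hdec]
    refine (norm_add_le _ _).trans ?_
    rw [norm_neg, norm_mul, Complex.norm_I, one_mul, Complex.norm_real, Real.norm_eq_abs]
    have : C * p.1 ^ 2 ≤ 2 * C / G * 1 * Z := hε2'.trans (by gcongr)
    linarith
  have hνn : ‖(ν : ℂ)‖ ≤ C + |p.2| := by
    rw [Complex.norm_real, Real.norm_eq_abs, hνp, realParam]
    exact (abs_add_le _ _).trans (add_le_add ((Complex.abs_re_le_norm _).trans b1) le_rfl)
  have hμ : ‖(p.1 : ℂ) * ν‖ ≤ muMax β := by
    rw [← Complex.ofReal_mul]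
    exact norm_ofReal_le_muMax (mul_nonneg hε.le hpos.le) hr.2
  have hΦ := (hd p.1 hε.le hK.2).2.1 _ _ b2 hμ
  -- The factor `ν₀ + ν` from the difference of squares grows with `δ`, but `ε|δ| ≤ 1` compensates
  -- it and one power of `ε` remains.
  have hsum : p.1 * (‖(ν₀ p.1 : ℂ) + ν‖ + 1) ≤ 2 * C + 2 := by
    have : ‖(ν₀ p.1 : ℂ) + ν‖ ≤ 2 * C + |p.2| := (norm_add_le _ _).trans (by linarith)
    nlinarith
  have hΦ' : ‖dispersion hf β T p.1 (p.1 * ν₀ p.1) - dispersion hf β T p.1 (p.1 * ν)‖ ≤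
      C₁ * (1 + 2 * C / G) * (2 * C + 2) * p.1 * Z := by
    refine hΦ.trans ?_
    have e1 : ((p.1 : ℂ) * ν₀ p.1) ^ 2 - (p.1 * ν) ^ 2 =
      (p.1 : ℂ) ^ 2 * ((ν₀ p.1 - ν) * (ν₀ p.1 + ν)) := by ring
    rw [e1, ← mul_sub, norm_mul, norm_mul, norm_mul, norm_pow, Complex.norm_real,
      Real.norm_of_nonneg hε.le]
    calc C₁ * (p.1 ^ 2 * (‖(ν₀ p.1 : ℂ) - ν‖ * ‖(ν₀ p.1 : ℂ) + ν‖) +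
          p.1 * (p.1 * ‖(ν₀ p.1 : ℂ) - ν‖))
        = C₁ * (p.1 * ‖(ν₀ p.1 : ℂ) - ν‖ * (p.1 * (‖(ν₀ p.1 : ℂ) + ν‖ + 1))) := by ring
      _ ≤ C₁ * (p.1 * ((1 + 2 * C / G) * Z) * (2 * C + 2)) := by gcongr
      _ = _ := by ring
  have e : (ν - dispersion hf β T p.1 (p.1 * ν)) / detuning G p - 1 =
      ((dispersion hf β T p.1 (p.1 * ν₀ p.1) - dispersion hf β T p.1 (p.1 * ν)) -
        Complex.I * ((ν₀ p.1).im - p.1 * G / 2 : ℝ)) / detuning G p := by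
    rw [← b3]
    rw [div_sub_one hz]
    congr 1
    linear_combination -hdec
  rw [e, norm_div, div_le_iff₀ hZ0]
  refine (norm_sub_le _ _).trans ?_
  rw [norm_mul, Complex.norm_I, one_mul, Complex.norm_real, Real.norm_eq_abs]
  linarith

end

section

/-! ### Asymptotics of the scattering coefficients -/

variable {f : ℝ × ℝ → ℝ} {X β K : ℝ} {T : ℂ → SeqSpace X →L[ℂ] SeqSpace X} {ν₀ : ℝ → ℂ} {δ₀ : ℝ → ℝ}

theorem nearConst_waveNumber (h0 : 0 < β) (h1 : β < 1 / 2) {C : ℝ}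
    (hC : ∀ᶠ ε in 𝓝[>] (0 : ℝ), ‖ν₀ ε‖ ≤ C)
    (hδ : Tendsto (fun ε => ε * δ₀ ε ^ 2) (𝓝[>] (0 : ℝ)) (𝓝 0)) :
    NearConst (paramFilter ν₀ δ₀) (fun p => (waveNumber β (p.1 * realParam ν₀ p) : ℂ)) (kappa β) := by
  have hκ := kappa_pos h1
  refine NearConst.of_bound (C := 2 * (C ^ 2 + 1) / kappa β) ?_
  filter_upwards [eventually_param_small hδ, eventually_realParam_pos,
    eventually_realParam_le hC hδ (muMax_pos h0 h1)] with p p1 p2 p3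
  have hμ := mul_nonneg p1.1.le p2.le
  have hk := waveNumber_pos h0 h1 hμ p3.2
  have hk2 := waveNumber_sq h0 h1 hμ p3.2
  have hκ2 : kappa β ^ 2 = 1 - 2 * β := Real.sq_sqrt (by linarith)
  refine ⟨p1.1.le, ?_⟩
  rw [← Complex.ofReal_sub, Complex.norm_real, Real.norm_eq_abs, div_mul_eq_mul_div,
    le_div_iff₀ hκ]
  generalize waveNumber β (p.1 * realParam ν₀ p) = k at hk hk2
  have e : |k - kappa β| * (k + kappa β) = (p.1 * realParam ν₀ p) ^ 2 := by
    rw [← abs_of_pos (by positivity : 0 < k + kappa β), ← abs_mul,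
      show (k - kappa β) * (k + kappa β) = -(p.1 * realParam ν₀ p) ^ 2 by linarith, abs_neg,
      abs_of_nonneg (sq_nonneg _)]
  nlinarith [abs_nonneg (k - kappa β), p3.1]

theorem nearConst_gammaC {C : ℝ} (hC : ∀ᶠ ε in 𝓝[>] (0 : ℝ), ‖ν₀ ε‖ ≤ C)
    (hδ : Tendsto (fun ε => ε * δ₀ ε ^ 2) (𝓝[>] (0 : ℝ)) (𝓝 0)) :
    NearConst (paramFilter ν₀ δ₀) (fun p => gammaC β (p.1 * realParam ν₀ p)) (gammaZero β) := by
  refine NearConst.of_bound (C := 2 * (C ^ 2 + 1)) ?_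
  filter_upwards [eventually_param_small hδ, eventually_realParam_le hC hδ one_pos] with p p1 p3
  refine ⟨p1.1.le, ?_⟩
  rw [← gammaC_zero]
  refine (norm_gammaC_sub_le β _ _).trans ?_
  rw [zero_pow two_ne_zero, sub_zero, ← Complex.ofReal_mul, norm_pow, Complex.norm_real,
    Real.norm_eq_abs, sq_abs]
  exact p3.1

/-- Expansion of the amplitude multiplied by the Breit-Wigner factor. -/
theorem exists_amplitude_expansion (hf : IsPerturbation f X) (h0 : 0 < β) (h1 : β < 1 / 2)
    (H : IsOperatorFamily T (muMax β) K)
    (hT : ∀ μ, ‖μ‖ ≤ muMax β → ∀ A m x, T μ A m x = operatorT f X β μ A m x)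
    (hν : IsResonance f X β ν₀) (hΓ : 0 < width f β)
    (hδ : Tendsto (fun ε => ε * δ₀ ε ^ 2) (𝓝[>] (0 : ℝ)) (𝓝 0)) {u : ℝ × ℝ → ℂ} {a : ℂ}
    (hu : NearConst (paramFilter ν₀ δ₀) u a) :
    ∃ C, 0 < C ∧ ∀ᶠ p in paramFilter ν₀ δ₀, ∃ e : ℂ, ‖e‖ ≤ C * (p.1 + p.1 * p.2 ^ 2) ∧
      Complex.I * gammaC β (p.1 * realParam ν₀ p) * p.1 / waveNumber β (p.1 * realParam ν₀ p) *
        amplitude hf β T p.1 (realParam ν₀ p) (u p) =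
      breitWigner (width f β) (p.2 / p.1) *
        ((gammaZero β : ℂ) ^ 2 / kappa β * expMean X (Complex.I * kappa β) (coefC hf (-1)) *
            expMean X a (coefC hf 1) +
          p.2 * expMean X (a + Complex.I * kappa β) (coefC hf 0) * (gammaZero β / kappa β) + e) := by
  set l := paramFilter ν₀ δ₀ with hl'
  have hl : Tendsto Prod.fst l (𝓝 (0 : ℝ)) := tendsto_fst_paramFilter.mono_right nhdsWithin_le_nhds
  obtain ⟨C, hC, hb⟩ := hν.bounds hf h0 h1 H hT
  have hκ := kappa_pos h1
  have hκc : (kappa β : ℂ) ≠ 0 := by exact_mod_cast hκ.ne'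
  have hbn := hb.mono fun _ h => h.1
  have nk := nearConst_waveNumber h0 h1 hbn hδ
  have nγ := nearConst_gammaC (β := β) hbn hδ
  have nD := nearConst_denominator hf h0 h1 H hT hν hΓ hδ
  have nIk := (NearConst.const l Complex.I).mul hl nk
  have hall : ∀ᶠ p in l, 0 < p.1 ∧ K * p.1 ≤ 1 / 2 ∧
      ‖(p.1 : ℂ) * (realParam ν₀ p : ℂ)‖ ≤ muMax β := by
    filter_upwards [eventually_param_small hδ,
      eventually_paramFilter_of (eventually_small H.bound_pos), eventually_realParam_pos,
      eventually_realParam_le hbn hδ (muMax_pos h0 h1)] with p p1 p2 p3 p4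
    refine ⟨p1.1, p2.2, ?_⟩
    rw [← Complex.ofReal_mul]
    exact norm_ofReal_le_muMax (mul_nonneg p1.1.le p3.le) p4.2
  have hall' := hall.mono fun p h => (⟨h.1.le, h.2⟩ : 0 ≤ p.1 ∧ K * p.1 ≤ 1 / 2 ∧
      ‖(p.1 : ℂ) * (realParam ν₀ p : ℂ)‖ ≤ muMax β)
  -- The three overlaps are the direct scattering within the open channel, the coupling of the
  -- incident wave into mode `-1`, and the coupling back out; their limits involve `f_0`, `f_{-1}`
  -- and `f_1`.
  have n11 := nearConst_modeMean_solve hf H hl hall' hu nIk 0 0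
  have n1 := nearConst_modeMean_solve hf H hl hall' (NearConst.const l 0) nIk (-1) 0
  have n2 := nearConst_modeMean_solve hf H hl hall' hu (NearConst.const l 0) 0 1
  have nG := (nγ.mul hl (nk.inv hl hκc)).mul hl n11
  have nG2 := ((nγ.mul hl (nk.inv hl hκc)).mul hl ((nγ.mul hl n1).mul hl (nD.inv hl one_ne_zero))).mul
    hl n2
  obtain ⟨c₁, hc₁, b₁⟩ := nG.exists_pos
  obtain ⟨c₂, hc₂, b₂⟩ := nG2.exists_pos
  set G := width f β with hG
  set G₀ : ℂ := gammaZero β * (kappa β : ℂ)⁻¹ *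
    expMean X (a + Complex.I * kappa β) (coefC hf (0 + 0)) with hG₀
  refine ⟨c₁ + G / 2 * (‖G₀‖ + c₁) + c₂, by positivity, ?_⟩
  filter_upwards [b₁.bound, b₂.bound, hall, nD.tendsto hl |>.eventually_ne one_ne_zero,
    eventually_param_small hδ] with p q₁ q₂ hp hD hs
  obtain ⟨hε, hs⟩ := hs
  rw [Real.norm_of_nonneg hε.le] at q₁ q₂
  set Gp := gammaC β (p.1 * realParam ν₀ p) * (waveNumber β (p.1 * realParam ν₀ p) : ℂ)⁻¹ *
    modeMean X (u p) 0 (solve ((p.1 : ℂ) • T (p.1 * realParam ν₀ p))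
      (shiftedCoef hf 0 (Complex.I * waveNumber β (p.1 * realParam ν₀ p)))) with hGp
  set G2 := gammaC β (p.1 * realParam ν₀ p) * (waveNumber β (p.1 * realParam ν₀ p) : ℂ)⁻¹ *
    (gammaC β (p.1 * realParam ν₀ p) *
      modeMean X 0 (-1) (solve ((p.1 : ℂ) • T (p.1 * realParam ν₀ p))
        (shiftedCoef hf 0 (Complex.I * waveNumber β (p.1 * realParam ν₀ p)))) *
      ((realParam ν₀ p - dispersion hf β T p.1 (p.1 * realParam ν₀ p)) / detuning G p)⁻¹) *
    modeMean X (u p) 0 (solve ((p.1 : ℂ) • T (p.1 * realParam ν₀ p)) (shiftedCoef hf 1 0)) with hG2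
  set G2₀ : ℂ := gammaZero β * (kappa β : ℂ)⁻¹ *
    (gammaZero β * expMean X (0 + Complex.I * kappa β) (coefC hf (-1 + 0)) * 1⁻¹) *
    expMean X (a + 0) (coefC hf (0 + 1)) with hG2₀
  have z2 := (abs_le_norm_detuning G p).2
  rw [abs_of_pos (by positivity)] at z2
  have hz : detuning G p ≠ 0 := norm_pos_iff.mp (lt_of_lt_of_le (by positivity) z2)
  -- Writing `z` for the detuning, `iε = W z` turns the prefactor times the amplitude into `W (z Gp
  -- + G2)`: the direct term carries `z`, while in the resonant term `z` cancels the denominator. Of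
  -- `z Gp` only `δ G₀` is kept; the error `δ (Gp - G₀)` is `O(ε|δ|)`, covered by `O(ε + εδ²)`.
  refine ⟨detuning G p * Gp + G2 - (p.2 * G₀ + G2₀), ?_, ?_⟩
  · have e : detuning G p * Gp + G2 - (p.2 * G₀ + G2₀) =
        p.2 * (Gp - G₀) - Complex.I * (p.1 * G / 2 : ℝ) * Gp + (G2 - G2₀) := by
      rw [detuning]
      ring
    have hε1 : p.1 ≤ 1 := by nlinarith [mul_nonneg hε.le (sq_nonneg p.2)]
    have hGn : ‖Gp‖ ≤ ‖G₀‖ + c₁ := by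
      have h := norm_add_le (Gp - G₀) G₀
      rw [sub_add_cancel] at h
      nlinarith
    have hδ1 : |p.2| ≤ 1 + p.2 ^ 2 := by nlinarith [sq_abs p.2, sq_nonneg (|p.2| - 1)]
    rw [e]
    refine (norm_add_le _ _).trans ((add_le_add_left (norm_sub_le _ _) _).trans ?_)
    rw [norm_mul, norm_mul, norm_mul, Complex.norm_I, one_mul, Complex.norm_real, Complex.norm_real,
      Real.norm_eq_abs, Real.norm_of_nonneg (by positivity : 0 ≤ p.1 * G / 2)]
    calc |p.2| * ‖Gp - G₀‖ + p.1 * G / 2 * ‖Gp‖ + ‖G2 - G2₀‖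
        ≤ (1 + p.2 ^ 2) * (c₁ * p.1) + p.1 * G / 2 * (‖G₀‖ + c₁) + c₂ * p.1 := by
          gcongr
      _ ≤ (1 + p.2 ^ 2) * (c₁ * p.1) + p.1 * G / 2 * (‖G₀‖ + c₁) * (1 + p.2 ^ 2) +
          c₂ * p.1 * (1 + p.2 ^ 2) := by
          have : 0 ≤ (p.1 * G / 2 * (‖G₀‖ + c₁) + c₂ * p.1) * p.2 ^ 2 := by positivity
          linarith
      _ = _ := by ring
  · have hD' : (realParam ν₀ p - dispersion hf β T p.1 (p.1 * realParam ν₀ p) : ℂ) ≠ 0 := fun h =>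
      hD (by rw [h, zero_div])
    rw [breitWigner_eq hε hz]
    have e1 : (gammaZero β : ℂ) ^ 2 / kappa β * expMean X (Complex.I * kappa β) (coefC hf (-1)) *
            expMean X a (coefC hf 1) +
          p.2 * expMean X (a + Complex.I * kappa β) (coefC hf 0) * (gammaZero β / kappa β) +
          (detuning G p * Gp + G2 - (p.2 * G₀ + G2₀)) = detuning G p * Gp + G2 := by
      rw [hG₀, hG2₀]
      simp only [zero_add, add_zero, inv_one]
      ring
    rw [e1, amplitude, hGp, hG2, inv_div]
    generalize (realParam ν₀ p - dispersion hf β T p.1 (p.1 * realParam ν₀ p) : ℂ) = D at hD'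
    field_simp

end

/-! ### The Lorentzian profile and assembly of the expansions -/

section

variable {f : ℝ × ℝ → ℝ} {X β : ℝ}

theorem conj_expMean_coefC (hf : IsPerturbation f X) (k : ℂ) (j : ℤ) :
    conj (expMean X k (coefC hf j)) = expMean X (conj k) (coefC hf (-j)) := by
  rw [expMean_apply, expMean_apply, ← integral_conj]
  congr 1
  funext x
  rw [map_mul, ← Complex.exp_conj, map_mul, Complex.conj_ofReal, coefC_apply, conj_fourierCoef]
  rfl

theorem fourierHat_neg_of_even {f : ℝ × ℝ → ℝ} (hx : ∀ x y : ℝ, f (-x, y) = f (x, y)) (j : ℤ) (ξ : ℝ) :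
    fourierHat f j (-ξ) = fourierHat f j ξ := by
  unfold fourierHat
  rw [← integral_neg_eq_self]
  congr 1
  funext x
  have : fourierCoef f j (-x) = fourierCoef f j x := by
    unfold fourierCoef
    simp only [hx]
  rw [this]
  congr 2
  push_cast
  ring

/-- If the leading coefficient has modulus `Γ/2`, the squared modulus follows the Lorentzian. -/
theorem lorentzian_bound {G C : ℝ} (hG : 0 < G) (hC : 0 ≤ C) {a b e R : ℂ} {p : ℝ × ℝ} (hε : 0 < p.1)
    (hs : p.1 + p.1 * p.2 ^ 2 ≤ 1) (ha : ‖a‖ = G / 2) (he : ‖e‖ ≤ C * (p.1 + p.1 * p.2 ^ 2))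
    (hR : R = breitWigner G (p.2 / p.1) * (a + p.2 * b + e)) :
    |‖R‖ ^ 2 - (p.1 ^ 2 * G ^ 2 / 4) / (p.2 ^ 2 + p.1 ^ 2 * G ^ 2 / 4)| ≤
      (‖b‖ + 2 * C / G + C) * (2 + (‖b‖ + 2 * C / G + C)) * p.1 := by
  obtain ⟨z1, z2⟩ := abs_le_norm_detuning G p
  have hsq := norm_detuning_sq G p
  set Z := ‖detuning G p‖ with hZ
  rw [abs_of_pos (by positivity)] at z2
  have hZ0 : 0 < Z := lt_of_lt_of_le (by positivity) z2
  have hz : detuning G p ≠ 0 := norm_pos_iff.mp hZ0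
  -- This is `|W(δ/ε)|`. Both `ρΓ ≤ 2` and `ρ|δ| ≤ ε` hold, so the factor tames the term linear in
  -- `δ` as well as the remainder.
  set ρ := p.1 / Z with hρ
  have hρ0 : 0 < ρ := by positivity
  set E : ℂ := p.2 * b + e with hE
  set B := ‖b‖ + 2 * C / G + C with hB
  have hB0 : 0 ≤ B := by positivity
  have hRn : ‖R‖ = ρ * ‖a + E‖ := by
    rw [hR, breitWigner_eq hε hz, norm_mul, norm_div, norm_mul, Complex.norm_I, one_mul,
      Complex.norm_real, Real.norm_of_nonneg hε.le, hE, add_assoc]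
  have htarget : (p.1 ^ 2 * G ^ 2 / 4) / (p.2 ^ 2 + p.1 ^ 2 * G ^ 2 / 4) = (ρ * ‖a‖) ^ 2 := by
    rw [← hsq, ha, hρ]
    field_simp
    norm_num
  have hρG : ρ * G ≤ 2 := by
    rw [hρ, div_mul_eq_mul_div, div_le_iff₀ hZ0]
    linarith
  have hρδ : ρ * |p.2| ≤ p.1 := by
    rw [hρ, div_mul_eq_mul_div, div_le_iff₀ hZ0]
    gcongr
  have hε1 : p.1 ≤ 1 := by nlinarith [mul_nonneg hε.le (sq_nonneg p.2)]
  have hεδ : p.1 * |p.2| ≤ 1 := by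
    have : |p.2| ≤ 1 + p.2 ^ 2 := by nlinarith [sq_abs p.2, sq_nonneg (|p.2| - 1)]
    nlinarith
  have hρE : ρ * ‖E‖ ≤ p.1 * B := by
    have hEn : ‖E‖ ≤ |p.2| * ‖b‖ + C * (p.1 + p.1 * p.2 ^ 2) := by
      rw [hE]
      refine (norm_add_le _ _).trans ?_
      rw [norm_mul, Complex.norm_real, Real.norm_eq_abs]
      linarith
    have hρ2 : ρ ≤ 2 / G := by rwa [le_div_iff₀ hG]
    calc ρ * ‖E‖ ≤ ρ * (|p.2| * ‖b‖ + C * (p.1 + p.1 * p.2 ^ 2)) := by gcongr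
      _ = (ρ * |p.2|) * ‖b‖ + C * (ρ * p.1 + (ρ * |p.2|) * (p.1 * |p.2|)) := by
        rw [← sq_abs p.2]
        ring
      _ ≤ p.1 * ‖b‖ + C * (2 / G * p.1 + p.1 * 1) := by gcongr
      _ = _ := by
        rw [hB]
        ring
  have habs : |‖a + E‖ - ‖a‖| ≤ ‖E‖ := by
    have := abs_norm_sub_norm_le (a + E) a
    rwa [add_sub_cancel_left] at this
  have hfac : ‖R‖ ^ 2 - (ρ * ‖a‖) ^ 2 = (ρ * (‖a + E‖ - ‖a‖)) * (ρ * (‖a + E‖ + ‖a‖)) := by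
    rw [hRn]
    ring
  have hlast : ρ * (‖a + E‖ + ‖a‖) ≤ 2 + B := by
    have h1 : ‖a + E‖ ≤ ‖a‖ + ‖E‖ := norm_add_le _ _
    have h2 : ρ * (‖a + E‖ + ‖a‖) ≤ ρ * (G + ‖E‖) := by
      rw [ha] at h1 ⊢
      exact mul_le_mul_of_nonneg_left (by linarith) hρ0.le
    nlinarith
  rw [htarget, hfac, abs_mul, abs_mul, abs_of_pos hρ0, abs_of_nonneg (by positivity :
    0 ≤ ρ * (‖a + E‖ + ‖a‖))]
  calc ρ * |‖a + E‖ - ‖a‖| * (ρ * (‖a + E‖ + ‖a‖)) ≤ (p.1 * B) * (2 + B) := by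
        refine mul_le_mul ?_ hlast (by positivity) (by positivity)
        exact (mul_le_mul_of_nonneg_left habs hρ0.le).trans hρE
    _ = _ := by ring

theorem width_pos (h1 : β < 1 / 2) (h : width f β ≠ 0) : 0 < width f β := by
  refine lt_of_le_of_ne ?_ (Ne.symm h)
  have := kappa_pos h1
  unfold width
  positivity

/-- The coefficients exist, are unique, and have the expansions of the theorem. -/
theorem exists_coefficients_asymptotics (hf : IsPerturbation f X) (h0 : 0 < β) (h1 : β < 1 / 2)
    (hΓ : 0 < width f β) {ν₀ : ℝ → ℂ} {δ₀ : ℝ → ℝ} (hν : IsResonance f X β ν₀)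
    (hδ : Tendsto (fun ε => ε * δ₀ ε ^ 2) (𝓝[>] (0 : ℝ)) (𝓝 0)) :
    ∃ C, 0 < C ∧ ∀ᶠ p in paramFilter ν₀ δ₀, ∃ Rc Tc : ℂ,
      AreScatteringCoefficients f β p.1 (p.1 * realParam ν₀ p) Rc Tc ∧
      (∀ Rc' Tc' : ℂ, AreScatteringCoefficients f β p.1 (p.1 * realParam ν₀ p) Rc' Tc' →
        Rc' = Rc ∧ Tc' = Tc) ∧
      (∃ e : ℂ, ‖e‖ ≤ C * (p.1 + p.1 * p.2 ^ 2) ∧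
        Rc = breitWigner (width f β) (p.2 / p.1) *
          ((gammaZero β ^ 2 / kappa β : ℝ) * conj (fourierHat f 1 (kappa β)) *
              fourierHat f 1 (-kappa β) +
            (p.2 : ℂ) * conj (fourierHat f 0 (2 * kappa β)) * (gammaZero β / kappa β : ℝ) + e)) ∧
      (∃ e : ℂ, ‖e‖ ≤ C * (p.1 + p.1 * p.2 ^ 2) ∧
        Tc = breitWigner (width f β) (p.2 / p.1) *
          ((p.2 : ℂ) / (Complex.I * p.1) +
            (gammaZero β ^ 2 / (2 * kappa β) *
              (‖fourierHat f 1 (kappa β)‖ ^ 2 - ‖fourierHat f 1 (-kappa β)‖ ^ 2) : ℝ) +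
            (p.2 : ℂ) * fourierHat f 0 0 * (gammaZero β / kappa β : ℝ) + e)) ∧
      ((∀ x y : ℝ, f (-x, y) = f (x, y)) →
        |‖Rc‖ ^ 2 - (p.1 ^ 2 * width f β ^ 2 / 4) / (p.2 ^ 2 + p.1 ^ 2 * width f β ^ 2 / 4)| ≤
          C * p.1) := by
  obtain ⟨K, T, H, hT⟩ := exists_operatorFamily hf h0 h1
  obtain ⟨C₀, hC₀, hb⟩ := hν.bounds hf h0 h1 H hT
  have hbn := hb.mono fun _ h => h.1
  have hl : Tendsto Prod.fst (paramFilter ν₀ δ₀) (𝓝 (0 : ℝ)) :=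
    tendsto_fst_paramFilter.mono_right nhdsWithin_le_nhds
  have nk := nearConst_waveNumber h0 h1 hbn hδ
  obtain ⟨C₁, hC₁, hR⟩ := exists_amplitude_expansion hf h0 h1 H hT hν hΓ hδ
    ((NearConst.const _ Complex.I).mul hl nk)
  obtain ⟨C₂, hC₂, hTr⟩ := exists_amplitude_expansion hf h0 h1 H hT hν hΓ hδ
    ((NearConst.const _ (-Complex.I)).mul hl nk)
  have nD := nearConst_denominator hf h0 h1 H hT hν hΓ hδ
  have f1 : expMean X (Complex.I * kappa β) (coefC hf (-1)) = conj (fourierHat f 1 (kappa β)) := by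
    rw [fourierHat_eq hf, conj_expMean_coefC]
    simp
  have f2 : expMean X (Complex.I * kappa β) (coefC hf 1) = fourierHat f 1 (-kappa β) := by
    rw [fourierHat_eq hf]
    simp
  have f3 : expMean X (Complex.I * kappa β + Complex.I * kappa β) (coefC hf 0) =
      conj (fourierHat f 0 (2 * kappa β)) := by
    rw [fourierHat_eq hf, conj_expMean_coefC]
    congr 2
    rw [map_mul, map_neg, Complex.conj_I, Complex.conj_ofReal]
    push_cast
    ring
  have f4 : expMean X (-Complex.I * kappa β) (coefC hf 1) = fourierHat f 1 (kappa β) :=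
    (fourierHat_eq hf _ _).symm
  have f5 : expMean X (-Complex.I * kappa β + Complex.I * kappa β) (coefC hf 0) = fourierHat f 0 0 := by
    rw [fourierHat_eq hf]
    simp
  simp only [f1, f2, f3] at hR
  simp only [f1, f4, f5] at hTr
  set b : ℂ := conj (fourierHat f 0 (2 * kappa β)) * (gammaZero β / kappa β : ℝ) with hbd
  set B := ‖b‖ + 2 * C₁ / width f β + C₁ with hB
  have hB0 : 0 ≤ B := by positivity
  refine ⟨C₁ + C₂ + B * (2 + B), by positivity, ?_⟩
  filter_upwards [hR, hTr, eventually_param_small hδ, eventually_realParam_pos,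
    eventually_realParam_le hbn hδ (muMax_pos h0 h1),
    eventually_paramFilter_of (eventually_small H.bound_pos),
    (nD.tendsto hl).eventually_ne one_ne_zero] with p hRp hTp hs hpos hle hK hD
  obtain ⟨hε, hs⟩ := hs
  have hD' : (realParam ν₀ p - dispersion hf β T p.1 (p.1 * realParam ν₀ p) : ℂ) ≠ 0 := fun h =>
    hD (by rw [h, zero_div])
  have hco := areScatteringCoefficients_of_dispersion hf h0 h1 H hT hε hK.2 hpos hle.2 hD'
  obtain ⟨e, he, hRe⟩ := hRp
  obtain ⟨e', he', hTe⟩ := hTp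
  have hs0 : 0 ≤ p.1 + p.1 * p.2 ^ 2 := by positivity
  have hBB : 0 ≤ B * (2 + B) := by positivity
  have hRe' := hRe.trans (show _ = breitWigner (width f β) (p.2 / p.1) *
          ((gammaZero β ^ 2 / kappa β : ℝ) * conj (fourierHat f 1 (kappa β)) *
              fourierHat f 1 (-kappa β) +
            (p.2 : ℂ) * conj (fourierHat f 0 (2 * kappa β)) * (gammaZero β / kappa β : ℝ) + e) by
    push_cast
    rfl)
  refine ⟨_, _, hco, fun R' T' h' => h'.unique hf h0 h1 (mul_pos hε hpos) hle.2 hco, ⟨e, ?_, hRe'⟩,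
    ⟨e', ?_, ?_⟩, fun hx => ?_⟩
  · refine he.trans (mul_le_mul_of_nonneg_right ?_ hs0)
    linarith
  · refine he'.trans (mul_le_mul_of_nonneg_right ?_ hs0)
    linarith
  · rw [hTe]
    have z2 := (abs_le_norm_detuning (width f β) p).2
    rw [abs_of_pos (by positivity)] at z2
    have hz : detuning (width f β) p ≠ 0 := norm_pos_iff.mp (lt_of_lt_of_le (by positivity) z2)
    have hεc : (p.1 : ℂ) ≠ 0 := by exact_mod_cast hε.ne'
    -- The transmitted incident wave `1` is written with the Breit-Wigner factor; the `-Γ/2` it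
    -- brings turns the coefficient with `|d_+|²` into half the difference `|d_+|² - |d_-|²`.
    have hone : breitWigner (width f β) (p.2 / p.1) *
        ((p.2 : ℂ) / (Complex.I * p.1) - (width f β / 2 : ℝ)) = 1 := by
      rw [breitWigner_eq hε hz, div_mul_eq_mul_div, div_eq_one_iff_eq hz, detuning, mul_sub,
        mul_div_cancel₀ _ (mul_ne_zero Complex.I_ne_zero hεc)]
      push_cast
      ring
    have hdd : conj (fourierHat f 1 (kappa β)) * fourierHat f 1 (kappa β) =
        ((‖fourierHat f 1 (kappa β)‖ ^ 2 : ℝ) : ℂ) := by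
      rw [mul_comm, Complex.mul_conj, Complex.normSq_eq_norm_sq]
    have hw : (gammaZero β ^ 2 / (2 * kappa β) *
        (‖fourierHat f 1 (kappa β)‖ ^ 2 - ‖fourierHat f 1 (-kappa β)‖ ^ 2) : ℝ) =
        gammaZero β ^ 2 / kappa β * ‖fourierHat f 1 (kappa β)‖ ^ 2 - width f β / 2 := by
      have := (kappa_pos h1).ne'
      rw [width]
      field_simp
      ring
    rw [hw]
    push_cast at hdd hone ⊢
    rw [mul_assoc ((gammaZero β : ℂ) ^ 2 / kappa β), hdd]
    linear_combination -hone
  -- Evenness in `x` gives `d_- = d_+`, so the leading coefficient has modulus exactly `Γ/2`.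
  · have heven := fourierHat_neg_of_even hx 1 (kappa β)
    have ha : ‖((gammaZero β ^ 2 / kappa β : ℝ) : ℂ) * conj (fourierHat f 1 (kappa β)) *
        fourierHat f 1 (-kappa β)‖ = width f β / 2 := by
      have := kappa_pos h1
      rw [width, heven, norm_mul, norm_mul, RCLike.norm_conj, Complex.norm_real,
        Real.norm_of_nonneg (by positivity)]
      ring
    have := lorentzian_bound (b := b) hΓ hC₁.le hε hs ha he (hRe'.trans (by rw [hbd]; ring))
    refine this.trans (mul_le_mul_of_nonneg_right ?_ hε.le)
    linarith

end

end PeriodicScattering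

end

open PeriodicScattering

theorem mainTheorem3 (f : ℝ × ℝ → ℝ) (X β : ℝ) (hX : 0 < X)
    (hf_smooth : ContDiff ℝ ∞ f)
    (hf_per : ∀ x y : ℝ, f (x, y + 2 * Real.pi) = f (x, y))
    (hf_supp : ∀ x y : ℝ, X < |x| → f (x, y) = 0)
    (hβ0 : 0 < β) (hβ1 : β < 1 / 2)
    (hΓ : width f β ≠ 0) :
    (∃ ν₀ : ℝ → ℂ, IsResonance f X β ν₀) ∧
    ∀ ν₀ : ℝ → ℂ, IsResonance f X β ν₀ →
    ∀ δ₀ : ℝ → ℝ, Tendsto (fun ε => ε * δ₀ ε ^ 2) (𝓝[>] (0 : ℝ)) (𝓝 0) →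
    ∃ C : ℝ, 0 < C ∧ ∃ ε₀ : ℝ, 0 < ε₀ ∧ ∀ ε : ℝ, 0 < ε → ε < ε₀ →
    ∀ δ : ℝ, -δ₀ ε < δ → δ < δ₀ ε → 0 < (ν₀ ε).re + δ →
    ∃ Rc Tc : ℂ,
      AreScatteringCoefficients f β ε (ε * ((ν₀ ε).re + δ)) Rc Tc ∧
      (∀ Rc' Tc' : ℂ, AreScatteringCoefficients f β ε (ε * ((ν₀ ε).re + δ)) Rc' Tc' →
        Rc' = Rc ∧ Tc' = Tc) ∧
      (∃ e : ℂ, ‖e‖ ≤ C * (ε + ε * δ ^ 2) ∧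
        Rc = breitWigner (width f β) (δ / ε) *
          ((gammaZero β ^ 2 / kappa β : ℝ) * conj (fourierHat f 1 (kappa β)) *
              fourierHat f 1 (-kappa β) +
            (δ : ℂ) * conj (fourierHat f 0 (2 * kappa β)) * (gammaZero β / kappa β : ℝ) + e)) ∧
      (∃ e : ℂ, ‖e‖ ≤ C * (ε + ε * δ ^ 2) ∧
        Tc = breitWigner (width f β) (δ / ε) *
          ((δ : ℂ) / (Complex.I * ε) +
            (gammaZero β ^ 2 / (2 * kappa β) *
              (‖fourierHat f 1 (kappa β)‖ ^ 2 - ‖fourierHat f 1 (-kappa β)‖ ^ 2) : ℝ) +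
            (δ : ℂ) * fourierHat f 0 0 * (gammaZero β / kappa β : ℝ) + e)) ∧
      ((∀ x y : ℝ, f (-x, y) = f (x, y)) → (∀ x y : ℝ, f (x, -y) = f (x, y)) →
        |‖Rc‖ ^ 2 - (ε ^ 2 * width f β ^ 2 / 4) / (δ ^ 2 + ε ^ 2 * width f β ^ 2 / 4)| ≤
          C * ε) := by
  have hf : IsPerturbation f X := ⟨hX, hf_smooth, hf_per, hf_supp⟩
  refine ⟨exists_isResonance hf hβ0 hβ1, fun ν₀ hν δ₀ hδ => ?_⟩
  obtain ⟨C, hC, h⟩ := exists_coefficients_asymptotics hf hβ0 hβ1 (width_pos hβ1 hΓ) hν hδ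
  obtain ⟨ε₀, hε₀, h⟩ := eventually_paramFilter_iff.mp h
  refine ⟨C, hC, ε₀, hε₀, fun ε h0 h1 δ d1 d2 d3 => ?_⟩
  obtain ⟨Rc, Tc, hco, huniq, hR, hT, hsymm⟩ := h ε h0 h1 δ d1 d2 d3
  exact ⟨Rc, Tc, hco, huniq, hR, hT, fun hx _ => hsymm hx⟩
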